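/- **Setting.** Let $d,J$ be integers. Vectors $\mathbf k\in\mathbb R^d$ are wavevectors, amplitudes lie in $\mathbb C^{2J}$, and $L^1=L^1(\mathbb R^d,\mathbb C^{2J})$. Let $\mathbf L(\mathbf k)$, $\mathbf k\in\mathbb R^d$, be Hermitian $2J\times 2J$ matrices, with real eigenvalues $\omega_{n,\zeta}(\mathbf k)$ and unit eigenvectors $\mathbf g_{n,\zeta}(\mathbf k)$, $n=1,\dots,J$, $\zeta=\pm$. The set $\sigma_{bc}$ of band-crossing points consists of the $\mathbf k$ at which $\omega_{n+1,\zeta}=\omega_{n,\zeta}$ for some $n,\zeta$, or $\omega_{1,\zeta}=0$ for some $\zeta$, or $\mathbf L$ is discontinuous. Assume that for $\mathbf k\notin\sigma_{bc}$: $\mathbf L\mathbf g_{n,\zeta}=\omega_{n,\zeta}\mathbf g_{n,\zeta}$; $\omega_{J,+}\ge\dots\ge\omega_{1,+}\ge0\ge\omega_{1,-}\ge\dots\ge\omega_{J,-}$; $\omega_{n,-\zeta}(-\mathbf k)=-\omega_{n,\zeta}(\mathbf k)$; the $\omega_{n,\zeta}$ are continuous and $\mathbf L$ is infinitely differentiable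 off $\sigma_{bc}$; $\sigma_{bc}$ is closed, nowhere dense and of Lebesgue measure zero; and $\|\mathbf L(\mathbf k)\|\le C(1+|\mathbf k|^p)$ for all $\mathbf k$, for some $C,p>0$. Put $\omega_n=\omega_{n,+}$, and let $\Pi_{n,\zeta}(\mathbf k)$ be the orthogonal projection onto $\mathbb C\,\mathbf g_{n,\zeta}(\mathbf k)$. Let $\mathfrak M\subset\{2,3,\dots\}$ be finite and, for $m\in\mathfrak M$, let $\chi^{(m)}(\mathbf k,\mathbf k',\dots,\mathbf k^{(m)})$ be $m$-linear maps $(\mathbb C^{2J})^m\to\mathbb C^{2J}$, infinitely differentiable in $(\mathbf k,\mathbf k',\dots,\mathbf k^{(m)})$ when none of these points lies in $\sigma_{bc}$, and with $(2\pi)^{-(m-1)d}|\chi^{(m)}|\le C_\chi$ there. Put $$\hat F(\mathbf U)(\mathbf k)=\sum_{m\in\mathfrak M}(2\pi)^{-(m-1)d}\int_{\mathbb R^{(m-1)d}}\chi^{(m)}(\mathbf k,\mathbf k',\dots,\mathbf k^{(m)})[\mathbf U(\mathbf k'),\dots,\mathbf U(\mathbf k^{(m)})]\,d\mathbf k'\cdots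 d\mathbf k^{(m-1)},\quad \mathbf k^{(m)}=\mathbf k-\mathbf k'-\dots-\mathbf k^{(m-1)}.$$ For $\varrho>0$ the integrated evolution equation on $[0,\tau_*]$, for $\hat{\mathbf u}\in C^1([0,\tau_*],L^1)$, is $$\hat{\mathbf u}(\tau)=\mathcal F(\varrho)(\hat{\mathbf u})(\tau)+\hat{\mathbf h},\qquad \mathcal F(\varrho)(\hat{\mathbf u})(\tau)=\int_0^\tau e^{\frac{i\tau'}{\varrho}\mathbf L}\hat F\bigl(e^{-\frac{i\tau'}{\varrho}\mathbf L}\hat{\mathbf u}(\tau')\bigr)\,d\tau'.\tag{1}$$ **Wavepackets.** Let $0<\epsilon<1$ and $s>0$. A family $\hat{\mathbf h}(\beta)\in L^1$ is an *$\epsilon$-wavepacket with $nk$-pair $(n,\mathbf k_*)$ and regularity degree $s$* if there are $\beta_0,C,C'>0$ such that for $0<\beta<\beta_0$: $\|\hat{\mathbf h}(\beta)\|_{L^1}\le C$ and $\hat{\mathbf h}=\hat{\mathbf h}_-+\hat{\mathbf h}_++\hat D$, where $\hat{\mathbf h}_\zeta(\beta,\mathbf k)=\Pi_{n,\zeta}(\mathbf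 k)\hat{\mathbf h}_\zeta(\beta,\mathbf k)$ and this vanishes for $|\mathbf k-\zeta\mathbf k_*|>\beta^{1-\epsilon}$, and $\|\hat D(\beta)\|_{L^1}\le C'\beta^s$. For a set $S=\{(n_l,\mathbf k_{*l})\}_{l=1}^N$ of $N$ distinct pairs, an *$\epsilon$-multi-wavepacket with $nk$-spectrum $S$ and degree $s$* is a family with $\hat{\mathbf h}(\beta)=\sum_{l=1}^N\hat{\mathbf h}_l(\beta)$ for small $\beta$, where $\hat{\mathbf h}_l$ is an $\epsilon$-wavepacket with $nk$-pair $(n_l,\mathbf k_{*l})$ and degree $s$. **Resonance invariance.** For $m\in\mathfrak M$ and $\vec\lambda=((\zeta^{(j)},l_j))_{j=1}^m\in(\{\pm1\}\times\{1,\dots,N\})^m$ put $\varkappa_m(\vec\lambda)=\sum_j\zeta^{(j)}\mathbf k_{*l_j}$. Assume that no $\mathbf k_{*l}$ and no $\varkappa_m(\vec\lambda)$ lies in $\sigma_{bc}$. $S$ is *resonance invariant* if $(n,\zeta\varkappa_m(\vec\lambda))\in S$ whenever $m\in\mathfrak M$, $\zeta=\pm1$, $1\le n\le J$ and $$-\zeta\,\omega_n(\zeta\varkappa_m(\vec\lambda))+\sum_{j=1}^m\zeta^{(j)}\omega_{n_{l_j}}(\mathbf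 k_{*l_j})=0 .$$ **Theorem 1 (multi-wavepacket preservation).** Let $S$ be resonance invariant, let $\hat{\mathbf h}(\beta)=\sum_{l=1}^N\hat{\mathbf h}_l(\beta)$, $0<\beta<\beta_1$, be an $\epsilon$-multi-wavepacket with $nk$-spectrum $S$ and regularity degree $s$, with $\|\hat{\mathbf h}_l(\beta)\|_{L^1}\le R_l$, and let $0<\rho(\beta)\le C\beta^s$ for $0<\beta<\beta_1$. Then there is $\tau_*>0$, depending (for given $d,J,\mathfrak M,C_\chi$) only on $N$ and the bounds $R_1,\dots,R_N$ of the $L^1$-norms, such that for every $0<\beta<\beta_1$ equation (1) with $\varrho=\rho(\beta)$ and data $\hat{\mathbf h}(\beta)$ has a unique solution $\hat{\mathbf u}(\tau,\beta)$ on $[0,\tau_*]$, and for every $\tau\in[0,\tau_*]$ and every $\epsilon'\in(\epsilon,1)$ the family $\beta\mapsto\hat{\mathbf u}(\tau,\beta)$ is an $\epsilon'$-multi-wavepacket with the same $nk$-spectrum $S$ and the same regularity degree $s$. The decomposition is unique up to equivalence: if $\hat{\mathbf u}(\tau,\beta)=\sum_l\hat{\mathbf u}_l(\beta)=\sum_l\hat{\mathbf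 u}_l'(\beta)$ for small $\beta$ are two decompositions into $\epsilon'$-wavepackets with $nk$-pairs $(n_l,\mathbf k_{*l})$ and degree $s$, then $\|\hat{\mathbf u}_l(\beta)-\hat{\mathbf u}_l'(\beta)\|_{L^1}=O(\beta^s)$ as $\beta\to0$ for every $l$. -/

import Mathlib

open MeasureTheory Set


noncomputable section

namespace Wavepacket

/-- The space `ℝ^d` of wavevectors. -/
abbrev KSpace (d : ℕ) : Type := EuclideanSpace ℝ (Fin d)

/-- The space `ℂ^{2J}` of amplitudes, with its Euclidean norm. -/
abbrev Amp (J : ℕ) : Type := EuclideanSpace ℂ (Fin (2 * J))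

/-- The space `L¹(ℝ^d, ℂ^{2J})`. -/
abbrev L1 (d J : ℕ) : Type := Lp (Amp J) 1 (volume : Measure (KSpace d))

/-- The sign `ζ = ±` as a real number. -/
def sgn (ζ : ℤˣ) : ℝ := ((ζ : ℤ) : ℝ)

/-! ### Linear part -/

/-- Band-crossing points of a symbol `L` with dispersion relations `ω n ζ`. Bands are numbered
from `0`, so that the lowest band is the one with `(n : ℕ) = 0`. -/
def bandCrossing {d J : ℕ} (L : KSpace d → (Amp J →L[ℂ] Amp J))
    (ω : Fin J → ℤˣ → KSpace d → ℝ) : Set (KSpace d) :=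
  {k | (∃ n n' : Fin J, (n' : ℕ) = n + 1 ∧ ∃ ζ : ℤˣ, ω n' ζ k = ω n ζ k) ∨
    ¬ ContinuousAt L k ∨
    (∃ n : Fin J, (n : ℕ) = 0 ∧ ∃ ζ : ℤˣ, ω n ζ k = 0)}

/-- The linear part: a Hermitian symbol `L k` on `ℂ^{2J}` with its eigenvalues `ω n ζ k` and its
eigenvectors `g n ζ k`. -/
structure LinearPart (d J : ℕ) where
  /-- the symbol, a Hermitian `2J × 2J` matrix seen as an operator on `ℂ^{2J}` -/
  L : KSpace d → (Amp J →L[ℂ] Amp J)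
  /-- the dispersion relations -/
  ω : Fin J → ℤˣ → KSpace d → ℝ
  /-- the eigenvectors -/
  g : Fin J → ℤˣ → KSpace d → Amp J
  isSelfAdjoint : ∀ k, IsSelfAdjoint (L k)
  eigen : ∀ k ∉ bandCrossing L ω, ∀ n ζ, L k (g n ζ k) = (ω n ζ k : ℂ) • g n ζ k
  norm_g : ∀ k ∉ bandCrossing L ω, ∀ n ζ, ‖g n ζ k‖ = 1
  ω_pos_nonneg : ∀ k ∉ bandCrossing L ω, ∀ n, 0 ≤ ω n 1 k
  ω_neg_nonpos : ∀ k ∉ bandCrossing L ω, ∀ n, ω n (-1) k ≤ 0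
  ω_pos_mono : ∀ k ∉ bandCrossing L ω, Monotone fun n => ω n 1 k
  ω_neg_anti : ∀ k ∉ bandCrossing L ω, Antitone fun n => ω n (-1) k
  ω_symm : ∀ k ∉ bandCrossing L ω, ∀ n ζ, ω n (-ζ) (-k) = -ω n ζ k
  ω_cont : ∀ n ζ, ContinuousOn (ω n ζ) (bandCrossing L ω)ᶜ
  isClosed_bc : IsClosed (bandCrossing L ω)
  isNowhereDense_bc : IsNowhereDense (bandCrossing L ω)
  volume_bc : volume (bandCrossing L ω) = 0
  L_smooth : ContDiffOn ℝ ((⊤ : ℕ∞) : WithTop ℕ∞) L (bandCrossing L ω)ᶜ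
  L_bound : ∃ C p : ℝ, 0 < C ∧ 0 < p ∧ ∀ k, ‖L k‖ ≤ C * (1 + ‖k‖ ^ p)

namespace LinearPart

variable {d J : ℕ} (A : LinearPart d J)

/-- The set of band-crossing points of the linear part. -/
def bc : Set (KSpace d) := bandCrossing A.L A.ω

/-- The orthogonal projection of `ℂ^{2J}` onto the complex line spanned by `g n ζ k`. -/
def proj (n : Fin J) (ζ : ℤˣ) (k : KSpace d) : Amp J →L[ℂ] Amp J :=
  (Submodule.span ℂ {A.g n ζ k}).starProjection

/-- The unitary operator `exp (i θ L(k))`. -/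
def flow (θ : ℝ) (k : KSpace d) : Amp J →L[ℂ] Amp J :=
  NormedSpace.exp ((Complex.I * (θ : ℂ)) • A.L k)

end LinearPart

/-! ### Nonlinear part -/

/-- The susceptibilities: for each degree `m`, an `m`-linear map depending on
`(k, k', …, k^(m))`. -/
abbrev Susceptibility (d J : ℕ) : Type :=
  (m : ℕ) → KSpace d → (Fin m → KSpace d) →
    ContinuousMultilinearMap ℂ (fun _ : Fin m => Amp J) (Amp J)

/-- Smoothness of the susceptibilities of degrees `m ∈ M` away from band-crossing points, and their
boundedness by the constant `Cχ`. -/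
structure IsAdmissible {d J : ℕ} (A : LinearPart d J) (M : Finset ℕ) (Cχ : ℝ)
    (χ : Susceptibility d J) : Prop where
  smooth : ∀ m ∈ M, ContDiffOn ℝ ((⊤ : ℕ∞) : WithTop ℕ∞)
    (fun p : KSpace d × (Fin m → KSpace d) => χ m p.1 p.2)
    {p | p.1 ∉ A.bc ∧ ∀ j, p.2 j ∉ A.bc}
  bound : ∀ m ∈ M, ∀ k ∉ A.bc, ∀ q : Fin m → KSpace d, (∀ j, q j ∉ A.bc) →
    ((2 * Real.pi) ^ ((m - 1) * d))⁻¹ * ‖χ m k q‖ ≤ Cχ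

/-- The vector `(k', …, k^(m-1), k - k' - … - k^(m-1))`. -/
def wavevectors {d : ℕ} (m : ℕ) (k : KSpace d) (q : Fin (m - 1) → KSpace d) :
    Fin m → KSpace d :=
  fun i => if hi : (i : ℕ) < m - 1 then q ⟨i, hi⟩ else k - ∑ j, q j

/-- The nonlinearity in Fourier form,
`F̂(U)(k) = ∑_{m ∈ M} (2π)^{-(m-1)d} ∫ χ^(m)(k, k', …, k^(m)) [U(k'), …, U(k^(m))] dk' … dk^(m-1)`
with `k^(m) = k - k' - … - k^(m-1)`. -/
def nonlin {d J : ℕ} (M : Finset ℕ) (χ : Susceptibility d J) (U : KSpace d → Amp J)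
    (k : KSpace d) : Amp J :=
  ∑ m ∈ M, ((2 * Real.pi) ^ ((m - 1) * d))⁻¹ •
    ∫ q : Fin (m - 1) → KSpace d,
      χ m k (wavevectors m k q) (fun i => U (wavevectors m k q i))

/-- The integrand `exp (iτL/ϱ) F̂(exp (-iτL/ϱ) v)` of the operator `𝓕(ϱ)`. -/
def rate {d J : ℕ} (A : LinearPart d J) (M : Finset ℕ) (χ : Susceptibility d J) (ϱ τ : ℝ)
    (v : KSpace d → Amp J) (k : KSpace d) : Amp J :=
  A.flow (τ / ϱ) k (nonlin M χ (fun k' => A.flow (-(τ / ϱ)) k' (v k')) k)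

/-- `u` is a solution on `[0, T]`, continuously differentiable with values in `L¹`, of the
integrated equation
`u(τ) = ∫_0^τ exp (iτ'L/ϱ) F̂(exp (-iτ'L/ϱ) u(τ')) dτ' + h`.
Here `G` is the integrand, which is an `L¹`-valued function of time; the time integral is the
Bochner integral in `L¹`. -/
def IsSolution {d J : ℕ} (A : LinearPart d J) (M : Finset ℕ) (χ : Susceptibility d J)
    (ϱ : ℝ) (h : L1 d J) (T : ℝ) (u : ℝ → L1 d J) : Prop :=
  ContinuousOn u (Icc 0 T) ∧
  ∃ G : ℝ → L1 d J, ContinuousOn G (Icc 0 T) ∧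
    (∀ τ ∈ Icc 0 T, ⇑(G τ) =ᵐ[volume] rate A M χ ϱ τ (u τ)) ∧
    ∀ τ ∈ Icc 0 T, u τ = (∫ τ' in (0 : ℝ)..τ, G τ') + h

/-! ### Wavepackets -/

/-- The cutoff function: the indicator function of the closed unit ball. -/
def cutoff {d : ℕ} (η : KSpace d) : ℝ :=
  open Classical in if ‖η‖ ≤ 1 then 1 else 0

/-- The shifted and rescaled cutoff `Ψ(k; k₀, r) = Ψ(r⁻¹ (k - k₀))`. -/
def cutoffAt {d : ℕ} (k₀ : KSpace d) (r : ℝ) (k : KSpace d) : ℝ :=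
  cutoff (r⁻¹ • (k - k₀))

/-- `h`, a family of elements of `L¹` indexed by `β`, is a wavepacket with `nk`-pair `p`, degree of
regularity `s` and localization parameter `ε`. In the decomposition, `f 1`, `f (-1)` and `D` are the
components `ĥ₊`, `ĥ₋` and the tail. -/
def IsWavepacket {d J : ℕ} (A : LinearPart d J) (ε s : ℝ) (p : Fin J × KSpace d)
    (h : ℝ → L1 d J) : Prop :=
  ∃ β₀ : ℝ, 0 < β₀ ∧
    (∃ C : ℝ, ∀ β ∈ Ioo 0 β₀, ‖h β‖ ≤ C) ∧
    ∃ (f : ℤˣ → ℝ → L1 d J) (D : ℝ → L1 d J),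
      (∀ β ∈ Ioo 0 β₀, h β = f (-1) β + f 1 β + D β) ∧
      (∀ ζ : ℤˣ, ∀ β ∈ Ioo 0 β₀, ∀ᵐ k : KSpace d,
        f ζ β k = cutoffAt (sgn ζ • p.2) (β ^ (1 - ε)) k • A.proj p.1 ζ k (f ζ β k)) ∧
      ∃ C' : ℝ, ∀ β ∈ Ioo 0 β₀, ‖D β‖ ≤ C' * β ^ s

/-- `h = ∑_l w_l` for small `β`, where `w_l` is a wavepacket with `nk`-pair `S l` and degree of
regularity `s`. -/
def IsPresentation {d J N : ℕ} (A : LinearPart d J) (ε s : ℝ) (S : Fin N → Fin J × KSpace d)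
    (h : ℝ → L1 d J) (w : Fin N → ℝ → L1 d J) : Prop :=
  (∀ l, IsWavepacket A ε s (S l) (w l)) ∧
  ∃ β₀ : ℝ, 0 < β₀ ∧ ∀ β ∈ Ioo 0 β₀, h β = ∑ l, w l β

/-- `h` is a multi-wavepacket with `nk`-spectrum `{S l}` and degree of regularity `s`. -/
def IsMultiWavepacket {d J N : ℕ} (A : LinearPart d J) (ε s : ℝ)
    (S : Fin N → Fin J × KSpace d) (h : ℝ → L1 d J) : Prop :=
  ∃ w : Fin N → ℝ → L1 d J, IsPresentation A ε s S h w

/-- Equivalence of degree `s`: the two families differ by `O(β^s)` in `L¹`. -/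
def Equivalent {d J : ℕ} (s : ℝ) (h₁ h₂ : ℝ → L1 d J) : Prop :=
  ∃ β₀ C : ℝ, 0 < β₀ ∧ ∀ β ∈ Ioo 0 β₀, ‖h₁ β - h₂ β‖ ≤ C * β ^ s

/-! ### Resonance invariance -/

section Resonance

variable {d J N : ℕ}

/-- `ϰ_m(λ) = ∑_j ζ^(j) k_{*l_j}` for `λ = ((ζ^(1), l_1), …, (ζ^(m), l_m))`. -/
def kappa (S : Fin N → Fin J × KSpace d) {m : ℕ} (lam : Fin m → ℤˣ × Fin N) : KSpace d :=
  ∑ j, sgn (lam j).1 • (S (lam j).2).2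

/-- The output `k`-spectrum. -/
def outK (M : Finset ℕ) (S : Fin N → Fin J × KSpace d) : Set (KSpace d) :=
  {k | ∃ m ∈ M, ∃ lam : Fin m → ℤˣ × Fin N, k = kappa S lam}

/-- The output `nk`-spectrum. -/
def outNK (M : Finset ℕ) (S : Fin N → Fin J × KSpace d) : Set (Fin J × KSpace d) :=
  {p | p.2 ∈ outK M S}

/-- The resonance equation `-ζ ω_n(ζ ϰ_m(λ)) + ∑_j ζ^(j) ω_{n_{l_j}}(k_{*l_j}) = 0`, where
`ω_n = ω_{n,+}`. -/
def IsResonant (A : LinearPart d J) (S : Fin N → Fin J × KSpace d) {m : ℕ} (ζ : ℤˣ) (n : Fin J)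
    (lam : Fin m → ℤˣ × Fin N) : Prop :=
  -(sgn ζ * A.ω n 1 (sgn ζ • kappa S lam)) +
    ∑ j, sgn (lam j).1 * A.ω (S (lam j).2).1 1 (S (lam j).2).2 = 0

/-- The resonant output spectrum. -/
def resOut (A : LinearPart d J) (M : Finset ℕ) (S : Fin N → Fin J × KSpace d) :
    Set (Fin J × KSpace d) :=
  {p ∈ outNK M S | ∃ m ∈ M, ∃ (ζ : ℤˣ) (lam : Fin m → ℤˣ × Fin N),
    p.2 = sgn ζ • kappa S lam ∧ IsResonant A S ζ p.1 lam}

/-- The resonance selection operation. -/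
def resSelect (A : LinearPart d J) (M : Finset ℕ) (S : Fin N → Fin J × KSpace d) :
    Set (Fin J × KSpace d) :=
  range S ∪ resOut A M S

/-- Resonance invariance of the `nk`-spectrum. -/
def ResonanceInvariant (A : LinearPart d J) (M : Finset ℕ) (S : Fin N → Fin J × KSpace d) : Prop :=
  resSelect A M S = range S

/-- No wavevector of the spectrum and no wavevector of its output `k`-spectrum is a band-crossing
point. -/
def NonSingular (A : LinearPart d J) (M : Finset ℕ) (S : Fin N → Fin J × KSpace d) : Prop :=
  (∀ l, (S l).2 ∉ A.bc) ∧ outK M S ∩ A.bc = ∅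

end Resonance

end Wavepacket

end

noncomputable section

namespace Wavepacket

/-! ### Multiplication and convolution-type integrals on L¹. -/

section

open scoped ENNReal
open Filter Topology

variable {d J : ℕ}

/-! ### Multiplication operators on `L¹` -/

/-! The linear oscillation is absorbed in the unknown, so the equation is an ODE u' = F_θ(u) in L¹
with θ = τ/ϱ and F_θ = e^{iθL} F̂ e^{-iθL}. Bounded kernels give bounded m-linear operators on L¹
and e^{iθL} is unitary. Hence F_θ is bounded and Lipschitz on balls uniformly in θ, and Picard
iteration gives a solution on a time interval independent of β and ϱ (`exists_exact_solution`);
uniqueness is Gronwall (`eqOn_of_isSolution`).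

To see the wavepacket structure, the exact solution is compared with a superposition w = ∑ w_i of
components indexed by i = (ζ, l). Each w_i lies in band (n_l, ζ) and in the ball of radius r =
β^(1-ε') about ζk_{*l}. It is written as e^{-a|k - center|} v_i with a = β^(-(1-ε)), and the v_i
solve the ODE obtained by projecting the nonlinearity onto the localized components. The weights
cost nothing: the inputs of an interaction contribute at most e^{-a|k - κ|} by the triangle
inequality, and for small r an output in the ball of i forces κ to be the centre of i, so the output
weight is cancelled (`norm_locKer_le`). The data live in the smaller ball of radius β^(1-ε), where
the weight is at most e, so the lifespan of the v_i does not depend on β or ε'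
(`exists_weighted_data`, `exists_localized_solution`).

The defect of w in the exact equation is the part of F_θ(w) outside the localized components. It
splits into interactions with a fixed output band and fixed inputs. If the pair (n, ζκ) belongs to
S, the ball about κ has been projected away and the rest carries a factor e^{-ar} =
exp(-β^{-(ε'-ε)}), smaller than any power of β. If it does not belong to S, resonance invariance
keeps the interaction phase away from 0, and integration by parts in time gains a factor ϱ = O(β^s)
(`exists_interaction_bound`). Thus the time-integrated defect is O(β^s), and a Gronwall argument
that needs only this integral gives ‖u - w‖ = O(β^s) (`norm_sub_le_of_integral_defect`,
`exists_localized_approximation`).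

Uniqueness of the decomposition is a projection argument: for small β the localized spectral
projections of different components annihilate each other. Hence each component of a difference is
recovered from the sum, which is O(β^s) (`equivalent_of_isPresentation`). -/

theorem MemLp_top_ae_le {α E : Type*} [MeasurableSpace α] {μ : Measure α} [NormedAddCommGroup E]
    {a : α → E} (ha : MemLp a ∞ μ) : ∀ᵐ x ∂μ, ‖a x‖ ≤ (eLpNorm a ∞ μ).toReal := by
  filter_upwards [ae_le_eLpNormEssSup (f := a) (μ := μ)] with x hx
  have h := ENNReal.toReal_mono ha.2.ne (by simpa using hx)
  simpa using h

theorem integrable_mul {a : KSpace d → Amp J →L[ℂ] Amp J} (ha : MemLp a ∞ volume) (f : L1 d J) :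
    Integrable (fun k => a k (f k)) volume := by
  have hf := L1.integrable_coeFn f
  refine (hf.norm.const_mul (eLpNorm a ∞ volume).toReal).mono'
    ((ContinuousLinearMap.id ℂ (Amp J →L[ℂ] Amp J)).aestronglyMeasurable_comp₂ ha.1 hf.1) ?_
  filter_upwards [MemLp_top_ae_le ha] with k hk
  exact (a k).le_of_opNorm_le hk _

open Classical in
/-- Multiplication by a bounded measurable operator-valued function, as an operator on `L¹`. -/
def mulOp (a : KSpace d → Amp J →L[ℂ] Amp J) : L1 d J →L[ℂ] L1 d J :=
  if ha : MemLp a ∞ volume then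
    LinearMap.mkContinuous
      { toFun := fun f => (integrable_mul ha f).toL1 _
        map_add' := fun f g => by
          rw [← Integrable.toL1_add, Integrable.toL1_eq_toL1_iff]
          filter_upwards [Lp.coeFn_add f g] with k hk
          change a k ((f + g) k) = a k (f k) + a k (g k)
          rw [hk, Pi.add_apply, map_add]
        map_smul' := fun c f => by
          rw [RingHom.id_apply, ← Integrable.toL1_smul, Integrable.toL1_eq_toL1_iff]
          filter_upwards [Lp.coeFn_smul c f] with k hk
          change a k ((c • f) k) = c • a k (f k)
          rw [hk, Pi.smul_apply, map_smul] }
      (eLpNorm a ∞ volume).toReal (fun f => by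
        simp only [LinearMap.coe_mk, AddHom.coe_mk]
        rw [L1.norm_eq_integral_norm, L1.norm_eq_integral_norm, ← integral_const_mul]
        refine integral_mono_ae (L1.integrable_coeFn _).norm
          ((L1.integrable_coeFn f).norm.const_mul _) ?_
        filter_upwards [MemLp_top_ae_le ha, (integrable_mul ha f).coeFn_toL1] with k hk hk'
        simp only [hk']
        exact (a k).le_of_opNorm_le hk _)
  else 0

theorem mulOp_coeFn {a : KSpace d → Amp J →L[ℂ] Amp J} (ha : MemLp a ∞ volume) (f : L1 d J) :
    mulOp a f =ᵐ[volume] fun k => a k (f k) := by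
  rw [mulOp, dif_pos ha]
  exact (integrable_mul ha f).coeFn_toL1

theorem norm_L1_le_of_ae {f g : L1 d J} {C : ℝ} (h : ∀ᵐ k, ‖f k‖ ≤ C * ‖g k‖) :
    ‖f‖ ≤ C * ‖g‖ := by
  rw [L1.norm_eq_integral_norm, L1.norm_eq_integral_norm, ← integral_const_mul]
  exact integral_mono_ae (L1.integrable_coeFn _).norm ((L1.integrable_coeFn g).norm.const_mul _) h

theorem norm_mulOp_apply_le {a : KSpace d → Amp J →L[ℂ] Amp J} (ha : MemLp a ∞ volume) {C : ℝ}
    (hC : ∀ᵐ k, ‖a k‖ ≤ C) (f : L1 d J) : ‖mulOp a f‖ ≤ C * ‖f‖ := by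
  refine norm_L1_le_of_ae ?_
  filter_upwards [mulOp_coeFn ha f, hC] with k hk hk'
  rw [hk]
  exact (a k).le_of_opNorm_le hk' _

theorem memLp_top_of_ae_le {α E : Type*} [MeasurableSpace α] {μ : Measure α} [NormedAddCommGroup E]
    {a : α → E} (ha : AEStronglyMeasurable a μ) {C : ℝ} (hC : ∀ᵐ x ∂μ, ‖a x‖ ≤ C) :
    MemLp a ∞ μ := memLp_top_of_bound ha C hC

theorem memLp_top_clm_comp {α E F G : Type*} [MeasurableSpace α] {μ : Measure α}
    [NormedAddCommGroup E] [NormedSpace ℂ E] [NormedAddCommGroup F] [NormedSpace ℂ F]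
    [NormedAddCommGroup G] [NormedSpace ℂ G]
    {a : α → F →L[ℂ] G} {b : α → E →L[ℂ] F} (ha : MemLp a ∞ μ) (hb : MemLp b ∞ μ) :
    MemLp (fun k => (a k).comp (b k)) ∞ μ := by
  refine memLp_top_of_ae_le
    ((ContinuousLinearMap.compL ℂ E F G).aestronglyMeasurable_comp₂ ha.1 hb.1)
    (C := (eLpNorm a ∞ μ).toReal * (eLpNorm b ∞ μ).toReal) ?_
  filter_upwards [MemLp_top_ae_le ha, MemLp_top_ae_le hb] with k h1 h2
  exact (ContinuousLinearMap.opNorm_comp_le _ _).trans (by gcongr)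

/-! ### The change of variables to independent wavevectors -/

/-- Up to a relabelling of coordinates the map is the shear (q, k) ↦ (q, k - ∑ q), whose fibre maps
are translations. It makes the m arguments independent variables. -/
theorem measurePreserving_wavevectors {m : ℕ} (hm : 1 ≤ m) :
    MeasurePreserving (fun z : KSpace d × (Fin (m - 1) → KSpace d) => wavevectors m z.1 z.2)
      volume volume := by
  obtain ⟨n, rfl⟩ : ∃ n, m = n + 1 := ⟨m - 1, by omega⟩
  change MeasurePreserving (fun z : KSpace d × (Fin n → KSpace d) => wavevectors (n + 1) z.1 z.2)
      volume volume
  have h1 : MeasurePreserving (fun z : (Fin n → KSpace d) × KSpace d => (z.1, z.2 - ∑ j, z.1 j))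
      (volume.prod volume) (volume.prod volume) := by
    refine (MeasurePreserving.id (volume : Measure (Fin n → KSpace d))).skew_product
      (g := fun (q : Fin n → KSpace d) k => k - ∑ j, q j) ?_ ?_
    · simp only [Function.uncurry_def]
      fun_prop
    · refine Eventually.of_forall fun q => ?_
      exact (measurePreserving_sub_right volume (∑ j, q j)).map_eq
  have h2 := (volume_preserving_piFinSuccAbove (fun _ : Fin (n + 1) => KSpace d) (Fin.last n)).symm
  have h3 := h2.comp (Measure.measurePreserving_swap.comp (h1.comp Measure.measurePreserving_swap))
  have h4 : (fun z : KSpace d × (Fin n → KSpace d) => wavevectors (n + 1) z.1 z.2) =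
      (MeasurableEquiv.piFinSuccAbove (fun _ => KSpace d) (Fin.last n)).symm ∘
      Prod.swap ∘ (fun z : (Fin n → KSpace d) × KSpace d => (z.1, z.2 - ∑ j, z.1 j)) ∘
        Prod.swap := by
    funext z i
    simp only [wavevectors, Function.comp_apply, Prod.swap,
      MeasurableEquiv.piFinSuccAbove_symm_apply]
    refine Fin.lastCases ?_ (fun j => ?_) i
    · simp
    · simp
  rw [h4]
  exact h3

theorem quasiMeasurePreserving_wavevectors_apply {m : ℕ} (i : Fin m) :
    Measure.QuasiMeasurePreserving
      (fun z : KSpace d × (Fin (m - 1) → KSpace d) => wavevectors m z.1 z.2 i)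
      volume volume :=
  (Measure.quasiMeasurePreserving_eval (fun _ : Fin m => (volume : Measure (KSpace d))) i).comp
    (measurePreserving_wavevectors (Fin.pos i)).quasiMeasurePreserving

theorem sum_wavevectors {m : ℕ} (hm : 1 ≤ m) (k : KSpace d) (q : Fin (m - 1) → KSpace d) :
    ∑ i, wavevectors m k q i = k := by
  obtain ⟨n, rfl⟩ : ∃ n, m = n + 1 := ⟨m - 1, by omega⟩
  rw [Fin.sum_univ_castSucc]
  simp [wavevectors]

theorem integrable_prod_norm {m : ℕ} (v : Fin m → L1 d J) :
    Integrable (fun p : Fin m → KSpace d => ∏ i, ‖v i (p i)‖) volume :=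
  Integrable.fintype_prod (f := fun (i : Fin m) k => ‖v i k‖)
    fun i => (L1.integrable_coeFn (v i)).norm

theorem integrable_prod_norm_wavevectors {m : ℕ} (hm : 1 ≤ m) (v : Fin m → L1 d J) :
    Integrable (fun z : KSpace d × (Fin (m - 1) → KSpace d) =>
      ∏ i, ‖v i (wavevectors m z.1 z.2 i)‖) volume := by
  have h := measurePreserving_wavevectors (d := d) hm
  have h1 := integrable_prod_norm v
  rw [← h.map_eq] at h1
  exact h1.comp_measurable h.measurable

theorem integral_prod_norm {m : ℕ} (v : Fin m → L1 d J) :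
    ∫ p : Fin m → KSpace d, ∏ i, ‖v i (p i)‖ = ∏ i, ‖v i‖ := by
  simp only [L1.norm_eq_integral_norm]
  exact integral_fintype_prod_volume_eq_prod (fun (i : Fin m) k => ‖v i k‖)

/-- Young's inequality for m factors in L¹, in its sharp form: after the change of variables it is
Fubini. -/
theorem integral_prod_norm_wavevectors {m : ℕ} (hm : 1 ≤ m) (v : Fin m → L1 d J) :
    ∫ z : KSpace d × (Fin (m - 1) → KSpace d), ∏ i, ‖v i (wavevectors m z.1 z.2 i)‖ =
      ∏ i, ‖v i‖ := by
  have h := measurePreserving_wavevectors (d := d) hm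
  have h1 : AEStronglyMeasurable (fun p : Fin m → KSpace d => ∏ i, ‖v i (p i)‖) volume :=
    (integrable_prod_norm v).1
  have h2 := integral_map h.measurable.aemeasurable (h.map_eq.symm ▸ h1)
  rw [h.map_eq] at h2
  rw [← integral_prod_norm, h2]

end

section

open scoped ENNReal
open Filter Topology

variable {d J : ℕ}

/-! ### Multilinear integral operators on `L¹` -/

/-- The space of `(k, k', …, k^(m-1))`. -/
abbrev ZSpace (d m : ℕ) : Type := KSpace d × (Fin (m - 1) → KSpace d)

/-- Integral kernels with values in `m`-linear maps. -/
abbrev Ker (d J m : ℕ) : Type :=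
  ZSpace d m → ContinuousMultilinearMap ℂ (fun _ : Fin m => Amp J) (Amp J)

/-- The arguments `(k', …, k^(m))` at which the inputs are evaluated. -/
abbrev wv {d m : ℕ} (z : ZSpace d m) : Fin m → KSpace d := wavevectors m z.1 z.2

variable {m : ℕ}

theorem memLp_top_add {α E : Type*} [MeasurableSpace α] {μ : Measure α} [NormedAddCommGroup E]
    {f g : α → E} (hf : MemLp f ∞ μ) (hg : MemLp g ∞ μ) : MemLp (f + g) ∞ μ := hf.add hg

theorem memLp_top_sub {α E : Type*} [MeasurableSpace α] {μ : Measure α} [NormedAddCommGroup E]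
    {f g : α → E} (hf : MemLp f ∞ μ) (hg : MemLp g ∞ μ) : MemLp (f - g) ∞ μ := hf.sub hg

theorem memLp_top_zero {α E : Type*} [MeasurableSpace α] {μ : Measure α} [NormedAddCommGroup E] :
    MemLp (0 : α → E) ∞ μ := MemLp.zero

theorem memLp_top_sum {α E ι : Type*} [MeasurableSpace α] {μ : Measure α} [NormedAddCommGroup E]
    (s : Finset ι) {f : ι → α → E} (hf : ∀ i ∈ s, MemLp (f i) ∞ μ) : MemLp (∑ i ∈ s, f i) ∞ μ :=
  memLp_finsetSum' s hf

theorem aestronglyMeasurable_comp_wv {E : Type*} [TopologicalSpace E] {f : KSpace d → E}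
    (hf : AEStronglyMeasurable f volume) (i : Fin m) :
    AEStronglyMeasurable (fun z : ZSpace d m => f (wv z i)) volume :=
  hf.comp_quasiMeasurePreserving (quasiMeasurePreserving_wavevectors_apply i)

theorem ae_wv {p : KSpace d → Prop} (hp : ∀ᵐ k, p k) :
    ∀ᵐ z : ZSpace d m, ∀ i, p (wv z i) :=
  ae_all_iff.2 fun i => (quasiMeasurePreserving_wavevectors_apply i).ae hp

theorem ae_fst {p : KSpace d → Prop} (hp : ∀ᵐ k, p k) : ∀ᵐ z : ZSpace d m, p z.1 :=
  Measure.quasiMeasurePreserving_fst.ae hp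

/-- The integrand `K(k, q) [v₁(k'), …, v_m(k^(m))]`. -/
def kerEval (K : Ker d J m) (v : Fin m → L1 d J) (z : ZSpace d m) : Amp J :=
  K z fun i => v i (wv z i)

theorem integrable_ker (hm : 1 ≤ m) {K : Ker d J m} (hK : MemLp K ∞ volume)
    (v : Fin m → L1 d J) : Integrable (kerEval K v) volume := by
  refine ((integrable_prod_norm_wavevectors hm v).const_mul (eLpNorm K ∞ volume).toReal).mono'
    ?_ ?_
  · have h : AEStronglyMeasurable (fun z : ZSpace d m => fun i => v i (wv z i)) volume := by
      refine (aemeasurable_pi_lambda _ fun i => ?_).aestronglyMeasurable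
      exact (aestronglyMeasurable_comp_wv (Lp.aestronglyMeasurable (v i)) i).aemeasurable
    have hc : Continuous fun p : (ContinuousMultilinearMap ℂ (fun _ : Fin m => Amp J) (Amp J)) ×
        (Fin m → Amp J) => p.1 p.2 := continuous_fst.eval continuous_snd
    exact hc.comp_aestronglyMeasurable (hK.1.prodMk h)
  · filter_upwards [MemLp_top_ae_le hK] with z hz
    exact (K z).le_of_opNorm_le hz _

theorem integral_norm_integral_le {f : ZSpace d m → Amp J} (hf : Integrable f volume) :
    ∫ k, ‖∫ q, f (k, q)‖ ≤ ∫ z, ‖f z‖ := by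
  have h := integral_prod _ hf.norm
  refine le_trans ?_ h.ge
  exact integral_mono_ae (Integrable.integral_prod_left hf).norm
    (Integrable.integral_prod_left hf.norm)
    (Eventually.of_forall fun k => norm_integral_le_integral_norm _)

theorem integrable_integral_ker (hm : 1 ≤ m) {K : Ker d J m} (hK : MemLp K ∞ volume)
    (v : Fin m → L1 d J) :
    Integrable (fun k => ∫ q, kerEval K v (k, q)) volume :=
  (integrable_ker hm hK v).integral_prod_left

theorem integral_norm_ker_le (hm : 1 ≤ m) {K : Ker d J m} (hK : MemLp K ∞ volume)
    (v : Fin m → L1 d J) :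
    ∫ k, ‖∫ q, kerEval K v (k, q)‖ ≤
      ∫ z, ‖K z‖ * ∏ i, ‖v i (wv z i)‖ := by
  refine (integral_norm_integral_le (integrable_ker hm hK v)).trans ?_
  refine integral_mono_ae (integrable_ker hm hK v).norm ?_
    (Eventually.of_forall fun z => (K z).le_opNorm _)
  refine ((integrable_prod_norm_wavevectors hm v).const_mul (eLpNorm K ∞ volume).toReal).mono'
    (hK.1.norm.mul (integrable_prod_norm_wavevectors hm v).1) ?_
  filter_upwards [MemLp_top_ae_le hK] with z hz
  rw [norm_mul, norm_norm, Real.norm_of_nonneg (by positivity)]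
  gcongr

theorem integral_ae_congr {f g : ZSpace d m → Amp J} (h : f =ᵐ[volume] g) :
    (fun k => ∫ q, f (k, q)) =ᵐ[volume] fun k => ∫ q, g (k, q) := by
  filter_upwards [Measure.ae_ae_of_ae_prod h] with k hk
  exact integral_congr_ae hk

theorem integral_ae_add {f g : ZSpace d m → Amp J} (hf : Integrable f volume)
    (hg : Integrable g volume) :
    (fun k => ∫ q, (f (k, q) + g (k, q))) =ᵐ[volume]
      fun k => (∫ q, f (k, q)) + ∫ q, g (k, q) := by
  filter_upwards [hf.prod_right_ae, hg.prod_right_ae] with k hk hk'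
  exact integral_add hk hk'

open Classical in
/-- The `m`-linear operator `v ↦ ∫ K(k, q) [v₁(k'), …, v_m(k^(m))] dq` on `L¹`. -/
def kerOp (m : ℕ) (K : Ker d J m) : ContinuousMultilinearMap ℂ (fun _ : Fin m => L1 d J) (L1 d J) :=
  if h : 1 ≤ m ∧ MemLp K ∞ volume then
    MultilinearMap.mkContinuous
      { toFun := fun v => (integrable_integral_ker h.1 h.2 v).toL1 _
        map_update_add' := fun {inst} v i x y => by
          rw [← Integrable.toL1_add, Integrable.toL1_eq_toL1_iff]
          refine EventuallyEq.trans (integral_ae_congr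
            (f := kerEval K (Function.update v i (x + y)))
            (g := fun z => kerEval K (Function.update v i x) z +
              kerEval K (Function.update v i y) z) ?_)
            (integral_ae_add (integrable_ker h.1 h.2 _) (integrable_ker h.1 h.2 _))
          filter_upwards [ae_wv (Lp.coeFn_add x y)] with z hz
          -- Updating a slot in L¹ and then evaluating agrees with updating the tuple of values, so
          -- additivity reduces to that of the pointwise multilinear map.
          have key : ∀ u : L1 d J,
              (fun j => (Function.update v i u j : KSpace d → Amp J) (wv z j)) =
              Function.update (fun j => v j (wv z j)) i (u (wv z i)) := by
            intro u
            funext j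
            by_cases hj : j = i
            · subst hj; simp
            · simp [hj]
          simp only [kerEval]
          rw [key, key, key, hz i]
          simp
        map_update_smul' := fun {inst} v i c x => by
          rw [← Integrable.toL1_smul, Integrable.toL1_eq_toL1_iff]
          refine EventuallyEq.trans (integral_ae_congr
            (f := kerEval K (Function.update v i (c • x)))
            (g := fun z => c • kerEval K (Function.update v i x) z) ?_)
            (Eventually.of_forall fun k => integral_smul _ _)
          filter_upwards [ae_wv (Lp.coeFn_smul c x)] with z hz
          have key : ∀ u : L1 d J,
              (fun j => (Function.update v i u j : KSpace d → Amp J) (wv z j)) =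
              Function.update (fun j => v j (wv z j)) i (u (wv z i)) := by
            intro u
            funext j
            by_cases hj : j = i
            · subst hj; simp
            · simp [hj]
          simp only [kerEval]
          rw [key, key, hz i]
          simp }
      (eLpNorm K ∞ volume).toReal (fun v => by
        simp only [MultilinearMap.coe_mk]
        rw [L1.norm_eq_integral_norm]
        refine (integral_congr_ae
          ((integrable_integral_ker h.1 h.2 v).coeFn_toL1.fun_comp norm)).trans_le ?_
        refine (integral_norm_ker_le h.1 h.2 v).trans ?_
        rw [← integral_prod_norm_wavevectors h.1, ← integral_const_mul]
        refine integral_mono_of_nonneg (Eventually.of_forall fun z => by positivity)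
          ((integrable_prod_norm_wavevectors h.1 v).const_mul _) ?_
        filter_upwards [MemLp_top_ae_le h.2] with z hz
        gcongr)
  else 0

theorem kerOp_coeFn (hm : 1 ≤ m) {K : Ker d J m} (hK : MemLp K ∞ volume) (v : Fin m → L1 d J) :
    kerOp m K v =ᵐ[volume] fun k => ∫ q, kerEval K v (k, q) := by
  rw [kerOp, dif_pos ⟨hm, hK⟩]
  exact (integrable_integral_ker hm hK v).coeFn_toL1

/-- The norm of the kernel is kept under the integral, so that dominated convergence can be applied
to kernels that converge only pointwise. -/
theorem norm_kerOp_apply_le_integral (hm : 1 ≤ m) {K : Ker d J m} (hK : MemLp K ∞ volume)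
    (v : Fin m → L1 d J) : ‖kerOp m K v‖ ≤ ∫ z, ‖K z‖ * ∏ i, ‖v i (wv z i)‖ := by
  rw [L1.norm_eq_integral_norm]
  exact (integral_congr_ae ((kerOp_coeFn hm hK v).fun_comp norm)).trans_le
    (integral_norm_ker_le hm hK v)

theorem norm_kerOp_le (hm : 1 ≤ m) {K : Ker d J m} (hK : MemLp K ∞ volume) {C : ℝ} (hC : 0 ≤ C)
    (h : ∀ᵐ z, ‖K z‖ ≤ C) : ‖kerOp m K‖ ≤ C := by
  refine ContinuousMultilinearMap.opNorm_le_bound hC fun v => ?_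
  refine (norm_kerOp_apply_le_integral hm hK v).trans ?_
  rw [← integral_prod_norm_wavevectors hm, ← integral_const_mul]
  refine integral_mono_of_nonneg (Eventually.of_forall fun z => by positivity)
    ((integrable_prod_norm_wavevectors hm v).const_mul _) ?_
  filter_upwards [h] with z hz
  gcongr

theorem kerOp_congr (hm : 1 ≤ m) {K K' : Ker d J m} (hK : MemLp K ∞ volume)
    (h : K =ᵐ[volume] K') : kerOp m K = kerOp m K' := by
  ext1 v
  refine Lp.ext ((kerOp_coeFn hm hK v).trans (EventuallyEq.trans ?_
    (kerOp_coeFn hm (hK.ae_eq h) v).symm))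
  refine integral_ae_congr (f := kerEval K v) (g := kerEval K' v) ?_
  filter_upwards [h] with z hz
  rw [kerEval, kerEval, hz]

theorem kerOp_add (hm : 1 ≤ m) {K K' : Ker d J m} (hK : MemLp K ∞ volume)
    (hK' : MemLp K' ∞ volume) : kerOp m (K + K') = kerOp m K + kerOp m K' := by
  have hKK : MemLp (K + K') ∞ volume := memLp_top_add hK hK'
  ext1 v
  refine Lp.ext ((kerOp_coeFn hm hKK v).trans ?_)
  refine (integral_ae_add (integrable_ker hm hK v) (integrable_ker hm hK' v)).trans ?_
  filter_upwards [kerOp_coeFn hm hK v, kerOp_coeFn hm hK' v,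
    Lp.coeFn_add (kerOp m K v) (kerOp m K' v)] with k h1 h2 h3
  rw [_root_.add_apply, h3, Pi.add_apply, h1, h2]

theorem kerOp_smul (hm : 1 ≤ m) {K : Ker d J m} (hK : MemLp K ∞ volume) (c : ℂ) :
    kerOp m (c • K) = c • kerOp m K := by
  ext1 v
  refine Lp.ext ((kerOp_coeFn hm (hK.const_smul c) v).trans ?_)
  filter_upwards [kerOp_coeFn hm hK v, Lp.coeFn_smul c (kerOp m K v)] with k h1 h3
  rw [_root_.smul_apply, h3, Pi.smul_apply, h1, ← integral_smul]
  rfl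

theorem kerOp_sub (hm : 1 ≤ m) {K K' : Ker d J m} (hK : MemLp K ∞ volume)
    (hK' : MemLp K' ∞ volume) : kerOp m (K - K') = kerOp m K - kerOp m K' := by
  refine eq_sub_of_add_eq ?_
  rw [← kerOp_add hm (memLp_top_sub hK hK') hK', sub_add_cancel]

/-- Composition of a kernel with operator-valued multipliers on the left. -/
def Ker.lmul (a : KSpace d → Amp J →L[ℂ] Amp J) (K : Ker d J m) : Ker d J m :=
  fun z => (a z.1).compContinuousMultilinearMap (K z)

/-- Composition of a kernel with operator-valued multipliers on the right. -/
def Ker.rmul (K : Ker d J m) (b : Fin m → KSpace d → Amp J →L[ℂ] Amp J) : Ker d J m :=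
  fun z => (K z).compContinuousLinearMap fun i => b i (wv z i)

theorem Ker.norm_lmul_le (a : KSpace d → Amp J →L[ℂ] Amp J) (K : Ker d J m) (z : ZSpace d m) :
    ‖K.lmul a z‖ ≤ ‖a z.1‖ * ‖K z‖ :=
  ContinuousLinearMap.norm_compContinuousMultilinearMap_le _ _

theorem Ker.norm_rmul_le (K : Ker d J m) (b : Fin m → KSpace d → Amp J →L[ℂ] Amp J)
    (z : ZSpace d m) : ‖K.rmul b z‖ ≤ ‖K z‖ * ∏ i, ‖b i (wv z i)‖ :=
  ContinuousMultilinearMap.norm_compContinuousLinearMap_le _ _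

theorem Ker.memLp_lmul {a : KSpace d → Amp J →L[ℂ] Amp J} (ha : MemLp a ∞ volume) {K : Ker d J m}
    (hK : MemLp K ∞ volume) : MemLp (K.lmul a) ∞ volume := by
  have ha' : AEStronglyMeasurable (fun z : ZSpace d m => a z.1) volume :=
    ha.1.comp_quasiMeasurePreserving Measure.quasiMeasurePreserving_fst
  have hc : Continuous fun p : (Amp J →L[ℂ] Amp J) ×
      (ContinuousMultilinearMap ℂ (fun _ : Fin m => Amp J) (Amp J)) =>
      p.1.compContinuousMultilinearMap p.2 :=
    (ContinuousLinearMap.compContinuousMultilinearMapL ℂ (fun _ : Fin m => Amp J) (Amp J)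
      (Amp J)).isBoundedBilinearMap.continuous
  refine memLp_top_of_ae_le (hc.comp_aestronglyMeasurable (ha'.prodMk hK.1))
    (C := (eLpNorm a ∞ volume).toReal * (eLpNorm K ∞ volume).toReal) ?_
  filter_upwards [ae_fst (MemLp_top_ae_le ha), MemLp_top_ae_le hK] with z h1 h2
  exact (Ker.norm_lmul_le a K z).trans (by gcongr)

theorem Ker.memLp_rmul {b : Fin m → KSpace d → Amp J →L[ℂ] Amp J}
    (hb : ∀ i, MemLp (b i) ∞ volume) {K : Ker d J m}
    (hK : MemLp K ∞ volume) : MemLp (K.rmul b) ∞ volume := by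
  have hb' : AEStronglyMeasurable (fun z : ZSpace d m => fun i => b i (wv z i)) volume := by
    borelize (Amp J →L[ℂ] Amp J)
    refine (aemeasurable_pi_lambda _ fun i => ?_).aestronglyMeasurable
    exact (aestronglyMeasurable_comp_wv (hb i).1 i).aemeasurable
  have hc : Continuous fun p : (ContinuousMultilinearMap ℂ (fun _ : Fin m => Amp J) (Amp J)) ×
      (Fin m → Amp J →L[ℂ] Amp J) => p.1.compContinuousLinearMap p.2 :=
    continuous_iff_continuousAt.2 fun p =>
      (ContinuousMultilinearMap.hasStrictFDerivAt_compContinuousLinearMap p).continuousAt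
  refine memLp_top_of_ae_le (hc.comp_aestronglyMeasurable (hK.1.prodMk hb'))
    (C := (eLpNorm K ∞ volume).toReal * ∏ i, (eLpNorm (b i) ∞ volume).toReal) ?_
  have h3 : ∀ᵐ z : ZSpace d m, ∀ i, ‖b i (wv z i)‖ ≤ (eLpNorm (b i) ∞ volume).toReal :=
    ae_all_iff.2 fun i => (quasiMeasurePreserving_wavevectors_apply i).ae (MemLp_top_ae_le (hb i))
  filter_upwards [h3, MemLp_top_ae_le hK] with z h1 h2
  exact (Ker.norm_rmul_le K b z).trans (by gcongr; exact h1 _)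

theorem mulOp_kerOp (hm : 1 ≤ m) {a : KSpace d → Amp J →L[ℂ] Amp J} (ha : MemLp a ∞ volume)
    {K : Ker d J m} (hK : MemLp K ∞ volume) (v : Fin m → L1 d J) :
    mulOp a (kerOp m K v) = kerOp m (K.lmul a) v := by
  refine Lp.ext ((mulOp_coeFn ha _).trans (EventuallyEq.trans ?_
    (kerOp_coeFn hm (Ker.memLp_lmul ha hK) v).symm))
  filter_upwards [kerOp_coeFn hm hK v, (integrable_ker hm hK v).prod_right_ae] with k h1 h2
  rw [h1]
  exact ((a k).integral_comp_comm h2).symm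

theorem kerOp_mulOp (hm : 1 ≤ m) {b : Fin m → KSpace d → Amp J →L[ℂ] Amp J}
    (hb : ∀ i, MemLp (b i) ∞ volume)
    {K : Ker d J m} (hK : MemLp K ∞ volume) (v : Fin m → L1 d J) :
    kerOp m K (fun i => mulOp (b i) (v i)) = kerOp m (K.rmul b) v := by
  refine Lp.ext ((kerOp_coeFn hm hK _).trans (EventuallyEq.trans ?_
    (kerOp_coeFn hm (Ker.memLp_rmul hb hK) v).symm))
  refine integral_ae_congr (f := kerEval K fun i => mulOp (b i) (v i))
    (g := kerEval (K.rmul b) v) ?_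
  have h3 : ∀ᵐ z : ZSpace d m, ∀ i, mulOp (b i) (v i) (wv z i) = b i (wv z i) (v i (wv z i)) :=
    ae_all_iff.2 fun i =>
      (quasiMeasurePreserving_wavevectors_apply i).ae (mulOp_coeFn (hb i) (v i))
  filter_upwards [h3] with z hz
  change K z (fun i => mulOp (b i) (v i) (wv z i)) = K z fun i => b i (wv z i) (v i (wv z i))
  simp only [hz]

/-- Dominated convergence for fixed inputs. Strong convergence is what can be expected for the
conjugated nonlinearity: the symbol `L` may be unbounded, so the flow need not be norm continuous in
θ as a multiplier. -/
theorem tendsto_kerOp (hm : 1 ≤ m) {ι : Type*} {l : Filter ι} [l.IsCountablyGenerated]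
    {K : ι → Ker d J m} {K₀ : Ker d J m} (hK : ∀ t, MemLp (K t) ∞ volume)
    (hK₀ : MemLp K₀ ∞ volume) {C : ℝ} (hC : ∀ t, ∀ᵐ z, ‖K t z‖ ≤ C)
    (h : ∀ᵐ z, Tendsto (fun t => K t z) l (𝓝 (K₀ z))) (v : Fin m → L1 d J) :
    Tendsto (fun t => kerOp m (K t) v) l (𝓝 (kerOp m K₀ v)) := by
  rw [tendsto_iff_norm_sub_tendsto_zero]
  have e : ∀ t, kerOp m (K t) v - kerOp m K₀ v = kerOp m (K t - K₀) v := fun t => by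
    rw [kerOp_sub hm (hK t) hK₀]; rfl
  simp only [e]
  have hlim : Tendsto (fun t => ∫ z, ‖(K t - K₀) z‖ * ∏ i, ‖v i (wv z i)‖) l (𝓝 0) := by
    rw [show (0 : ℝ) = ∫ z : ZSpace d m, (0 : ℝ) by simp]
    refine tendsto_integral_filter_of_dominated_convergence
      (fun z => (C + (eLpNorm K₀ ∞ volume).toReal) * ∏ i, ‖v i (wv z i)‖)
      (Eventually.of_forall fun t =>
        (memLp_top_sub (hK t) hK₀).1.norm.mul (integrable_prod_norm_wavevectors hm v).1)
      (Eventually.of_forall fun t => ?_)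
      ((integrable_prod_norm_wavevectors hm v).const_mul _) ?_
    · filter_upwards [hC t, MemLp_top_ae_le hK₀] with z h1 h2
      rw [norm_mul, norm_norm, Real.norm_of_nonneg (by positivity)]
      gcongr
      exact (norm_sub_le _ _).trans (add_le_add h1 h2)
    · filter_upwards [h] with z hz
      have := (tendsto_iff_norm_sub_tendsto_zero.1 hz).mul_const (∏ i, ‖v i (wv z i)‖)
      simpa using this
  exact squeeze_zero (fun _ => norm_nonneg _)
    (fun t => norm_kerOp_apply_le_integral hm (memLp_top_sub (hK t) hK₀) v) hlim

end

section

open scoped ENNReal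
open Filter Topology

variable {d J : ℕ}

/-! ### Spectral calculus away from band-crossing points -/

theorem norm_exp_I_mul_smul_le {H : Type*} [NormedAddCommGroup H] [InnerProductSpace ℂ H]
    [CompleteSpace H] {T : H →L[ℂ] H} (hT : IsSelfAdjoint T) (θ : ℝ) :
    ‖NormedSpace.exp ((Complex.I * (θ : ℂ)) • T)‖ ≤ 1 := by
  have hT' : IsSelfAdjoint ((θ : ℂ) • T) := by
    have hθ : star (θ : ℂ) = θ := Complex.conj_ofReal θ
    rw [IsSelfAdjoint, star_smul, hT.star_eq, hθ]
  have h := selfAdjoint.expUnitary_coe (⟨(θ : ℂ) • T, hT'⟩ : selfAdjoint (H →L[ℂ] H))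
  refine ContinuousLinearMap.opNorm_le_bound _ zero_le_one fun x => ?_
  rw [one_mul, mul_smul]
  change _ = NormedSpace.exp (Complex.I • (θ : ℂ) • T) at h
  rw [← h]
  exact (ContinuousLinearMap.norm_map_of_mem_unitary (SetLike.coe_mem _) x).le

theorem exp_apply_eigenvector {H : Type*} [NormedAddCommGroup H] [NormedSpace ℂ H]
    [CompleteSpace H] {T : H →L[ℂ] H} {c : ℂ} {x : H} (h : T x = c • x) :
    NormedSpace.exp T x = Complex.exp c • x := by
  have hpow : ∀ j : ℕ, (T ^ j) x = c ^ j • x := by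
    intro j
    induction j with
    | zero => simp
    | succ j ih =>
      rw [pow_succ, ContinuousLinearMap.mul_def, ContinuousLinearMap.comp_apply, h, map_smul, ih,
        smul_smul, pow_succ', ]
  have h1 := (NormedSpace.exp_series_hasSum_exp' (𝕂 := ℂ) T).mapL
    (ContinuousLinearMap.apply ℂ H x)
  have h2 := (NormedSpace.exp_series_hasSum_exp' (𝕂 := ℂ) c).smul_const x
  rw [Complex.exp_eq_exp_ℂ]
  refine h1.unique ?_
  convert h2 using 2 with j
  rw [ContinuousLinearMap.apply_apply, _root_.smul_apply, hpow, smul_smul, smul_eq_mul]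

namespace LinearPart

variable (A : LinearPart d J) {k : KSpace d}

theorem ω_pos_of_notMem (hk : k ∉ A.bc) (n : Fin J) : 0 < A.ω n 1 k := by
  have hJ : 0 < J := n.pos
  have h0 : 0 < A.ω ⟨0, hJ⟩ 1 k := by
    refine lt_of_le_of_ne (A.ω_pos_nonneg k hk _) fun h => hk ?_
    exact Or.inr (Or.inr ⟨⟨0, hJ⟩, rfl, 1, h.symm⟩)
  exact h0.trans_le (A.ω_pos_mono k hk (Fin.mk_le_of_le_val (Nat.zero_le _)))

theorem ω_neg_of_notMem (hk : k ∉ A.bc) (n : Fin J) : A.ω n (-1) k < 0 := by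
  have hJ : 0 < J := n.pos
  have h0 : A.ω ⟨0, hJ⟩ (-1) k < 0 := by
    refine lt_of_le_of_ne (A.ω_neg_nonpos k hk _) fun h => hk ?_
    exact Or.inr (Or.inr ⟨⟨0, hJ⟩, rfl, -1, h⟩)
  exact (A.ω_neg_anti k hk (Fin.mk_le_of_le_val (Nat.zero_le _))).trans_lt h0

theorem ω_ne_succ (hk : k ∉ A.bc) {n n' : Fin J} (h : (n' : ℕ) = n + 1) (ζ : ℤˣ) :
    A.ω n' ζ k ≠ A.ω n ζ k := fun he => hk (Or.inl ⟨n, n', h, ζ, he⟩)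

/-- Off the band-crossing set only adjacent bands are known to differ; the ordering of the bands
propagates this to all pairs of the same sign. -/
theorem ω_ne_of_lt (hk : k ∉ A.bc) {n n' : Fin J} (h : n < n') (ζ : ℤˣ) :
    A.ω n ζ k ≠ A.ω n' ζ k := by
  have hlt : (n : ℕ) + 1 < J := lt_of_le_of_lt h n'.2
  have hle : (⟨n + 1, hlt⟩ : Fin J) ≤ n' := h
  have hle' : n ≤ (⟨n + 1, hlt⟩ : Fin J) := Nat.le_succ _
  have hne := A.ω_ne_succ hk (n := n) (n' := ⟨n + 1, hlt⟩) rfl ζ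
  rcases Int.units_eq_one_or ζ with rfl | rfl
  · have h1 := A.ω_pos_mono k hk hle
    have h2 := A.ω_pos_mono k hk hle'
    exact ((lt_of_le_of_ne h2 hne.symm).trans_le h1).ne
  · have h1 := A.ω_neg_anti k hk hle
    have h2 := A.ω_neg_anti k hk hle'
    exact (h1.trans_lt (lt_of_le_of_ne h2 hne)).ne'

theorem ω_injective (hk : k ∉ A.bc) :
    Function.Injective fun p : Fin J × ℤˣ => A.ω p.1 p.2 k := by
  rintro ⟨n, ζ⟩ ⟨n', ζ'⟩ h
  simp only at h
  have hζ : ζ = ζ' := by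
    rcases Int.units_eq_one_or ζ with rfl | rfl <;> rcases Int.units_eq_one_or ζ' with rfl | rfl
    · rfl
    · exact absurd h ((A.ω_neg_of_notMem hk n').trans (A.ω_pos_of_notMem hk n)).ne'
    · exact absurd h ((A.ω_neg_of_notMem hk n).trans (A.ω_pos_of_notMem hk n')).ne
    · rfl
  subst hζ
  rcases lt_trichotomy n n' with hn | rfl | hn
  · exact absurd h (A.ω_ne_of_lt hk hn ζ)
  · rfl
  · exact absurd h.symm (A.ω_ne_of_lt hk hn ζ)

/-- The 2J eigenvalues are distinct, because the lowest bands separate the two signs from 0;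
eigenvectors of a Hermitian operator with distinct eigenvalues are orthogonal. -/
theorem orthonormal_g (hk : k ∉ A.bc) :
    Orthonormal ℂ fun p : Fin J × ℤˣ => A.g p.1 p.2 k := by
  refine ⟨fun p => A.norm_g k hk _ _, fun p q hpq => ?_⟩
  have hne : (A.ω p.1 p.2 k : ℂ) ≠ A.ω q.1 q.2 k := fun h =>
    hpq (A.ω_injective hk (Complex.ofReal_injective h))
  have h1 := (A.isSelfAdjoint k).isSymmetric (A.g p.1 p.2 k) (A.g q.1 q.2 k)
  simp only [ContinuousLinearMap.coe_coe] at h1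
  rw [A.eigen k hk, A.eigen k hk, inner_smul_left, inner_smul_right, Complex.conj_ofReal] at h1
  by_contra h0
  exact hne (mul_right_cancel₀ h0 h1)

theorem card_bands : Fintype.card (Fin J × ℤˣ) = 2 * J := by
  rw [Fintype.card_prod, Fintype.card_fin, Fintype.card_units_int, mul_comm]

/-- The orthonormal eigenbasis at a regular point. -/
def eigenbasis (hk : k ∉ A.bc) : OrthonormalBasis (Fin J × ℤˣ) ℂ (Amp J) :=
  OrthonormalBasis.mk (A.orthonormal_g hk) (by
    rw [(A.orthonormal_g hk).linearIndependent.span_eq_top_of_card_eq_finrank']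
    rw [card_bands, finrank_euclideanSpace_fin])

theorem eigenbasis_apply (hk : k ∉ A.bc) (p : Fin J × ℤˣ) :
    A.eigenbasis hk p = A.g p.1 p.2 k := by
  simp [eigenbasis]

theorem proj_apply (hk : k ∉ A.bc) (n : Fin J) (ζ : ℤˣ) (x : Amp J) :
    A.proj n ζ k x = inner ℂ (A.g n ζ k) x • A.g n ζ k := by
  rw [proj, Submodule.starProjection_unit_singleton ℂ (A.norm_g k hk n ζ)]

theorem proj_g_self (hk : k ∉ A.bc) (n : Fin J) (ζ : ℤˣ) :
    A.proj n ζ k (A.g n ζ k) = A.g n ζ k := by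
  rw [A.proj_apply hk, inner_self_eq_norm_sq_to_K, A.norm_g k hk]
  simp

theorem proj_g_of_ne (hk : k ∉ A.bc) {n n' : Fin J} {ζ ζ' : ℤˣ} (h : (n, ζ) ≠ (n', ζ')) :
    A.proj n ζ k (A.g n' ζ' k) = 0 := by
  rw [A.proj_apply hk, (A.orthonormal_g hk).2 h, zero_smul]

theorem norm_proj_le (n : Fin J) (ζ : ℤˣ) (k : KSpace d) : ‖A.proj n ζ k‖ ≤ 1 :=
  Submodule.starProjection_norm_le _

theorem proj_proj_self (n : Fin J) (ζ : ℤˣ) (k : KSpace d) (x : Amp J) :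
    A.proj n ζ k (A.proj n ζ k x) = A.proj n ζ k x :=
  Submodule.starProjection_eq_self_iff.2 (Submodule.starProjection_apply_mem _ x)

theorem proj_proj_of_ne (hk : k ∉ A.bc) {n n' : Fin J} {ζ ζ' : ℤˣ} (h : (n, ζ) ≠ (n', ζ'))
    (x : Amp J) : A.proj n ζ k (A.proj n' ζ' k x) = 0 := by
  rw [A.proj_apply hk n' ζ', map_smul, A.proj_g_of_ne hk h, smul_zero]

theorem sum_proj (hk : k ∉ A.bc) (x : Amp J) :
    ∑ p : Fin J × ℤˣ, A.proj p.1 p.2 k x = x := by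
  conv_rhs => rw [← (A.eigenbasis hk).sum_repr' x]
  refine Finset.sum_congr rfl fun p _ => ?_
  rw [A.proj_apply hk, eigenbasis_apply]

theorem ext_g (hk : k ∉ A.bc) {E : Type*} [NormedAddCommGroup E] [NormedSpace ℂ E]
    {T T' : Amp J →L[ℂ] E} (h : ∀ p : Fin J × ℤˣ, T (A.g p.1 p.2 k) = T' (A.g p.1 p.2 k)) :
    T = T' := by
  refine ContinuousLinearMap.coe_injective ((A.eigenbasis hk).toBasis.ext fun p => ?_)
  simpa [eigenbasis_apply] using h p

/-- The Lagrange polynomial expression of the spectral projection. -/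
def lagrangeProj (p : Fin J × ℤˣ) (k : KSpace d) : Amp J →L[ℂ] Amp J :=
  (((Finset.univ.erase p).toList).map fun q =>
    (((A.ω p.1 p.2 k - A.ω q.1 q.2 k : ℝ) : ℂ)⁻¹) •
      (A.L k - ((A.ω q.1 q.2 k : ℝ) : ℂ) • (1 : Amp J →L[ℂ] Amp J))).prod

theorem lagrangeProj_g (hk : k ∉ A.bc) (r : Fin J × ℤˣ) (l : List (Fin J × ℤˣ))
    (c : Fin J × ℤˣ → ℂ) :
    (l.map fun q => c q • (A.L k - ((A.ω q.1 q.2 k : ℝ) : ℂ) • (1 : Amp J →L[ℂ] Amp J))).prod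
      (A.g r.1 r.2 k) =
    (l.map fun q => c q * (((A.ω r.1 r.2 k : ℝ) : ℂ) - (A.ω q.1 q.2 k : ℝ))).prod •
      A.g r.1 r.2 k := by
  induction l with
  | nil => simp
  | cons q l ih =>
    simp only [List.map_cons, List.prod_cons]
    have : (A.L k - ((A.ω q.1 q.2 k : ℝ) : ℂ) • (1 : Amp J →L[ℂ] Amp J)) (A.g r.1 r.2 k) =
        (((A.ω r.1 r.2 k : ℝ) : ℂ) - (A.ω q.1 q.2 k : ℝ)) • A.g r.1 r.2 k := by
      rw [_root_.sub_apply, A.eigen k hk, sub_smul]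
      rfl
    rw [ContinuousLinearMap.mul_def, ContinuousLinearMap.comp_apply, ih, map_smul,
      _root_.smul_apply, this, smul_smul, smul_smul]
    congr 1
    ring

theorem lagrangeProj_eq (hk : k ∉ A.bc) (p : Fin J × ℤˣ) :
    A.lagrangeProj p k = A.proj p.1 p.2 k := by
  refine A.ext_g hk fun r => ?_
  rw [lagrangeProj, A.lagrangeProj_g hk]
  by_cases hr : r = p
  · subst hr
    rw [A.proj_g_self hk, List.prod_eq_one, one_smul]
    intro x hx
    obtain ⟨q, hq, rfl⟩ := List.mem_map.1 hx
    rw [← Complex.ofReal_sub]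
    refine inv_mul_cancel₀ ?_
    rw [Complex.ofReal_ne_zero, sub_ne_zero]
    exact fun h => (Finset.ne_of_mem_erase (Finset.mem_toList.1 hq)) (A.ω_injective hk h).symm
  · rw [A.proj_g_of_ne hk (Ne.symm hr), List.prod_eq_zero, zero_smul]
    refine List.mem_map.2 ⟨r, Finset.mem_toList.2 (Finset.mem_erase.2 ⟨hr, Finset.mem_univ _⟩), ?_⟩
    simp

/-- No continuity of the eigenvectors is assumed. The Lagrange formula writes the projection through
`L` and the eigenvalues alone, which are continuous and distinct there. -/
theorem continuousOn_proj (n : Fin J) (ζ : ℤˣ) : ContinuousOn (A.proj n ζ) A.bcᶜ := by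
  have h : ContinuousOn (A.lagrangeProj (n, ζ)) A.bcᶜ := by
    refine continuousOn_list_prod _ fun q hq => ?_
    have hω : ∀ q : Fin J × ℤˣ, ContinuousOn (fun k => ((A.ω q.1 q.2 k : ℝ) : ℂ)) A.bcᶜ :=
      fun q => Complex.continuous_ofReal.comp_continuousOn (A.ω_cont q.1 q.2)
    have h1 : ContinuousOn (fun k => A.L k - ((A.ω q.1 q.2 k : ℝ) : ℂ) •
        (1 : Amp J →L[ℂ] Amp J)) A.bcᶜ :=
      A.L_smooth.continuousOn.sub ((hω q).smul continuousOn_const)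
    have h2 : ContinuousOn (fun k => (((A.ω n ζ k - A.ω q.1 q.2 k : ℝ) : ℂ)⁻¹)) A.bcᶜ := by
      refine ContinuousOn.inv₀ (Complex.continuous_ofReal.comp_continuousOn
        ((A.ω_cont n ζ).sub (A.ω_cont q.1 q.2))) fun k hk => ?_
      rw [Complex.ofReal_ne_zero, sub_ne_zero]
      exact fun h => (Finset.ne_of_mem_erase (Finset.mem_toList.1 hq)) (A.ω_injective hk h).symm
    exact h2.smul h1
  exact h.congr fun k hk => (A.lagrangeProj_eq hk (n, ζ)).symm

theorem ae_notMem_bc : ∀ᵐ k : KSpace d, k ∉ A.bc :=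
  measure_eq_zero_iff_ae_notMem.1 A.volume_bc

/-- The band-crossing set is closed and null, so restricting Lebesgue measure to its complement
changes nothing. -/
theorem aestronglyMeasurable_of_continuousOn {E : Type*} [TopologicalSpace E]
    [TopologicalSpace.PseudoMetrizableSpace E] {f : KSpace d → E}
    (hf : ContinuousOn f A.bcᶜ) : AEStronglyMeasurable f volume := by
  have h := hf.aestronglyMeasurable (μ := volume) A.isClosed_bc.measurableSet.compl
  have h0 : ∀ᵐ k : KSpace d, k ∈ A.bcᶜ := A.ae_notMem_bc
  rwa [Measure.restrict_eq_self_of_ae_mem h0] at h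

theorem memLp_proj (n : Fin J) (ζ : ℤˣ) : MemLp (A.proj n ζ) ∞ volume :=
  memLp_top_of_ae_le (A.aestronglyMeasurable_of_continuousOn (A.continuousOn_proj n ζ))
    (Eventually.of_forall (A.norm_proj_le n ζ))

theorem norm_flow_le (θ : ℝ) (k : KSpace d) : ‖A.flow θ k‖ ≤ 1 :=
  norm_exp_I_mul_smul_le (A.isSelfAdjoint k) θ

theorem continuous_exp_clm : Continuous fun T : Amp J →L[ℂ] Amp J => NormedSpace.exp T := by
  let _ : NormedAlgebra ℚ (Amp J →L[ℂ] Amp J) := NormedAlgebra.restrictScalars ℚ ℂ _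
  exact NormedSpace.exp_continuous

theorem continuous_flow (k : KSpace d) : Continuous fun θ => A.flow θ k := by
  unfold flow
  exact continuous_exp_clm.comp ((continuous_const.mul Complex.continuous_ofReal).smul
    continuous_const)

theorem aestronglyMeasurable_flow (θ : ℝ) : AEStronglyMeasurable (A.flow θ) volume := by
  refine A.aestronglyMeasurable_of_continuousOn ?_
  have h : ContinuousOn (fun k => (Complex.I * (θ : ℂ)) • A.L k) A.bcᶜ :=
    A.L_smooth.continuousOn.const_smul (Complex.I * (θ : ℂ))
  exact continuous_exp_clm.comp_continuousOn h

theorem memLp_flow (θ : ℝ) : MemLp (A.flow θ) ∞ volume :=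
  memLp_top_of_ae_le (A.aestronglyMeasurable_flow θ) (Eventually.of_forall (A.norm_flow_le θ))

theorem flow_g (hk : k ∉ A.bc) (θ : ℝ) (n : Fin J) (ζ : ℤˣ) :
    A.flow θ k (A.g n ζ k) = Complex.exp (Complex.I * θ * A.ω n ζ k) • A.g n ζ k := by
  refine exp_apply_eigenvector ?_
  rw [_root_.smul_apply, A.eigen k hk, smul_smul]

theorem flow_proj (hk : k ∉ A.bc) (θ : ℝ) (n : Fin J) (ζ : ℤˣ) :
    (A.flow θ k).comp (A.proj n ζ k) =
      Complex.exp (Complex.I * θ * A.ω n ζ k) • A.proj n ζ k := by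
  ext1 x
  rw [ContinuousLinearMap.comp_apply, _root_.smul_apply, A.proj_apply hk, map_smul, A.flow_g hk,
    smul_comm]

theorem proj_flow (hk : k ∉ A.bc) (θ : ℝ) (n : Fin J) (ζ : ℤˣ) :
    (A.proj n ζ k).comp (A.flow θ k) =
      Complex.exp (Complex.I * θ * A.ω n ζ k) • A.proj n ζ k := by
  refine A.ext_g hk fun p => ?_
  rw [ContinuousLinearMap.comp_apply, A.flow_g hk, map_smul, _root_.smul_apply]
  by_cases hp : (n, ζ) = p
  · rw [← hp]
  · rw [A.proj_g_of_ne hk hp, smul_zero, smul_zero]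

end LinearPart

end

/-! ### Well-posedness of the evolution equation in L¹. -/

section

open scoped ENNReal NNReal
open Filter Topology Metric

/-! ### Ordinary differential equations in Banach spaces -/

section ODE

variable {X : Type*} [NormedAddCommGroup X]

theorem continuous_field_comp {F : ℝ → X → X} {K : ℝ≥0} {s : Set X}
    (hc : ∀ x, Continuous fun t => F t x) (hl : ∀ t, LipschitzOnWith K (F t) s)
    {u : ℝ → X} {I : Set ℝ} (hu : ContinuousOn u I) (hs : ∀ t ∈ I, u t ∈ s) :
    ContinuousOn (fun t => F t (u t)) I := by
  have h := continuousOn_prod_of_continuousOn_lipschitzOnWith' (s := I) (t := s)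
    (Function.uncurry F) K (fun t _ => hl t) (fun x _ => (hc x).continuousOn)
  exact h.comp (continuousOn_id.prodMk hu) fun t ht => ⟨ht, hs t ht⟩

/-- Picard iteration in the ball of radius R about x₀, which lies in the ball of radius 2R about 0.
The Picard fixed point is frozen outside [0, T], and its integral defines u on all of ℝ. Thus u has
two-sided derivatives everywhere, although the equation holds only on [0, T]. -/
theorem exists_solution_ODE [NormedSpace ℝ X] [CompleteSpace X] {F : ℝ → X → X} {K : ℝ≥0}
    {R B T : ℝ} (x₀ : X)
    (hc : ∀ x, Continuous fun t => F t x)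
    (hl : ∀ t, LipschitzOnWith K (F t) (closedBall 0 (2 * R)))
    (hB : ∀ t, ∀ x ∈ closedBall (0 : X) (2 * R), ‖F t x‖ ≤ B)
    (hx₀ : ‖x₀‖ ≤ R) (hT : 0 ≤ T) (hBT : B * T ≤ R) :
    ∃ u g : ℝ → X, Continuous g ∧ (∀ t, HasDerivAt u (g t) t) ∧ u 0 = x₀ ∧
      ∀ t ∈ Icc 0 T, g t = F t (u t) ∧ ‖u t‖ ≤ 2 * R := by
  have hR : 0 ≤ R := (norm_nonneg _).trans hx₀
  have hB0 : 0 ≤ B := (norm_nonneg _).trans (hB 0 0 (by simpa using hR))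
  lift R to ℝ≥0 using hR
  lift B to ℝ≥0 using hB0
  have hsub : closedBall x₀ R ⊆ closedBall (0 : X) (2 * R) := by
    intro x hx
    rw [mem_closedBall_zero_iff]
    rw [mem_closedBall_iff_norm] at hx
    linarith [norm_le_norm_add_norm_sub' x x₀]
  have h : IsPicardLindelof F (⟨0, left_mem_Icc.2 hT⟩ : Icc 0 T) x₀ R 0 B K :=
    { lipschitzOnWith := fun t _ => (hl t).mono hsub
      continuousOn := fun x _ => (hc x).continuousOn
      norm_le := fun t _ x hx => hB t x (hsub hx)
      mul_max_le := by simpa [hT] using hBT }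
  obtain ⟨α, hα⟩ := ODE.FunSpace.exists_isFixedPt_next h (mem_closedBall_self le_rfl)
  have hmem : ∀ t, α.compProj t ∈ closedBall (0 : X) (2 * R) := fun t =>
    hsub (ODE.FunSpace.compProj_mem_closedBall α h.mul_max_le)
  have hg : Continuous fun t => F t (α.compProj t) :=
    continuousOn_univ.1 (continuous_field_comp hc hl α.continuous_compProj.continuousOn
      fun t _ => hmem t)
  have heq : ∀ t ∈ Icc 0 T, x₀ + ∫ τ in (0 : ℝ)..t, F τ (α.compProj τ) = α.compProj t := by
    intro t ht
    rw [ODE.FunSpace.compProj_of_mem ht]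
    conv_rhs => rw [← hα]
    rw [ODE.FunSpace.next_apply, ODE.picard_apply]
  refine ⟨fun t => x₀ + ∫ τ in (0 : ℝ)..t, F τ (α.compProj τ), _, hg, fun t => ?_, by simp,
    fun t ht => ?_⟩
  · exact ((hg.integral_hasStrictDerivAt 0 t).hasDerivAt).const_add x₀
  · simp only [heq t ht]
    exact ⟨trivial, by simpa using hmem t⟩

end ODE

/-! ### Lipschitz bounds for multilinear maps -/

theorem ContinuousMultilinearMap.norm_sub_le_of_le {X Y : Type*} [NormedAddCommGroup X]
    [NormedSpace ℂ X] [NormedAddCommGroup Y] [NormedSpace ℂ Y] {m : ℕ}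
    (f : ContinuousMultilinearMap ℂ (fun _ : Fin m => X) Y) {C R δ : ℝ} (hf : ‖f‖ ≤ C)
    (hR : 0 ≤ R) (hδ : 0 ≤ δ) {x y : Fin m → X} (hx : ∀ i, ‖x i‖ ≤ R) (hy : ∀ i, ‖y i‖ ≤ R)
    (hxy : ∀ i, ‖x i - y i‖ ≤ δ) :
    ‖f x - f y‖ ≤ C * m * R ^ (m - 1) * δ := by
  have hC : 0 ≤ C := (norm_nonneg _).trans hf
  refine (f.norm_image_sub_le x y).trans ?_
  rw [Fintype.card_fin]
  have h1 : max ‖x‖ ‖y‖ ≤ R :=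
    max_le ((pi_norm_le_iff_of_nonneg hR).2 hx) ((pi_norm_le_iff_of_nonneg hR).2 hy)
  have h2 : ‖x - y‖ ≤ δ := (pi_norm_le_iff_of_nonneg hδ).2 hxy
  gcongr

theorem ContinuousMultilinearMap.norm_apply_le_of_le {X Y : Type*} [NormedAddCommGroup X]
    [NormedSpace ℂ X] [NormedAddCommGroup Y] [NormedSpace ℂ Y] {m : ℕ}
    (f : ContinuousMultilinearMap ℂ (fun _ : Fin m => X) Y) {C R : ℝ} (hf : ‖f‖ ≤ C)
    {x : Fin m → X} (hx : ∀ i, ‖x i‖ ≤ R) :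
    ‖f x‖ ≤ C * R ^ m := by
  have hC : 0 ≤ C := (norm_nonneg _).trans hf
  refine (f.le_opNorm x).trans ?_
  calc ‖f‖ * ∏ i, ‖x i‖ ≤ C * ∏ _i : Fin m, R := by gcongr; exact hx _
    _ = C * R ^ m := by simp

/-! ### The vector field of the evolution equation -/

variable {d J : ℕ}

/-- The susceptibility of degree `m`, with its normalization, as an integral kernel. -/
def baseKer (χ : Susceptibility d J) (m : ℕ) : Ker d J m := fun z =>
  ((((2 * Real.pi) ^ ((m - 1) * d))⁻¹ : ℝ) : ℂ) • χ m z.1 (wv z)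

/-- The kernel of the nonlinearity conjugated by the linear flow. -/
def fieldKer (A : LinearPart d J) (χ : Susceptibility d J) (θ : ℝ) (m : ℕ) : Ker d J m :=
  ((baseKer χ m).rmul fun _ => A.flow (-θ)).lmul (A.flow θ)

/-- The vector field `exp (iθL) F̂(exp (-iθL) x)` on `L¹`. -/
def field (A : LinearPart d J) (M : Finset ℕ) (χ : Susceptibility d J) (θ : ℝ) (x : L1 d J) :
    L1 d J :=
  ∑ m ∈ M, kerOp m (fieldKer A χ θ m) fun _ => x

variable {A : LinearPart d J} {M : Finset ℕ} {Cχ : ℝ} {χ : Susceptibility d J}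

theorem ae_notMem_bc_ZSpace (A : LinearPart d J) (m : ℕ) :
    ∀ᵐ z : ZSpace d m, z.1 ∉ A.bc ∧ ∀ i, wv z i ∉ A.bc := by
  filter_upwards [ae_fst A.ae_notMem_bc, ae_wv A.ae_notMem_bc] with z h1 h2 using ⟨h1, h2⟩

theorem aestronglyMeasurable_baseKer (hχ : IsAdmissible A M Cχ χ) {m : ℕ} (hm : m ∈ M)
    (hm1 : 1 ≤ m) : AEStronglyMeasurable (baseKer χ m) volume := by
  have hmeas : Measurable fun z : ZSpace d m => wv z :=
    (measurePreserving_wavevectors hm1).measurable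
  have hcont : Continuous fun z : ZSpace d m => wv z := by
    refine continuous_pi fun i => ?_
    unfold wv wavevectors
    split_ifs <;> fun_prop
  have h1 : ContinuousOn (fun z : ZSpace d m => χ m z.1 (wv z))
      {z | z.1 ∉ A.bc ∧ ∀ i, wv z i ∉ A.bc} :=
    (hχ.smooth m hm).continuousOn.comp (continuous_fst.prodMk hcont).continuousOn
      fun z hz => hz
  have hms : MeasurableSet {z : ZSpace d m | z.1 ∉ A.bc ∧ ∀ i, wv z i ∉ A.bc} := by
    have e : {z : ZSpace d m | z.1 ∉ A.bc ∧ ∀ i, wv z i ∉ A.bc} =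
        Prod.fst ⁻¹' A.bcᶜ ∩ ⋂ i, (fun z => wv z i) ⁻¹' A.bcᶜ := by
      ext z; simp
    rw [e]
    have hb : MeasurableSet A.bcᶜ := A.isClosed_bc.measurableSet.compl
    exact (measurable_fst hb).inter
      (MeasurableSet.iInter fun i => ((measurable_pi_apply i).comp hmeas) hb)
  have h2 := h1.aestronglyMeasurable (μ := volume) hms
  have h0 : ∀ᵐ z : ZSpace d m, z ∈ {z : ZSpace d m | z.1 ∉ A.bc ∧ ∀ i, wv z i ∉ A.bc} :=
    ae_notMem_bc_ZSpace A m
  rw [Measure.restrict_eq_self_of_ae_mem h0] at h2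
  exact h2.const_smul ((((2 * Real.pi) ^ ((m - 1) * d))⁻¹ : ℝ) : ℂ)

theorem norm_baseKer_le (hχ : IsAdmissible A M Cχ χ) {m : ℕ} (hm : m ∈ M) :
    ∀ᵐ z, ‖baseKer χ m z‖ ≤ |Cχ| := by
  filter_upwards [ae_notMem_bc_ZSpace A m] with z hz
  rw [baseKer, norm_smul, Complex.norm_real, Real.norm_of_nonneg (by positivity)]
  exact (hχ.bound m hm z.1 hz.1 (wv z) hz.2).trans (le_abs_self _)

theorem memLp_baseKer (hχ : IsAdmissible A M Cχ χ) {m : ℕ} (hm : m ∈ M) (hm1 : 1 ≤ m) :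
    MemLp (baseKer χ m) ∞ volume :=
  memLp_top_of_ae_le (aestronglyMeasurable_baseKer hχ hm hm1) (norm_baseKer_le hχ hm)

theorem memLp_fieldKer (hχ : IsAdmissible A M Cχ χ) {m : ℕ} (hm : m ∈ M) (hm1 : 1 ≤ m) (θ : ℝ) :
    MemLp (fieldKer A χ θ m) ∞ volume :=
  Ker.memLp_lmul (A.memLp_flow θ) (Ker.memLp_rmul (fun _ => A.memLp_flow (-θ))
    (memLp_baseKer hχ hm hm1))

theorem norm_fieldKer_le (hχ : IsAdmissible A M Cχ χ) {m : ℕ} (hm : m ∈ M) (θ : ℝ) :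
    ∀ᵐ z, ‖fieldKer A χ θ m z‖ ≤ |Cχ| := by
  filter_upwards [norm_baseKer_le hχ hm] with z hz
  refine (Ker.norm_lmul_le _ _ z).trans ?_
  refine (mul_le_of_le_one_left (norm_nonneg _) (A.norm_flow_le θ _)).trans ?_
  refine (Ker.norm_rmul_le _ _ z).trans ?_
  refine (mul_le_of_le_one_right (norm_nonneg _) ?_).trans hz
  exact Finset.prod_le_one (fun _ _ => norm_nonneg _) fun i _ => A.norm_flow_le _ _

theorem norm_kerOp_fieldKer_le (hχ : IsAdmissible A M Cχ χ) {m : ℕ} (hm : m ∈ M) (hm1 : 1 ≤ m)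
    (θ : ℝ) : ‖kerOp m (fieldKer A χ θ m)‖ ≤ |Cχ| :=
  norm_kerOp_le hm1 (memLp_fieldKer hχ hm hm1 θ) (abs_nonneg _) (norm_fieldKer_le hχ hm θ)

theorem continuous_fieldKer (A : LinearPart d J) (χ : Susceptibility d J) (m : ℕ)
    (z : ZSpace d m) : Continuous fun θ => fieldKer A χ θ m z := by
  have h1 : Continuous fun p : (Amp J →L[ℂ] Amp J) ×
      (ContinuousMultilinearMap ℂ (fun _ : Fin m => Amp J) (Amp J)) =>
      p.1.compContinuousMultilinearMap p.2 :=
    (ContinuousLinearMap.compContinuousMultilinearMapL ℂ (fun _ : Fin m => Amp J) (Amp J)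
      (Amp J)).isBoundedBilinearMap.continuous
  have h2 : Continuous fun p : (ContinuousMultilinearMap ℂ (fun _ : Fin m => Amp J) (Amp J)) ×
      (Fin m → Amp J →L[ℂ] Amp J) => p.1.compContinuousLinearMap p.2 :=
    continuous_iff_continuousAt.2 fun p =>
      (ContinuousMultilinearMap.hasStrictFDerivAt_compContinuousLinearMap p).continuousAt
  have h3 : Continuous fun θ => (fun i => A.flow (-θ) (wv z i) : Fin m → Amp J →L[ℂ] Amp J) :=
    continuous_pi fun i => (A.continuous_flow (wv z i)).comp continuous_neg
  exact h1.comp ((A.continuous_flow z.1).prodMk (h2.comp (continuous_const.prodMk h3)))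

theorem continuous_kerOp_fieldKer (hχ : IsAdmissible A M Cχ χ) {m : ℕ} (hm : m ∈ M)
    (hm1 : 1 ≤ m) (v : Fin m → L1 d J) : Continuous fun θ => kerOp m (fieldKer A χ θ m) v :=
  continuous_iff_continuousAt.2 fun θ₀ =>
    tendsto_kerOp hm1 (memLp_fieldKer hχ hm hm1) (memLp_fieldKer hχ hm hm1 θ₀)
      (norm_fieldKer_le hχ hm)
      (Eventually.of_forall fun z => (continuous_fieldKer A χ m z).continuousAt) v

theorem continuous_field (hχ : IsAdmissible A M Cχ χ) (hM : ∀ m ∈ M, 1 ≤ m) (x : L1 d J) :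
    Continuous fun θ => field A M χ θ x :=
  continuous_finsetSum _ fun m hm => continuous_kerOp_fieldKer hχ hm (hM m hm) _

/-- The Lipschitz constant of the vector field on a ball of radius `R`. -/
def fieldLip (M : Finset ℕ) (Cχ R : ℝ) : ℝ := ∑ m ∈ M, |Cχ| * m * R ^ (m - 1)

theorem fieldLip_nonneg (M : Finset ℕ) (Cχ : ℝ) {R : ℝ} (hR : 0 ≤ R) : 0 ≤ fieldLip M Cχ R :=
  Finset.sum_nonneg fun _ _ => by positivity

theorem norm_field_sub_le (hχ : IsAdmissible A M Cχ χ) (hM : ∀ m ∈ M, 1 ≤ m) (θ : ℝ) {R : ℝ}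
    (hR : 0 ≤ R) {x y : L1 d J} (hx : ‖x‖ ≤ R) (hy : ‖y‖ ≤ R) :
    ‖field A M χ θ x - field A M χ θ y‖ ≤ fieldLip M Cχ R * ‖x - y‖ := by
  rw [field, field, ← Finset.sum_sub_distrib, fieldLip, Finset.sum_mul]
  refine norm_sum_le_of_le _ fun m hm => ?_
  exact ContinuousMultilinearMap.norm_sub_le_of_le _ (norm_kerOp_fieldKer_le hχ hm (hM m hm) θ) hR
    (norm_nonneg _) (fun _ => hx) (fun _ => hy) fun _ => le_rfl

theorem lipschitzOnWith_field (hχ : IsAdmissible A M Cχ χ) (hM : ∀ m ∈ M, 1 ≤ m) (θ : ℝ) {R : ℝ}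
    (hR : 0 ≤ R) :
    LipschitzOnWith (fieldLip M Cχ R).toNNReal (field A M χ θ) (closedBall 0 R) := by
  refine LipschitzOnWith.of_dist_le_mul fun x hx y hy => ?_
  rw [dist_eq_norm, dist_eq_norm, Real.coe_toNNReal _ (fieldLip_nonneg M Cχ hR)]
  exact norm_field_sub_le hχ hM θ hR (by simpa using hx) (by simpa using hy)

theorem norm_field_le (hχ : IsAdmissible A M Cχ χ) (hM : ∀ m ∈ M, 1 ≤ m) (θ : ℝ) {R : ℝ}
    {x : L1 d J} (hx : ‖x‖ ≤ R) : ‖field A M χ θ x‖ ≤ ∑ m ∈ M, |Cχ| * R ^ m :=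
  norm_sum_le_of_le _ fun m hm => ContinuousMultilinearMap.norm_apply_le_of_le _
    (norm_kerOp_fieldKer_le hχ hm (hM m hm) θ) fun _ => hx

theorem field_zero (hM : ∀ m ∈ M, 1 ≤ m) (θ : ℝ) : field A M χ θ 0 = 0 :=
  Finset.sum_eq_zero fun m hm => by
    have : Nonempty (Fin m) := ⟨⟨0, hM m hm⟩⟩
    exact (kerOp m (fieldKer A χ θ m)).map_zero

/-- For almost every k the integrand is integrable in q, so the operator e^{iθL(k)} moves under the
integral; this links the pointwise formula with the operators on L¹. -/
theorem rate_ae_eq (hχ : IsAdmissible A M Cχ χ) (hM : ∀ m ∈ M, 1 ≤ m) (ϱ τ : ℝ) (x : L1 d J) :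
    rate A M χ ϱ τ x =ᵐ[volume] field A M χ (τ / ϱ) x := by
  have h1 : field A M χ (τ / ϱ) x =ᵐ[volume]
      fun k => ∑ m ∈ M, ∫ q, kerEval (fieldKer A χ (τ / ϱ) m) (fun _ => x) (k, q) := by
    have h2 : ∀ᵐ k, ∀ m ∈ M, kerOp m (fieldKer A χ (τ / ϱ) m) (fun _ => x) k =
        ∫ q, kerEval (fieldKer A χ (τ / ϱ) m) (fun _ => x) (k, q) :=
      (Finset.eventually_all M).2 fun m hm =>
        kerOp_coeFn (hM m hm) (memLp_fieldKer hχ hm (hM m hm) _) _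
    filter_upwards [h2, Lp.coeFn_finsetSum M fun m => kerOp m (fieldKer A χ (τ / ϱ) m) fun _ => x]
      with k hk hk'
    rw [field, hk', Finset.sum_apply]
    exact Finset.sum_congr rfl hk
  have h3 : ∀ᵐ k, ∀ m ∈ M, Integrable (fun q =>
      kerEval ((baseKer χ m).rmul fun _ => A.flow (-(τ / ϱ))) (fun _ => x) (k, q)) volume :=
    (Finset.eventually_all M).2 fun m hm =>
      (integrable_ker (hM m hm) (Ker.memLp_rmul (fun _ => A.memLp_flow _)
        (memLp_baseKer hχ hm (hM m hm))) _).prod_right_ae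
  filter_upwards [h1, h3] with k hk hk3
  rw [hk, rate, nonlin, map_sum]
  refine Finset.sum_congr rfl fun m hm => ?_
  refine Eq.trans ?_ ((A.flow (τ / ϱ) k).integral_comp_comm (hk3 m hm)).symm
  congr 1
  rw [← integral_smul]
  rfl

/-! ### The exact evolution -/

theorem isSolution_iff_field (hχ : IsAdmissible A M Cχ χ) (hM : ∀ m ∈ M, 1 ≤ m) {ϱ T : ℝ}
    {h : L1 d J} {u : ℝ → L1 d J} :
    IsSolution A M χ ϱ h T u ↔ ContinuousOn u (Icc 0 T) ∧
      ∃ G : ℝ → L1 d J, ContinuousOn G (Icc 0 T) ∧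
        (∀ τ ∈ Icc 0 T, G τ = field A M χ (τ / ϱ) (u τ)) ∧
        ∀ τ ∈ Icc 0 T, u τ = (∫ τ' in (0 : ℝ)..τ, G τ') + h := by
  refine and_congr_right fun _ => exists_congr fun G => and_congr_right fun _ =>
    and_congr_left fun _ => forall₂_congr fun τ _ => ?_
  exact ⟨fun he => Lp.ext (he.trans (rate_ae_eq hχ hM ϱ τ _)),
    fun he => he ▸ (rate_ae_eq hχ hM ϱ τ _).symm⟩

/-- Both solutions are continuous on a compact interval, hence stay in a common ball, where the
field is Lipschitz uniformly in time. No bound on the length of the interval is needed. -/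
theorem eqOn_of_isSolution (hχ : IsAdmissible A M Cχ χ) (hM : ∀ m ∈ M, 1 ≤ m) {ϱ T : ℝ}
    {h : L1 d J} {u v : ℝ → L1 d J} (hu : IsSolution A M χ ϱ h T u)
    (hv : IsSolution A M χ ϱ h T v) : EqOn v u (Icc 0 T) := by
  rcases lt_or_ge T 0 with hT | hT
  · simp [Icc_eq_empty (not_le.2 hT)]
  obtain ⟨huc, G, hGc, hG, huG⟩ := (isSolution_iff_field hχ hM).1 hu
  obtain ⟨hvc, H, hHc, hH, hvH⟩ := (isSolution_iff_field hχ hM).1 hv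
  obtain ⟨R₁, hR₁⟩ := isCompact_Icc.exists_bound_of_continuousOn huc
  obtain ⟨R₂, hR₂⟩ := isCompact_Icc.exists_bound_of_continuousOn hvc
  -- The integrand is continuous only on [0, T], so differentiating the integral equation yields
  -- right derivatives.
  have key : ∀ {w g : ℝ → L1 d J}, ContinuousOn g (Icc 0 T) →
      (∀ τ ∈ Icc 0 T, w τ = (∫ τ' in (0 : ℝ)..τ, g τ') + h) →
      ∀ t ∈ Ico 0 T, HasDerivWithinAt w (g t) (Ici t) t := by
    intro w g hg hw t ht
    have ht' : t ∈ Icc 0 T := Ico_subset_Icc_self ht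
    have : Fact (t ∈ Icc 0 T) := ⟨ht'⟩
    have h1 : HasDerivWithinAt (fun τ => (∫ τ' in (0 : ℝ)..τ, g τ') + h) (g t) (Icc 0 T) t := by
      refine (intervalIntegral.integral_hasDerivWithinAt_right ?_
        (hg.stronglyMeasurableAtFilter_nhdsWithin measurableSet_Icc t) (hg t ht')).add_const h
      exact (hg.mono (uIcc_subset_Icc (left_mem_Icc.2 hT) ht')).intervalIntegrable
    have h2 := (h1.congr hw (hw t ht')).mono_of_mem_nhdsWithin
      (Icc_mem_nhdsGE_of_mem ht)
    exact h2
  have hR : 0 ≤ max R₁ R₂ := (norm_nonneg _).trans ((hR₁ 0 (left_mem_Icc.2 hT)).trans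
    (le_max_left _ _))
  refine ODE_solution_unique_of_mem_Icc_right (s := fun _ => closedBall 0 (max R₁ R₂))
    (v := fun t => field A M χ (t / ϱ)) (fun t _ => lipschitzOnWith_field hχ hM _ hR) hvc ?_ ?_ huc
    ?_ ?_ ?_
  · intro t ht
    rw [← hH t (Ico_subset_Icc_self ht)]
    exact key hHc hvH t ht
  · intro t ht
    simpa using Or.inr (hR₂ t (Ico_subset_Icc_self ht))
  · intro t ht
    rw [← hG t (Ico_subset_Icc_self ht)]
    exact key hGc huG t ht
  · intro t ht
    simpa using Or.inl (hR₁ t (Ico_subset_Icc_self ht))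
  · rw [huG 0 (left_mem_Icc.2 hT), hvH 0 (left_mem_Icc.2 hT)]
    simp

theorem exists_exact_solution (hχ : IsAdmissible A M Cχ χ) (hM : ∀ m ∈ M, 1 ≤ m) (ϱ : ℝ)
    {R T : ℝ} (h : L1 d J) (hh : ‖h‖ ≤ R) (hT : 0 ≤ T)
    (hBT : (∑ m ∈ M, |Cχ| * (2 * R) ^ m) * T ≤ R) :
    ∃ u g : ℝ → L1 d J, Continuous g ∧ (∀ t, HasDerivAt u (g t) t) ∧ u 0 = h ∧
      ∀ t ∈ Icc 0 T, g t = field A M χ (t / ϱ) (u t) ∧ ‖u t‖ ≤ 2 * R := by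
  have hR : 0 ≤ R := (norm_nonneg _).trans hh
  refine exists_solution_ODE (F := fun t => field A M χ (t / ϱ)) h
    (fun x => (continuous_field hχ hM x).comp (continuous_id.div_const ϱ))
    (fun t => lipschitzOnWith_field hχ hM _ (by positivity))
    (fun t x hx => norm_field_le hχ hM _ (by simpa using hx)) hh hT hBT

theorem isSolution_of_hasDerivAt (hχ : IsAdmissible A M Cχ χ) (hM : ∀ m ∈ M, 1 ≤ m) {ϱ T : ℝ}
    {h : L1 d J} {u g : ℝ → L1 d J} (hg : Continuous g) (hu : ∀ t, HasDerivAt u (g t) t)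
    (h0 : u 0 = h) (hug : ∀ t ∈ Icc 0 T, g t = field A M χ (t / ϱ) (u t)) :
    IsSolution A M χ ϱ h T u := by
  refine (isSolution_iff_field hχ hM).2 ⟨fun t _ => (hu t).continuousAt.continuousWithinAt, g,
    hg.continuousOn, hug, fun τ _ => ?_⟩
  rw [intervalIntegral.integral_eq_sub_of_hasDerivAt (fun t _ => hu t)
    (hg.intervalIntegrable _ _), h0, sub_add_cancel]

end

/-! ### Localized components and their weighted system. -/

section

open scoped ENNReal NNReal
open Filter Topology Metric

variable {d J N : ℕ}

/-! ### Localized and weighted projections -/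

theorem mulOp_congr {a b : KSpace d → Amp J →L[ℂ] Amp J} (ha : MemLp a ∞ volume)
    (hab : a =ᵐ[volume] b) : mulOp a = mulOp b := by
  ext1 f
  refine Lp.ext ((mulOp_coeFn ha f).trans (EventuallyEq.trans ?_
    (mulOp_coeFn (ha.ae_eq hab) f).symm))
  filter_upwards [hab] with k hk
  rw [hk]

theorem mulOp_mulOp {a b : KSpace d → Amp J →L[ℂ] Amp J} (ha : MemLp a ∞ volume)
    (hb : MemLp b ∞ volume) (f : L1 d J) :
    mulOp a (mulOp b f) = mulOp (fun k => (a k).comp (b k)) f := by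
  refine Lp.ext ((mulOp_coeFn ha _).trans (EventuallyEq.trans ?_
    (mulOp_coeFn (memLp_top_clm_comp ha hb) f).symm))
  filter_upwards [mulOp_coeFn hb f] with k hk
  rw [hk]
  rfl

theorem mulOp_one_sub_sum {ι : Type*} (s : Finset ι) {a : ι → KSpace d → Amp J →L[ℂ] Amp J}
    (ha : ∀ i, MemLp (a i) ∞ volume)
    (ha' : MemLp (fun k => 1 - ∑ i ∈ s, a i k) ∞ volume) (f : L1 d J) :
    mulOp (fun k => 1 - ∑ i ∈ s, a i k) f = f - ∑ i ∈ s, mulOp (a i) f := by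
  refine Lp.ext ((mulOp_coeFn ha' f).trans ?_)
  have h : ∀ᵐ k, ∀ i ∈ s, mulOp (a i) f k = a i k (f k) :=
    (Finset.eventually_all s).2 fun i _ => mulOp_coeFn (ha i) f
  filter_upwards [h, Lp.coeFn_sub f (∑ i ∈ s, mulOp (a i) f),
    Lp.coeFn_finsetSum s fun i => mulOp (a i) f] with k h1 h2 h3
  rw [h2, Pi.sub_apply, h3, Finset.sum_apply, Finset.sum_congr rfl h1]
  simp

/-- The centre `ζ k_{*l}` of the component with index `(ζ, l)`. -/
def center (S : Fin N → Fin J × KSpace d) (i : ℤˣ × Fin N) : KSpace d := sgn i.1 • (S i.2).2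

theorem kappa_eq_sum_center (S : Fin N → Fin J × KSpace d) {m : ℕ} (lam : Fin m → ℤˣ × Fin N) :
    kappa S lam = ∑ j, center S (lam j) := rfl

theorem sgn_mul_self (ζ : ℤˣ) : sgn ζ * sgn ζ = 1 := by
  rcases Int.units_eq_one_or ζ with rfl | rfl <;> simp [sgn]

theorem sgn_smul_sgn_smul (ζ : ℤˣ) (k : KSpace d) : sgn ζ • sgn ζ • k = k := by
  rw [smul_smul, sgn_mul_self, one_smul]

variable (A : LinearPart d J) (S : Fin N → Fin J × KSpace d)

/-- The spectral projection of the band of `i`, localized to the ball of radius `r` about the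
centre of `i` and multiplied by the weight `exp (b |k - center|)`. -/
def expProj (r b : ℝ) (i : ℤˣ × Fin N) (k : KSpace d) : Amp J →L[ℂ] Amp J :=
  open Classical in
  if ‖k - center S i‖ ≤ r then
    ((Real.exp (b * ‖k - center S i‖) : ℝ) : ℂ) • A.proj (S i.2).1 i.1 k else 0

variable {A S} {r b : ℝ} {i : ℤˣ × Fin N} {k : KSpace d}

theorem expProj_of_le (h : ‖k - center S i‖ ≤ r) : expProj A S r b i k =
    ((Real.exp (b * ‖k - center S i‖) : ℝ) : ℂ) • A.proj (S i.2).1 i.1 k := if_pos h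

theorem expProj_of_not_le (h : ¬ ‖k - center S i‖ ≤ r) : expProj A S r b i k = 0 := if_neg h

theorem expProj_zero_of_le (h : ‖k - center S i‖ ≤ r) :
    expProj A S r 0 i k = A.proj (S i.2).1 i.1 k := by
  rw [expProj_of_le h]; simp

theorem norm_expProj_le (r b : ℝ) (i : ℤˣ × Fin N) (k : KSpace d) :
    ‖expProj A S r b i k‖ ≤ Real.exp (b * ‖k - center S i‖) := by
  by_cases h : ‖k - center S i‖ ≤ r
  · rw [expProj_of_le h, norm_smul, Complex.norm_real, Real.norm_of_nonneg (Real.exp_pos _).le]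
    exact mul_le_of_le_one_right (Real.exp_pos _).le (A.norm_proj_le _ _ _)
  · rw [expProj_of_not_le h, norm_zero]
    exact (Real.exp_pos _).le

theorem norm_expProj_le_exp (r b : ℝ) (hb : 0 ≤ b) (i : ℤˣ × Fin N) (k : KSpace d) :
    ‖expProj A S r b i k‖ ≤ Real.exp (b * r) := by
  by_cases h : ‖k - center S i‖ ≤ r
  · exact (norm_expProj_le r b i k).trans (Real.exp_le_exp.2 (by gcongr))
  · rw [expProj_of_not_le h, norm_zero]
    exact (Real.exp_pos _).le

theorem norm_expProj_le_one (r : ℝ) (hb : b ≤ 0) (i : ℤˣ × Fin N) (k : KSpace d) :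
    ‖expProj A S r b i k‖ ≤ 1 :=
  (norm_expProj_le r b i k).trans
    (Real.exp_le_one_iff.2 (mul_nonpos_of_nonpos_of_nonneg hb (norm_nonneg _)))

variable (A S) in
theorem memLp_expProj (r b : ℝ) (i : ℤˣ × Fin N) :
    MemLp (expProj A S r b i) ∞ volume := by
  refine memLp_top_of_ae_le (C := Real.exp (|b| * r)) ?_ (Eventually.of_forall fun k => ?_)
  · have h1 : AEStronglyMeasurable (fun k => ((Real.exp (b * ‖k - center S i‖) : ℝ) : ℂ) •
        A.proj (S i.2).1 i.1 k) volume := by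
      have h0 : AEStronglyMeasurable
          (fun k : KSpace d => ((Real.exp (b * ‖k - center S i‖) : ℝ) : ℂ)) volume :=
        Continuous.aestronglyMeasurable (by fun_prop)
      exact h0.smul (A.memLp_proj _ _).1
    have hs : MeasurableSet {k : KSpace d | ‖k - center S i‖ ≤ r} :=
      (isClosed_le (by fun_prop) continuous_const).measurableSet
    have h2 := h1.indicator hs
    have e : expProj A S r b i = {k | ‖k - center S i‖ ≤ r}.indicator fun k =>
        ((Real.exp (b * ‖k - center S i‖) : ℝ) : ℂ) • A.proj (S i.2).1 i.1 k := by
      funext k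
      simp only [expProj, indicator, mem_ofPred_eq]
    rw [e]
    exact h2
  · by_cases h : ‖k - center S i‖ ≤ r
    · refine (norm_expProj_le r b i k).trans (Real.exp_le_exp.2 ?_)
      exact (mul_le_mul_of_nonneg_right (le_abs_self b) (norm_nonneg _)).trans (by gcongr)
    · rw [expProj_of_not_le h, norm_zero]
      exact (Real.exp_pos _).le

/-- Weights add, so `b` and `-b` undo each other on the localized band; this is the passage between
weighted and original variables. -/
theorem expProj_comp (r b b' : ℝ) (i : ℤˣ × Fin N) (k : KSpace d) :
    (expProj A S r b i k).comp (expProj A S r b' i k) = expProj A S r (b + b') i k := by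
  by_cases h : ‖k - center S i‖ ≤ r
  · ext1 x
    simp only [expProj_of_le h, ContinuousLinearMap.comp_apply, _root_.smul_apply, map_smul,
      A.proj_proj_self, smul_smul]
    rw [add_comm b b', add_mul, Real.exp_add, Complex.ofReal_mul]
  · simp [expProj_of_not_le h]

/-- Two components are separated when their balls of radius `r` are disjoint unless the centres
coincide. -/
def Separated (S : Fin N → Fin J × KSpace d) (r : ℝ) : Prop :=
  ∀ i j, center S i ≠ center S j → 2 * r < ‖center S i - center S j‖

/-- Different bands are orthogonal. If band and sign agree, two balls that meet have the same
centre, and then the two indices agree because the pairs of the spectrum are distinct. -/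
theorem expProj_comp_of_ne (hS : Function.Injective S) (hr : Separated S r) (hk : k ∉ A.bc)
    {j : ℤˣ × Fin N} (hij : i ≠ j) (b b' : ℝ) :
    (expProj A S r b i k).comp (expProj A S r b' j k) = 0 := by
  by_cases h : ‖k - center S i‖ ≤ r
  swap
  · simp [expProj_of_not_le h]
  by_cases h' : ‖k - center S j‖ ≤ r
  swap
  · simp [expProj_of_not_le h']
  have hne : ((S i.2).1, i.1) ≠ ((S j.2).1, j.1) := by
    intro he
    obtain ⟨h1, h2⟩ := Prod.ext_iff.1 he
    simp only at h1 h2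
    have hc : center S i = center S j := by
      by_contra hc
      have h3 := hr i j hc
      have h4 : ‖center S i - center S j‖ ≤ ‖k - center S j‖ + ‖k - center S i‖ := by
        have : center S i - center S j = (k - center S j) - (k - center S i) := by abel
        rw [this]
        exact norm_sub_le _ _
      linarith
    have h3 : (S i.2).2 = (S j.2).2 := by
      have := congrArg (fun x => sgn i.1 • x) hc
      simp only [center] at this
      rwa [← h2, sgn_smul_sgn_smul, sgn_smul_sgn_smul] at this
    exact hij (Prod.ext h2 (hS (Prod.ext h1 h3)))
  ext1 x
  simp only [expProj_of_le h, expProj_of_le h', ContinuousLinearMap.comp_apply, _root_.smul_apply,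
    map_smul, A.proj_proj_of_ne hk hne, smul_zero]
  rfl

theorem mulOp_expProj_mulOp (r b b' : ℝ) (i : ℤˣ × Fin N) (f : L1 d J) :
    mulOp (expProj A S r b i) (mulOp (expProj A S r b' i) f) =
      mulOp (expProj A S r (b + b') i) f := by
  rw [mulOp_mulOp (memLp_expProj A S r b i) (memLp_expProj A S r b' i)]
  congr 2
  funext k
  exact expProj_comp r b b' i k

variable (A S) in
theorem mulOp_expProj_mulOp_of_ne (hS : Function.Injective S) (hr : Separated S r)
    {j : ℤˣ × Fin N} (hij : i ≠ j) (b b' : ℝ) (f : L1 d J) :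
    mulOp (expProj A S r b i) (mulOp (expProj A S r b' j) f) = 0 := by
  rw [mulOp_mulOp (memLp_expProj A S r b i) (memLp_expProj A S r b' j)]
  have h : (fun k => (expProj A S r b i k).comp (expProj A S r b' j k)) =ᵐ[volume] fun _ => 0 := by
    filter_upwards [A.ae_notMem_bc] with k hk
    exact expProj_comp_of_ne hS hr hk hij b b'
  have h0 : MemLp (fun _ : KSpace d => (0 : Amp J →L[ℂ] Amp J)) ∞ volume := memLp_top_zero
  rw [mulOp_congr (memLp_top_clm_comp (memLp_expProj A S r b i) (memLp_expProj A S r b' j)) h]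
  refine Lp.ext ((mulOp_coeFn h0 f).trans ?_)
  filter_upwards [Lp.coeFn_zero (Amp J) 1 (volume : Measure (KSpace d))] with k hk
  rw [hk]
  rfl

/-! ### The localized system -/

variable {M : Finset ℕ} {Cχ : ℝ} {χ : Susceptibility d J}

variable (A χ S) in
/-- The kernel of the interaction of the components `lam j` with output the component `i`. -/
def locKer (r a θ : ℝ) (m : ℕ) (i : ℤˣ × Fin N) (lam : Fin m → ℤˣ × Fin N) : Ker d J m :=
  ((fieldKer A χ θ m).rmul fun j => expProj A S r (-a) (lam j)).lmul (expProj A S r a i)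

/-- Outputs of interactions of degree `m ∈ M` are localized away from the components
whose centre is not the centre of the interaction. -/
def OutSeparated (M : Finset ℕ) (S : Fin N → Fin J × KSpace d) (r : ℝ) : Prop :=
  ∀ m ∈ M, ∀ (i : ℤˣ × Fin N) (lam : Fin m → ℤˣ × Fin N), kappa S lam ≠ center S i →
    (m + 1) * r < ‖kappa S lam - center S i‖

/-- The wavevectors sum to k and the centres sum to κ, so distances from the centres are subadditive
under interaction. -/
theorem norm_sub_kappa_le {m : ℕ} (hm : 1 ≤ m) (z : ZSpace d m) (lam : Fin m → ℤˣ × Fin N) :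
    ‖z.1 - kappa S lam‖ ≤ ∑ j, ‖wv z j - center S (lam j)‖ := by
  rw [kappa_eq_sum_center, ← sum_wavevectors hm z.1 z.2, ← Finset.sum_sub_distrib]
  exact norm_sum_le _ _

theorem prod_norm_expProj_le {m : ℕ} (hm : 1 ≤ m) (z : ZSpace d m) (lam : Fin m → ℤˣ × Fin N)
    (r : ℝ) {a : ℝ} (ha : 0 ≤ a) :
    ∏ j, ‖expProj A S r (-a) (lam j) (wv z j)‖ ≤ Real.exp (-(a * ‖z.1 - kappa S lam‖)) := by
  calc ∏ j, ‖expProj A S r (-a) (lam j) (wv z j)‖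
      ≤ ∏ j, Real.exp (-a * ‖wv z j - center S (lam j)‖) := by
        gcongr with j; exact norm_expProj_le _ _ _ _
    _ = Real.exp (-(a * ∑ j, ‖wv z j - center S (lam j)‖)) := by
        rw [← Real.exp_sum, Finset.mul_sum, ← Finset.sum_neg_distrib]
        simp
    _ ≤ _ := by
        gcongr
        exact norm_sub_kappa_le hm z lam

theorem prod_norm_expProj_eq_zero {m : ℕ} {z : ZSpace d m} {lam : Fin m → ℤˣ × Fin N}
    {r a : ℝ} (h : ¬ ∀ j, ‖wv z j - center S (lam j)‖ ≤ r) :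
    ∏ j, ‖expProj A S r a (lam j) (wv z j)‖ = 0 := by
  obtain ⟨j, hj⟩ := not_forall.1 h
  exact Finset.prod_eq_zero (Finset.mem_univ j) (by rw [expProj_of_not_le hj, norm_zero])

/-- The bound does not depend on the weight `a`. The inputs contribute at most e^{-a|k - κ|}; since
κ must be the centre of the output component, this cancels the output weight exactly. -/
theorem norm_locKer_le (hχ : IsAdmissible A M Cχ χ) {m : ℕ} (hm : m ∈ M) (hm1 : 1 ≤ m)
    (hr : OutSeparated M S r) {a : ℝ} (ha : 0 ≤ a) (θ : ℝ) (i : ℤˣ × Fin N)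
    (lam : Fin m → ℤˣ × Fin N) : ∀ᵐ z, ‖locKer A S χ r a θ m i lam z‖ ≤ |Cχ| := by
  filter_upwards [norm_fieldKer_le hχ hm θ] with z hz
  have h1 : ‖locKer A S χ r a θ m i lam z‖ ≤ ‖expProj A S r a i z.1‖ *
      (|Cχ| * ∏ j, ‖expProj A S r (-a) (lam j) (wv z j)‖) := by
    refine (Ker.norm_lmul_le _ _ z).trans ?_
    gcongr
    refine (Ker.norm_rmul_le _ _ z).trans ?_
    gcongr
  refine h1.trans ?_
  by_cases hj : ∀ j, ‖wv z j - center S (lam j)‖ ≤ r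
  swap
  · rw [prod_norm_expProj_eq_zero hj]; simp
  by_cases hk : ‖z.1 - center S i‖ ≤ r
  swap
  · rw [expProj_of_not_le hk]; simp
  -- The inputs place k within m·r of κ and the output within r of the centre of i. Distinct points
  -- κ and centre are further than (m + 1)·r apart.
  have hκ : kappa S lam = center S i := by
    by_contra hne
    have h2 := hr m hm i lam hne
    have h3 : ‖kappa S lam - center S i‖ ≤ ‖z.1 - center S i‖ + ‖z.1 - kappa S lam‖ := by
      have : kappa S lam - center S i = (z.1 - center S i) - (z.1 - kappa S lam) := by abel
      rw [this]
      exact norm_sub_le _ _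
    have h4 : ‖z.1 - kappa S lam‖ ≤ m * r := by
      refine (norm_sub_kappa_le hm1 z lam).trans ((Finset.sum_le_sum fun j _ => hj j).trans ?_)
      simp
    linarith
  have h5 := prod_norm_expProj_le (A := A) (S := S) hm1 z lam r ha
  have h6 := norm_expProj_le (A := A) (S := S) r a i z.1
  rw [hκ] at h5
  calc ‖expProj A S r a i z.1‖ * (|Cχ| * ∏ j, ‖expProj A S r (-a) (lam j) (wv z j)‖)
      ≤ Real.exp (a * ‖z.1 - center S i‖) * (|Cχ| * Real.exp (-(a * ‖z.1 - center S i‖))) := by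
        gcongr
    _ = |Cχ| := by
        rw [mul_left_comm, ← Real.exp_add, add_neg_cancel, Real.exp_zero, mul_one]

theorem memLp_locKer (hχ : IsAdmissible A M Cχ χ) {m : ℕ} (hm : m ∈ M) (hm1 : 1 ≤ m)
    (r a θ : ℝ) (i : ℤˣ × Fin N) (lam : Fin m → ℤˣ × Fin N) :
    MemLp (locKer A S χ r a θ m i lam) ∞ volume :=
  Ker.memLp_lmul (memLp_expProj A S r a i) (Ker.memLp_rmul (fun _ => memLp_expProj A S r _ _)
    (memLp_fieldKer hχ hm hm1 θ))

theorem norm_kerOp_locKer_le (hχ : IsAdmissible A M Cχ χ) {m : ℕ} (hm : m ∈ M) (hm1 : 1 ≤ m)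
    (hr : OutSeparated M S r) {a : ℝ} (ha : 0 ≤ a) (θ : ℝ) (i : ℤˣ × Fin N)
    (lam : Fin m → ℤˣ × Fin N) : ‖kerOp m (locKer A S χ r a θ m i lam)‖ ≤ |Cχ| :=
  norm_kerOp_le hm1 (memLp_locKer hχ hm hm1 r a θ i lam) (abs_nonneg _)
    (norm_locKer_le hχ hm hm1 hr ha θ i lam)

theorem kerOp_lmul_rmul_apply {m : ℕ} (hm1 : 1 ≤ m) {K : Ker d J m} (hK : MemLp K ∞ volume)
    {a : KSpace d → Amp J →L[ℂ] Amp J} (ha : MemLp a ∞ volume)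
    {b : Fin m → KSpace d → Amp J →L[ℂ] Amp J} (hb : ∀ j, MemLp (b j) ∞ volume)
    (v : Fin m → L1 d J) :
    kerOp m ((K.rmul b).lmul a) v = mulOp a (kerOp m K fun j => mulOp (b j) (v j)) := by
  rw [← mulOp_kerOp hm1 ha (Ker.memLp_rmul hb hK), kerOp_mulOp hm1 hb hK]

theorem kerOp_locKer_apply (hχ : IsAdmissible A M Cχ χ) {m : ℕ} (hm : m ∈ M) (hm1 : 1 ≤ m)
    (r a θ : ℝ) (i : ℤˣ × Fin N) (lam : Fin m → ℤˣ × Fin N) (v : Fin m → L1 d J) :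
    kerOp m (locKer A S χ r a θ m i lam) v = mulOp (expProj A S r a i)
      (kerOp m (fieldKer A χ θ m) fun j => mulOp (expProj A S r (-a) (lam j)) (v j)) :=
  kerOp_lmul_rmul_apply hm1 (memLp_fieldKer hχ hm hm1 θ) (memLp_expProj A S r a i)
    (fun _ => memLp_expProj A S r _ _) v

variable (A χ S M) in
/-- The vector field of the localized system in the weighted variables. -/
def locField (r a θ : ℝ) (v : ℤˣ × Fin N → L1 d J) (i : ℤˣ × Fin N) : L1 d J :=
  ∑ m ∈ M, ∑ lam : Fin m → ℤˣ × Fin N,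
    kerOp m (locKer A S χ r a θ m i lam) fun j => v (lam j)

variable (A S) in
/-- The superposition of the components in the original variables. -/
def assemble (r a : ℝ) (v : ℤˣ × Fin N → L1 d J) : L1 d J :=
  ∑ i, mulOp (expProj A S r (-a) i) (v i)

theorem kerOp_fieldKer_assemble {m : ℕ} (r a θ : ℝ) (v : ℤˣ × Fin N → L1 d J) :
    kerOp m (fieldKer A χ θ m) (fun _ => assemble A S r a v) =
      ∑ lam : Fin m → ℤˣ × Fin N, kerOp m (fieldKer A χ θ m)
        fun j => mulOp (expProj A S r (-a) (lam j)) (v (lam j)) :=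
  (kerOp m (fieldKer A χ θ m)).map_sum fun _ i => mulOp (expProj A S r (-a) i) (v i)

/-- The output weight is removed by the opposite one. Summed over i, this says that the assembled
superposition evolves by the full field followed by projection onto the localized components. -/
theorem mulOp_locField (hχ : IsAdmissible A M Cχ χ) (hM : ∀ m ∈ M, 1 ≤ m) (r a θ : ℝ)
    (v : ℤˣ × Fin N → L1 d J) (i : ℤˣ × Fin N) :
    mulOp (expProj A S r (-a) i) (locField A S M χ r a θ v i) =
      mulOp (expProj A S r 0 i) (field A M χ θ (assemble A S r a v)) := by
  rw [locField, field, map_sum, map_sum]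
  refine Finset.sum_congr rfl fun m hm => ?_
  rw [kerOp_fieldKer_assemble, map_sum, map_sum]
  refine Finset.sum_congr rfl fun lam _ => ?_
  rw [kerOp_locKer_apply hχ hm (hM m hm), mulOp_expProj_mulOp, neg_add_cancel]

theorem continuous_locField (hχ : IsAdmissible A M Cχ χ) (hM : ∀ m ∈ M, 1 ≤ m) (r a : ℝ)
    (v : ℤˣ × Fin N → L1 d J) : Continuous fun θ => locField A S M χ r a θ v := by
  refine continuous_pi fun i => continuous_finsetSum _ fun m hm => continuous_finsetSum _
    fun lam _ => ?_
  simp only [kerOp_locKer_apply hχ hm (hM m hm)]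
  exact (mulOp _).continuous.comp (continuous_kerOp_fieldKer hχ hm (hM m hm) _)

theorem card_interactions (N m : ℕ) :
    Fintype.card (Fin m → ℤˣ × Fin N) = (2 * N) ^ m := by
  simp

theorem norm_locField_le (hχ : IsAdmissible A M Cχ χ) (hM : ∀ m ∈ M, 1 ≤ m)
    (hr : OutSeparated M S r) {a : ℝ} (ha : 0 ≤ a) (θ : ℝ) {R : ℝ} (hR : 0 ≤ R)
    {v : ℤˣ × Fin N → L1 d J} (hv : ‖v‖ ≤ R) :
    ‖locField A S M χ r a θ v‖ ≤ ∑ m ∈ M, (2 * N : ℝ) ^ m * (|Cχ| * R ^ m) := by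
  refine (pi_norm_le_iff_of_nonneg (Finset.sum_nonneg fun _ _ => by positivity)).2 fun i => ?_
  refine norm_sum_le_of_le _ fun m hm => ?_
  refine (norm_sum_le_of_le _ fun lam _ => ContinuousMultilinearMap.norm_apply_le_of_le _
    (norm_kerOp_locKer_le hχ hm (hM m hm) hr ha θ i lam)
      fun j => (norm_le_pi_norm v (lam j)).trans hv).trans ?_
  rw [Finset.sum_const, Finset.card_univ, card_interactions, nsmul_eq_mul]
  push_cast
  rfl

theorem lipschitzOnWith_locField (hχ : IsAdmissible A M Cχ χ) (hM : ∀ m ∈ M, 1 ≤ m)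
    (hr : OutSeparated M S r) {a : ℝ} (ha : 0 ≤ a) {R : ℝ} (hR : 0 ≤ R) : ∃ K : ℝ≥0, ∀ θ,
    LipschitzOnWith K (locField A S M χ r a θ) (closedBall 0 R) := by
  have hK : 0 ≤ ∑ m ∈ M, (2 * N : ℝ) ^ m * (|Cχ| * m * R ^ (m - 1)) :=
    Finset.sum_nonneg fun _ _ => by positivity
  refine ⟨⟨_, hK⟩, fun θ => LipschitzOnWith.of_dist_le_mul fun v hv w hw => ?_⟩
  rw [dist_eq_norm, dist_eq_norm]
  rw [mem_closedBall_zero_iff] at hv hw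
  change _ ≤ (∑ m ∈ M, (2 * N : ℝ) ^ m * (|Cχ| * m * R ^ (m - 1))) * _
  refine (pi_norm_le_iff_of_nonneg (mul_nonneg hK (norm_nonneg _))).2 fun i => ?_
  rw [Pi.sub_apply, locField, locField, ← Finset.sum_sub_distrib, Finset.sum_mul]
  refine norm_sum_le_of_le _ fun m hm => ?_
  rw [← Finset.sum_sub_distrib]
  refine (norm_sum_le_of_le _ fun lam _ => ContinuousMultilinearMap.norm_sub_le_of_le _
    (norm_kerOp_locKer_le hχ hm (hM m hm) hr ha θ i lam) hR (norm_nonneg (v - w))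
      (fun j => (norm_le_pi_norm v (lam j)).trans hv)
      (fun j => (norm_le_pi_norm w (lam j)).trans hw)
      fun j => norm_le_pi_norm (v - w) (lam j)).trans ?_
  rw [Finset.sum_const, Finset.card_univ, card_interactions, nsmul_eq_mul]
  push_cast
  exact (mul_assoc _ _ _).ge

/-- The condition on T involves neither `r`, `a` nor `ϱ`, so one lifespan serves all small β. The
factor (2N)^m counts the choices of inputs. -/
theorem exists_localized_solution (hχ : IsAdmissible A M Cχ χ) (hM : ∀ m ∈ M, 1 ≤ m)
    (hr : OutSeparated M S r) {a : ℝ} (ha : 0 ≤ a) (ϱ : ℝ) {R T : ℝ}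
    (v₀ : ℤˣ × Fin N → L1 d J) (hv₀ : ‖v₀‖ ≤ R) (hT : 0 ≤ T)
    (hBT : (∑ m ∈ M, (2 * N : ℝ) ^ m * (|Cχ| * (2 * R) ^ m)) * T ≤ R) :
    ∃ v g : ℝ → ℤˣ × Fin N → L1 d J, Continuous g ∧ (∀ t, HasDerivAt v (g t) t) ∧ v 0 = v₀ ∧
      ∀ t ∈ Icc 0 T, g t = locField A S M χ r a (t / ϱ) (v t) ∧ ‖v t‖ ≤ 2 * R := by
  have hR : 0 ≤ R := (norm_nonneg _).trans hv₀
  obtain ⟨K, hK⟩ := lipschitzOnWith_locField hχ hM hr ha (R := 2 * R) (by positivity)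
  exact exists_solution_ODE (F := fun t => locField A S M χ r a (t / ϱ)) v₀
    (fun x => (continuous_locField hχ hM r a x).comp (continuous_id.div_const ϱ))
    (fun t => hK _)
    (fun t x hx => norm_locField_le hχ hM hr ha _ (by positivity) (by simpa using hx)) hv₀ hT hBT

end

/-! ### Oscillatory time integrals. -/

section

open scoped ENNReal NNReal
open Filter Topology Metric

variable {d J N : ℕ}

/-! ### Integration by parts in time -/

section IBP

variable {X Y : Type*} [NormedAddCommGroup X] [NormedSpace ℂ X] [NormedAddCommGroup Y]
  [NormedSpace ℂ Y] {m : ℕ}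

/-- Strong continuity suffices because the uniform bound makes the multilinear maps locally
Lipschitz, uniformly in t. -/
theorem continuous_multilinear_apply {A : ℝ → ContinuousMultilinearMap ℂ (fun _ : Fin m => X) Y}
    {C : ℝ} (hA : ∀ x, Continuous fun t => A t x) (hC : ∀ t, ‖A t‖ ≤ C) {v : ℝ → Fin m → X}
    (hv : Continuous v) : Continuous fun t => A t (v t) := by
  refine continuous_iff_continuousAt.2 fun t₀ => ?_
  have h0 : ∀ᶠ t in 𝓝 t₀, ‖v t‖ ≤ ‖v t₀‖ + 1 :=
    (hv.norm.tendsto t₀).eventually_le_const (by linarith)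
  have h1 : Tendsto (fun t => C * m * (‖v t₀‖ + 1) ^ (m - 1) * ‖v t - v t₀‖ +
      ‖A t (v t₀) - A t₀ (v t₀)‖) (𝓝 t₀) (𝓝 0) := by
    have h2 := (tendsto_iff_norm_sub_tendsto_zero.1 (hv.tendsto t₀)).const_mul
      (C * m * (‖v t₀‖ + 1) ^ (m - 1))
    have h3 := tendsto_iff_norm_sub_tendsto_zero.1 ((hA (v t₀)).tendsto t₀)
    simpa using h2.add h3
  refine tendsto_iff_norm_sub_tendsto_zero.2 (squeeze_zero' (Eventually.of_forall fun _ =>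
    norm_nonneg _) ?_ h1)
  filter_upwards [h0] with t ht
  have h4 := ContinuousMultilinearMap.norm_sub_le_of_le (A t) (hC t) (R := ‖v t₀‖ + 1)
    (by positivity) (norm_nonneg (v t - v t₀)) (fun i => (norm_le_pi_norm (v t) i).trans ht)
    (fun i => (norm_le_pi_norm (v t₀) i).trans (by linarith))
    fun i => norm_le_pi_norm (v t - v t₀) i
  calc ‖A t (v t) - A t₀ (v t₀)‖ = ‖(A t (v t) - A t (v t₀)) + (A t (v t₀) - A t₀ (v t₀))‖ := by
        rw [sub_add_sub_cancel]
    _ ≤ _ := (norm_add_le _ _).trans (by gcongr)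

/-- Integration by parts with P' = A. The two boundary terms and the m terms in which the derivative
falls on one argument all contain P, hence the overall factor δ. -/
theorem norm_integral_multilinear_le [CompleteSpace Y]
    {A P : ℝ → ContinuousMultilinearMap ℂ (fun _ : Fin m => X) Y} {v v' : Fin m → ℝ → X}
    {δ B B' T : ℝ} (hP : ∀ t, HasDerivAt P (A t) t) (hδ : ∀ t, ‖P t‖ ≤ δ)
    (hA : Continuous fun t => A t fun i => v i t)
    (hv : ∀ i t, HasDerivAt (v i) (v' i t) t) (hv' : ∀ i, Continuous (v' i))
    (hB : ∀ i, ∀ t ∈ Icc 0 T, ‖v i t‖ ≤ B) (hB' : ∀ i, ∀ t ∈ Icc 0 T, ‖v' i t‖ ≤ B') 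
    (hB0 : 0 ≤ B) (hB0' : 0 ≤ B') {τ : ℝ} (hτ : τ ∈ Icc 0 T) :
    ‖∫ t in (0 : ℝ)..τ, A t fun i => v i t‖ ≤
      δ * (2 * B ^ m + T * (m * (B ^ (m - 1) * B'))) := by
  have hδ0 : 0 ≤ δ := (norm_nonneg _).trans (hδ 0)
  have hPc : Continuous P := continuous_iff_continuousAt.2 fun t => (hP t).continuousAt
  have hvc : ∀ i, Continuous (v i) := fun i =>
    continuous_iff_continuousAt.2 fun t => (hv i t).continuousAt
  set Q : ℝ → Y := fun t => ∑ j, P t (Function.update (fun i => v i t) j (v' j t)) with hQ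
  have hQc : Continuous Q := by
    refine continuous_finsetSum _ fun j _ => hPc.eval ?_
    exact (continuous_pi hvc).update j (hv' j)
  have hderiv : ∀ t, HasDerivAt (fun t => P t fun i => v i t) ((A t fun i => v i t) + Q t) t := by
    intro t
    have h := ((ContinuousMultilinearMap.hasStrictFDerivAt_uncurry
      (P t, fun i => v i t)).hasFDerivAt.restrictScalars ℝ).comp_hasDerivAt t
      ((hP t).prodMk (hasDerivAt_pi.2 fun i => hv i t))
    refine h.congr_deriv ?_
    simp [hQ]
  have hint := intervalIntegral.integral_eq_sub_of_hasDerivAt (a := 0) (b := τ)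
    (fun t _ => hderiv t) ((hA.add hQc).intervalIntegrable _ _)
  rw [intervalIntegral.integral_add (hA.intervalIntegrable _ _) (hQc.intervalIntegrable _ _)]
    at hint
  have h0 : (0 : ℝ) ∈ Icc 0 T := left_mem_Icc.2 (hτ.1.trans hτ.2)
  have hPB : ∀ t ∈ Icc 0 T, ‖P t fun i => v i t‖ ≤ δ * B ^ m := fun t ht =>
    ContinuousMultilinearMap.norm_apply_le_of_le _ (hδ t) fun i => hB i t ht
  have hQB : ∀ t ∈ Icc 0 T, ‖Q t‖ ≤ m * (δ * (B ^ (m - 1) * B')) := by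
    intro t ht
    refine (norm_sum_le_of_le (n := fun _ => δ * (B ^ (m - 1) * B')) _ fun j _ => ?_).trans
      (by simp)
    refine ((P t).le_opNorm _).trans ?_
    refine mul_le_mul (hδ t) ?_ (by positivity) hδ0
    rw [← Finset.mul_prod_erase _ _ (Finset.mem_univ j), mul_comm]
    refine mul_le_mul ?_ (by simpa using hB' j t ht) (norm_nonneg _) (by positivity)
    refine (Finset.prod_le_prod (g := fun _ => B) (fun _ _ => norm_nonneg _) fun i hi => ?_).trans
      (by simp)
    rw [Function.update_of_ne (Finset.ne_of_mem_erase hi)]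
    exact hB i t ht
  have hIQ : ‖∫ t in (0 : ℝ)..τ, Q t‖ ≤ m * (δ * (B ^ (m - 1) * B')) * T := by
    refine (intervalIntegral.norm_integral_le_of_norm_le_const
      (C := m * (δ * (B ^ (m - 1) * B'))) fun t ht => ?_).trans ?_
    · rw [uIoc_of_le hτ.1] at ht
      exact hQB t ⟨ht.1.le, ht.2.trans hτ.2⟩
    · rw [sub_zero, abs_of_nonneg hτ.1]
      gcongr
      exact hτ.2
  have e : (∫ t in (0 : ℝ)..τ, A t fun i => v i t) =
      ((P τ fun i => v i τ) - P 0 fun i => v i 0) - ∫ t in (0 : ℝ)..τ, Q t := by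
    rw [← hint, add_sub_cancel_right]
  rw [e]
  refine (norm_sub_le _ _).trans ?_
  refine (add_le_add ((norm_sub_le _ _).trans (add_le_add (hPB τ hτ) (hPB 0 h0))) hIQ).trans ?_
  apply le_of_eq
  ring

end IBP

/-! ### Oscillating kernels -/

theorem Ker.memLp_smul {m : ℕ} {c : ZSpace d m → ℂ} {K : Ker d J m}
    (hc : AEStronglyMeasurable c volume) (hK : MemLp K ∞ volume) {C : ℝ}
    (hC : ∀ᵐ z, ‖c z • K z‖ ≤ C) : MemLp (fun z => c z • K z) ∞ volume :=
  memLp_top_of_ae_le (hc.smul hK.1) hC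

/-- The kernel `exp (iθφ) K`. -/
def oscKer {m : ℕ} (φ : ZSpace d m → ℝ) (K : Ker d J m) (θ : ℝ) : Ker d J m := fun z =>
  Complex.exp (Complex.I * θ * φ z) • K z

/-- The antiderivative `exp (iθφ) (iφ)⁻¹ K` of the kernel `exp (iθφ) K` with respect to `θ`. -/
def oscPrim {m : ℕ} (φ : ZSpace d m → ℝ) (K : Ker d J m) (θ : ℝ) : Ker d J m := fun z =>
  (Complex.exp (Complex.I * θ * φ z) / (Complex.I * φ z)) • K z

theorem norm_exp_I_mul_mul (θ x : ℝ) : ‖Complex.exp (Complex.I * θ * x)‖ = 1 := by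
  rw [show Complex.I * θ * x = ((θ * x : ℝ) : ℂ) * Complex.I by push_cast; ring]
  exact Complex.norm_exp_ofReal_mul_I _

/-- The second-order Taylor remainder |hx|² of the exponential, divided by |x|. It stays bounded by
h² uniformly for x in a bounded set. -/
theorem norm_exp_remainder_le {θ h x : ℝ} (hx : x ≠ 0) (hh : |h * x| ≤ 1) :
    ‖Complex.exp (Complex.I * (θ + h : ℝ) * x) / (Complex.I * x) -
      Complex.exp (Complex.I * θ * x) / (Complex.I * x) - h * Complex.exp (Complex.I * θ * x)‖ ≤
      |x| * h ^ 2 := by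
  have hx' : (x : ℂ) ≠ 0 := Complex.ofReal_ne_zero.2 hx
  have e : Complex.exp (Complex.I * (θ + h : ℝ) * x) / (Complex.I * x) -
      Complex.exp (Complex.I * θ * x) / (Complex.I * x) - h * Complex.exp (Complex.I * θ * x) =
      Complex.exp (Complex.I * θ * x) / (Complex.I * x) *
        (Complex.exp (Complex.I * (h * x : ℝ)) - 1 - Complex.I * (h * x : ℝ)) := by
    have : Complex.I * (θ + h : ℝ) * x = Complex.I * θ * x + Complex.I * (h * x : ℝ) := by
      push_cast; ring
    rw [this, Complex.exp_add]
    push_cast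
    field_simp
  rw [e, norm_mul, norm_div, norm_exp_I_mul_mul]
  have h1 : ‖Complex.I * ((h * x : ℝ) : ℂ)‖ = |h * x| := by
    rw [norm_mul, Complex.norm_I, one_mul, Complex.norm_real, Real.norm_eq_abs]
  have h2 := Complex.norm_exp_sub_one_sub_id_le (x := Complex.I * ((h * x : ℝ) : ℂ))
    (by rw [h1]; exact hh)
  rw [h1] at h2
  have h3 : ‖Complex.I * (x : ℂ)‖ = |x| := by
    rw [norm_mul, Complex.norm_I, one_mul, Complex.norm_real, Real.norm_eq_abs]
  rw [h3]
  have hxp : 0 < |x| := abs_pos.2 hx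
  calc 1 / |x| * ‖Complex.exp (Complex.I * ((h * x : ℝ) : ℂ)) - 1 -
        Complex.I * ((h * x : ℝ) : ℂ)‖ ≤ 1 / |x| * |h * x| ^ 2 := by gcongr
    _ = |x| * h ^ 2 := by
        rw [abs_mul, mul_pow, sq_abs]
        field_simp

section Osc

variable {m : ℕ} {φ : ZSpace d m → ℝ} {K : Ker d J m} {c C' C : ℝ}

theorem aestronglyMeasurable_exp_phase (hφ : AEStronglyMeasurable φ volume) (θ : ℝ) :
    AEStronglyMeasurable (fun z => Complex.exp (Complex.I * θ * φ z)) volume :=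
  Complex.continuous_exp.comp_aestronglyMeasurable
    ((Complex.continuous_ofReal.comp_aestronglyMeasurable hφ).const_mul _)

theorem memLp_oscKer (hφ : AEStronglyMeasurable φ volume) (hK : MemLp K ∞ volume) (θ : ℝ) :
    MemLp (oscKer φ K θ) ∞ volume := by
  refine Ker.memLp_smul (C := (eLpNorm K ∞ volume).toReal)
    (aestronglyMeasurable_exp_phase hφ θ) hK ?_
  filter_upwards [MemLp_top_ae_le hK] with z hz
  rwa [norm_smul, norm_exp_I_mul_mul, one_mul]

theorem norm_oscPrim_le (hc : 0 < c) (hC : 0 ≤ C) (hK : ∀ᵐ z, ‖K z‖ ≤ C)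
    (hφc : ∀ᵐ z, K z ≠ 0 → c ≤ |φ z|) (θ : ℝ) : ∀ᵐ z, ‖oscPrim φ K θ z‖ ≤ C / c := by
  filter_upwards [hK, hφc] with z h1 h2
  rw [oscPrim, norm_smul, norm_div, norm_exp_I_mul_mul, norm_mul, Complex.norm_I, one_mul,
    Complex.norm_real, Real.norm_eq_abs, one_div, inv_mul_eq_div]
  -- No lower bound on the phase is known where `K` vanishes; the kernel is zero there whatever the
  -- quotient is.
  by_cases h0 : K z = 0
  · rw [h0, norm_zero, zero_div]
    positivity
  · have := h2 h0
    gcongr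

theorem memLp_oscPrim (hφ : AEStronglyMeasurable φ volume) (hKm : MemLp K ∞ volume)
    (hc : 0 < c) (hC : 0 ≤ C) (hK : ∀ᵐ z, ‖K z‖ ≤ C)
    (hφc : ∀ᵐ z, K z ≠ 0 → c ≤ |φ z|) (θ : ℝ) : MemLp (oscPrim φ K θ) ∞ volume := by
  refine Ker.memLp_smul (C := C / c) ?_ hKm (norm_oscPrim_le hc hC hK hφc θ)
  have h1 : AEStronglyMeasurable (fun z => Complex.I * (φ z : ℂ)) volume :=
    (Complex.continuous_ofReal.comp_aestronglyMeasurable hφ).const_mul _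
  exact ((aestronglyMeasurable_exp_phase hφ θ).aemeasurable.div
    h1.aemeasurable).aestronglyMeasurable

/-- The phase is bounded on the support of `K`, so the Taylor remainder is O(h²) uniformly in z. The
derivative therefore exists in operator norm, unlike for the unlocalized field, where only strong
continuity is used. -/
theorem hasDerivAt_kerOp_oscPrim (hm : 1 ≤ m) (hφ : AEStronglyMeasurable φ volume)
    (hKm : MemLp K ∞ volume) (hc : 0 < c) (hC : 0 ≤ C) (hK : ∀ᵐ z, ‖K z‖ ≤ C)
    (hφc : ∀ᵐ z, K z ≠ 0 → c ≤ |φ z|) (hφC : ∀ᵐ z, K z ≠ 0 → |φ z| ≤ C') (θ : ℝ) :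
    HasDerivAt (fun θ => kerOp m (oscPrim φ K θ)) (kerOp m (oscKer φ K θ)) θ := by
  rw [hasDerivAt_iff_isLittleO_nhds_zero]
  have key : ∀ h : ℝ, |h| * |C'| ≤ 1 → ‖kerOp m (oscPrim φ K (θ + h)) - kerOp m (oscPrim φ K θ) -
      h • kerOp m (oscKer φ K θ)‖ ≤ (|C'| * C) * ‖h ^ 2‖ := by
    intro h hh
    have hm1 := memLp_oscPrim hφ hKm hc hC hK hφc (θ + h)
    have hm2 := memLp_oscPrim hφ hKm hc hC hK hφc θ
    have hm3 := memLp_oscKer hφ hKm θ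
    have hm4 : MemLp ((h : ℂ) • oscKer φ K θ) ∞ volume := hm3.const_smul (h : ℂ)
    have e : kerOp m (oscPrim φ K (θ + h)) - kerOp m (oscPrim φ K θ) - h • kerOp m (oscKer φ K θ) =
        kerOp m (oscPrim φ K (θ + h) - oscPrim φ K θ - (h : ℂ) • oscKer φ K θ) := by
      rw [kerOp_sub hm (memLp_top_sub hm1 hm2) hm4, kerOp_sub hm hm1 hm2, kerOp_smul hm hm3]
      rfl
    rw [e]
    refine norm_kerOp_le hm (memLp_top_sub (memLp_top_sub hm1 hm2) hm4) (by positivity) ?_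
    filter_upwards [hK, hφc, hφC] with z h1 h2 h3
    have e2 : (oscPrim φ K (θ + h) - oscPrim φ K θ - (h : ℂ) • oscKer φ K θ) z =
        (Complex.exp (Complex.I * (θ + h : ℝ) * φ z) / (Complex.I * φ z) -
      Complex.exp (Complex.I * θ * φ z) / (Complex.I * φ z) -
        h * Complex.exp (Complex.I * θ * φ z)) • K z := by
      refine ContinuousMultilinearMap.ext fun x => ?_
      change (_ : ℂ) • K z x - (_ : ℂ) • K z x - (h : ℂ) • (_ : ℂ) • K z x =
        ((_ : ℂ) - (_ : ℂ) - (_ : ℂ)) • K z x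
      rw [sub_smul, sub_smul, mul_smul]
    rw [e2, norm_smul]
    by_cases h0 : K z = 0
    · rw [h0, norm_zero, mul_zero]
      positivity
    have hφ0 : φ z ≠ 0 := abs_pos.1 (hc.trans_le (h2 h0))
    have hle : |φ z| ≤ |C'| := (h3 h0).trans (le_abs_self _)
    have h4 := norm_exp_remainder_le (θ := θ) (h := h) hφ0 (by
      rw [abs_mul]
      exact (mul_le_mul_of_nonneg_left hle (abs_nonneg _)).trans hh)
    calc _ ≤ (|φ z| * h ^ 2) * C := by gcongr
      _ ≤ (|C'| * h ^ 2) * C := by gcongr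
      _ = (|C'| * C) * ‖h ^ 2‖ := by rw [Real.norm_of_nonneg (sq_nonneg h)]; ring
  have hO : (fun h : ℝ => kerOp m (oscPrim φ K (θ + h)) - kerOp m (oscPrim φ K θ) -
      h • kerOp m (oscKer φ K θ)) =O[𝓝 0] fun h : ℝ => h ^ 2 := by
    refine Asymptotics.IsBigO.of_bound (|C'| * C) ?_
    have : ∀ᶠ h : ℝ in 𝓝 0, |h| * |C'| < 1 := by
      have hcont : Continuous fun h : ℝ => |h| * |C'| := by fun_prop
      exact (hcont.tendsto 0).eventually_lt_const (by simp)
    filter_upwards [this] with h hh using key h hh.le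
  exact hO.trans_isLittleO (by
    simpa using Asymptotics.isLittleO_pow_id (𝕜 := ℝ) (n := 2) one_lt_two)

end Osc

end

/-! ### The residual: exponentially small and nonresonant interactions. -/

section

open scoped ENNReal NNReal
open Filter Topology Metric

variable {d J N : ℕ}

/-! ### Dispersion relations near the centres -/

namespace LinearPart

variable (A : LinearPart d J)

theorem compl_bc_mem_nhds {k : KSpace d} (hk : k ∉ A.bc) : A.bcᶜ ∈ 𝓝 k :=
  A.isClosed_bc.isOpen_compl.mem_nhds hk

theorem continuousAt_ω {k : KSpace d} (hk : k ∉ A.bc) (n : Fin J) (ζ : ℤˣ) :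
    ContinuousAt (A.ω n ζ) k :=
  (A.ω_cont n ζ).continuousAt (A.compl_bc_mem_nhds hk)

theorem ω_eq_sgn_mul {k : KSpace d} (hk : k ∉ A.bc) (n : Fin J) (ζ : ℤˣ) :
    A.ω n ζ k = sgn ζ * A.ω n 1 (sgn ζ • k) := by
  rcases Int.units_eq_one_or ζ with rfl | rfl
  · simp [sgn]
  · have h := A.ω_symm k hk n (-1)
    rw [neg_neg] at h
    simp [sgn, h]

theorem ω_sgn_smul {k : KSpace d} (hk : k ∉ A.bc) (n : Fin J) (ζ : ℤˣ) :
    A.ω n ζ (sgn ζ • k) = sgn ζ * A.ω n 1 k := by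
  rcases Int.units_eq_one_or ζ with rfl | rfl
  · simp [sgn]
  · have h := A.ω_symm k hk n 1
    simp [sgn, h]

/-- Regularity is assumed at k but not at -k. Continuity at the reflected point comes from the
symmetry of the dispersion relations, which holds on a whole neighbourhood because the regular set
is open. -/
theorem continuousAt_ω_sgn_smul {k : KSpace d} (hk : k ∉ A.bc) (n : Fin J) (ζ : ℤˣ) :
    ContinuousAt (A.ω n ζ) (sgn ζ • k) := by
  have hc : ContinuousAt (fun x => sgn ζ * A.ω n 1 (sgn ζ • x)) (sgn ζ • k) := by
    refine continuousAt_const.mul (ContinuousAt.comp (f := fun x => sgn ζ • x) ?_ (by fun_prop))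
    rw [sgn_smul_sgn_smul]
    exact A.continuousAt_ω hk n 1
  refine hc.congr ?_
  have hcont : Tendsto (fun x : KSpace d => sgn ζ • x) (𝓝 (sgn ζ • k)) (𝓝 k) := by
    have : Continuous fun x : KSpace d => sgn ζ • x := by fun_prop
    simpa [sgn_smul_sgn_smul] using this.tendsto (sgn ζ • k)
  filter_upwards [hcont (A.compl_bc_mem_nhds hk)] with x hx
  have := A.ω_sgn_smul hx n ζ
  rw [sgn_smul_sgn_smul] at this
  exact this.symm

end LinearPart

theorem sgn_mul (ζ ζ' : ℤˣ) : sgn (ζ * ζ') = sgn ζ * sgn ζ' := by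
  simp [sgn]

theorem sgn_smul_kappa (S : Fin N → Fin J × KSpace d) {m : ℕ} (lam : Fin m → ℤˣ × Fin N)
    (ζ : ℤˣ) : sgn ζ • kappa S lam = kappa S fun j => (ζ * (lam j).1, (lam j).2) := by
  simp only [kappa, Finset.smul_sum, smul_smul, sgn_mul]

variable {A : LinearPart d J} {S : Fin N → Fin J × KSpace d} {M : Finset ℕ} {Cχ : ℝ}
  {χ : Susceptibility d J}

/-! ### Small radii -/

theorem eventually_separated (S : Fin N → Fin J × KSpace d) : ∀ᶠ r in 𝓝[>] (0 : ℝ),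
    Separated S r := by
  refine eventually_all.2 fun i => eventually_all.2 fun j => ?_
  by_cases h : center S i = center S j
  · exact Eventually.of_forall fun r hne => absurd h hne
  · have hc : Tendsto (fun r : ℝ => 2 * r) (𝓝[>] 0) (𝓝 0) := by
      have : Continuous fun r : ℝ => 2 * r := by fun_prop
      simpa using (this.tendsto 0).mono_left nhdsWithin_le_nhds
    filter_upwards [hc.eventually_lt_const (norm_pos_iff.2 (sub_ne_zero.2 h))] with r hr _ using hr

theorem eventually_outSeparated (M : Finset ℕ) (S : Fin N → Fin J × KSpace d) :
    ∀ᶠ r in 𝓝[>] (0 : ℝ), OutSeparated M S r := by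
  refine (Finset.eventually_all M).2 fun m _ => eventually_all.2 fun i =>
    eventually_all.2 fun lam => ?_
  by_cases h : kappa S lam = center S i
  · exact Eventually.of_forall fun r hne => absurd h hne
  · have hc : Tendsto (fun r : ℝ => (m + 1) * r) (𝓝[>] 0) (𝓝 0) := by
      have : Continuous fun r : ℝ => (m + 1 : ℝ) * r := by fun_prop
      simpa using (this.tendsto 0).mono_left nhdsWithin_le_nhds
    filter_upwards [hc.eventually_lt_const (norm_pos_iff.2 (sub_ne_zero.2 h))] with r hr _ using hr

/-! ### The part of the nonlinearity outside of the localized components -/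

variable (A S) in
/-- The projection onto the complement of the localized components. -/
def resid (r : ℝ) (k : KSpace d) : Amp J →L[ℂ] Amp J := 1 - ∑ i, expProj A S r 0 i k

variable (A S) in
/-- The component in the band `p` of the projection `resid`. -/
def resProj (r : ℝ) (p : Fin J × ℤˣ) (k : KSpace d) : Amp J →L[ℂ] Amp J :=
  (resid A S r k).comp (A.proj p.1 p.2 k)

theorem norm_resid_le (r : ℝ) (k : KSpace d) : ‖resid A S r k‖ ≤ 1 + 2 * N := by
  refine (norm_sub_le _ _).trans (add_le_add (ContinuousLinearMap.norm_id_le) ?_)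
  refine (norm_sum_le_of_le (n := fun _ => (1 : ℝ)) _
    fun i _ => norm_expProj_le_one r le_rfl i k).trans ?_
  simp

theorem memLp_resid (r : ℝ) : MemLp (resid A S r) ∞ volume := by
  have h1 : AEStronglyMeasurable (fun _ : KSpace d => (1 : Amp J →L[ℂ] Amp J)) volume :=
    aestronglyMeasurable_const
  have h2 := memLp_top_sum Finset.univ fun i _ => memLp_expProj A S r 0 i
  have e : (∑ i, expProj A S r 0 i) = fun k => ∑ i, expProj A S r 0 i k := by
    funext k
    rw [Finset.sum_apply]
  rw [e] at h2
  refine memLp_top_of_ae_le (h1.sub h2.1) (C := 1 + 2 * N) (Eventually.of_forall fun k => ?_)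
  have := norm_resid_le (A := A) (S := S) r k
  simpa [resid, Finset.sum_apply] using this

theorem norm_resProj_le (r : ℝ) (p : Fin J × ℤˣ) (k : KSpace d) :
    ‖resProj A S r p k‖ ≤ 1 + 2 * N :=
  (ContinuousLinearMap.opNorm_comp_le _ _).trans
    ((mul_le_of_le_one_right (norm_nonneg _) (A.norm_proj_le _ _ _)).trans (norm_resid_le r k))

theorem memLp_resProj (r : ℝ) (p : Fin J × ℤˣ) : MemLp (resProj A S r p) ∞ volume :=
  memLp_top_clm_comp (memLp_resid r) (A.memLp_proj p.1 p.2)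

/-- The split into bands makes the flow act as a scalar on each output, so that every interaction
acquires a definite phase. -/
theorem mulOp_resid_eq_sum (r : ℝ) (f : L1 d J) :
    mulOp (resid A S r) f = ∑ p, mulOp (resProj A S r p) f := by
  refine Lp.ext ((mulOp_coeFn (memLp_resid r) f).trans ?_)
  have h : ∀ᵐ k, ∀ p, mulOp (resProj A S r p) f k = resProj A S r p k (f k) :=
    eventually_all.2 fun p => mulOp_coeFn (memLp_resProj r p) f
  filter_upwards [h, Lp.coeFn_finsetSum Finset.univ fun p => mulOp (resProj A S r p) f,
    A.ae_notMem_bc] with k h1 h2 hk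
  rw [h2, Finset.sum_apply, Finset.sum_congr rfl fun p _ => h1 p]
  simp only [resProj, ContinuousLinearMap.comp_apply]
  rw [← map_sum, A.sum_proj hk]

theorem mulOp_resid (r : ℝ) (f : L1 d J) :
    mulOp (resid A S r) f = f - ∑ i, mulOp (expProj A S r 0 i) f :=
  mulOp_one_sub_sum Finset.univ (fun i => memLp_expProj A S r 0 i) (memLp_resid r) f

theorem resid_comp_expProj (hS : Function.Injective S) {r : ℝ} (hr : Separated S r)
    {k : KSpace d} (hk : k ∉ A.bc) (i : ℤˣ × Fin N) :
    (resid A S r k).comp (expProj A S r 0 i k) = 0 := by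
  have h : (∑ j, expProj A S r 0 j k).comp (expProj A S r 0 i k) = expProj A S r 0 i k := by
    ext1 x
    rw [ContinuousLinearMap.comp_apply, _root_.sum_apply,
      Finset.sum_eq_single i]
    · rw [← ContinuousLinearMap.comp_apply, expProj_comp, add_zero]
    · intro j _ hj
      rw [← ContinuousLinearMap.comp_apply, expProj_comp_of_ne hS hr hk hj]
      rfl
    · simp
  rw [resid, ContinuousLinearMap.sub_comp, h]
  exact sub_self _

/-- The hypothesis on `l` says that κ is the centre of the component (ζ, l). Near κ the projection
onto this band is thus one of those subtracted in `resid`. -/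
theorem resProj_eq_zero (hS : Function.Injective S) {r : ℝ} (hr : Separated S r)
    {k : KSpace d} (hk : k ∉ A.bc) {p : Fin J × ℤˣ} {κ : KSpace d} {l : Fin N}
    (hl : S l = (p.1, sgn p.2 • κ)) (hκ : ‖k - κ‖ ≤ r) : resProj A S r p k = 0 := by
  have hc : center S (p.2, l) = κ := by
    simp only [center, hl, sgn_smul_sgn_smul]
  have h1 : expProj A S r 0 (p.2, l) k = A.proj p.1 p.2 k := by
    rw [expProj_zero_of_le (by rwa [hc])]
    simp only [hl]
  rw [resProj, ← h1]
  exact resid_comp_expProj hS hr hk _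

variable (A S χ) in
/-- The kernel of the interaction of the components `lam j` with output in the band `p` outside of
the localized components. -/
def resKer (r a θ : ℝ) (m : ℕ) (p : Fin J × ℤˣ) (lam : Fin m → ℤˣ × Fin N) : Ker d J m :=
  ((fieldKer A χ θ m).rmul fun j => expProj A S r (-a) (lam j)).lmul (resProj A S r p)

variable (A S χ) in
/-- The kernel `resKer` without the oscillating factor. -/
def resBase (r a : ℝ) (m : ℕ) (p : Fin J × ℤˣ) (lam : Fin m → ℤˣ × Fin N) : Ker d J m :=
  ((baseKer χ m).rmul fun j => expProj A S r (-a) (lam j)).lmul (resProj A S r p)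

variable (A S) in
/-- The phase of an interaction. -/
def phase {m : ℕ} (p : Fin J × ℤˣ) (lam : Fin m → ℤˣ × Fin N) (z : ZSpace d m) : ℝ :=
  A.ω p.1 p.2 z.1 - ∑ j, A.ω (S (lam j).2).1 (lam j).1 (wv z j)

theorem aestronglyMeasurable_phase {m : ℕ} (p : Fin J × ℤˣ) (lam : Fin m → ℤˣ × Fin N) :
    AEStronglyMeasurable (phase A S p lam) volume := by
  have hω : ∀ n ζ, AEStronglyMeasurable (A.ω n ζ) volume := fun n ζ =>
    A.aestronglyMeasurable_of_continuousOn (A.ω_cont n ζ)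
  refine AEStronglyMeasurable.sub
    ((hω p.1 p.2).comp_quasiMeasurePreserving Measure.quasiMeasurePreserving_fst) ?_
  have := Finset.aestronglyMeasurable_sum Finset.univ fun j _ =>
    aestronglyMeasurable_comp_wv (m := m) (hω (S (lam j).2).1 (lam j).1) j
  simpa [Finset.sum_fn] using this

section Kernels

variable {m : ℕ} {r a : ℝ} {p : Fin J × ℤˣ} {lam : Fin m → ℤˣ × Fin N}

theorem flow_comp_expProj {k : KSpace d} (hk : k ∉ A.bc) (θ r b : ℝ) (i : ℤˣ × Fin N) :
    (A.flow θ k).comp (expProj A S r b i k) =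
      Complex.exp (Complex.I * θ * A.ω (S i.2).1 i.1 k) • expProj A S r b i k := by
  by_cases h : ‖k - center S i‖ ≤ r
  · rw [expProj_of_le h, ContinuousLinearMap.comp_smul, A.flow_proj hk, smul_comm]
  · rw [expProj_of_not_le h, ContinuousLinearMap.comp_zero]
    ext1 x
    rw [_root_.smul_apply, _root_.zero_apply, smul_zero]

theorem resProj_comp_flow {k : KSpace d} (hk : k ∉ A.bc) (θ r : ℝ) (p : Fin J × ℤˣ) :
    (resProj A S r p k).comp (A.flow θ k) =
      Complex.exp (Complex.I * θ * A.ω p.1 p.2 k) • resProj A S r p k := by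
  rw [resProj, ContinuousLinearMap.comp_assoc, A.proj_flow hk, ContinuousLinearMap.comp_smul]

/-- Every flow factor stands next to a spectral projection and becomes a scalar exponential. By
multilinearity the scalars collect into one phase, leaving a time-independent kernel. -/
theorem resKer_ae_eq (r a θ : ℝ) (p : Fin J × ℤˣ) (lam : Fin m → ℤˣ × Fin N) :
    resKer A S χ r a θ m p lam =ᵐ[volume]
      oscKer (phase A S p lam) (resBase A S χ r a m p lam) θ := by
  filter_upwards [ae_notMem_bc_ZSpace A m] with z hz
  refine ContinuousMultilinearMap.ext fun x => ?_
  change resProj A S r p z.1 (A.flow θ z.1 (baseKer χ m z fun j =>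
      A.flow (-θ) (wv z j) (expProj A S r (-a) (lam j) (wv z j) (x j)))) =
    Complex.exp (Complex.I * θ * phase A S p lam z) • resProj A S r p z.1 (baseKer χ m z fun j =>
      expProj A S r (-a) (lam j) (wv z j) (x j))
  have h1 : ∀ y, resProj A S r p z.1 (A.flow θ z.1 y) =
      Complex.exp (Complex.I * θ * A.ω p.1 p.2 z.1) • resProj A S r p z.1 y := fun y =>
    congrArg (fun T : Amp J →L[ℂ] Amp J => T y) (resProj_comp_flow hz.1 θ r p)
  have h2 : ∀ j, A.flow (-θ) (wv z j) (expProj A S r (-a) (lam j) (wv z j) (x j)) =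
      Complex.exp (Complex.I * (-θ : ℝ) * A.ω (S (lam j).2).1 (lam j).1 (wv z j)) •
        expProj A S r (-a) (lam j) (wv z j) (x j) := fun j =>
    congrArg (fun T : Amp J →L[ℂ] Amp J => T (x j)) (flow_comp_expProj (hz.2 j) (-θ) r (-a) (lam j))
  rw [h1]
  simp only [h2]
  rw [ContinuousMultilinearMap.map_smul_univ, map_smul, smul_smul, ← Complex.exp_sum,
    ← Complex.exp_add]
  congr 2
  rw [← Finset.mul_sum, phase]
  push_cast
  ring

theorem memLp_resKer (hχ : IsAdmissible A M Cχ χ) (hm : m ∈ M) (hm1 : 1 ≤ m) (r a θ : ℝ)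
    (p : Fin J × ℤˣ) (lam : Fin m → ℤˣ × Fin N) :
    MemLp (resKer A S χ r a θ m p lam) ∞ volume :=
  Ker.memLp_lmul (memLp_resProj r p) (Ker.memLp_rmul (fun _ => memLp_expProj A S r _ _)
    (memLp_fieldKer hχ hm hm1 θ))

theorem memLp_resBase (hχ : IsAdmissible A M Cχ χ) (hm : m ∈ M) (hm1 : 1 ≤ m) (r a : ℝ)
    (p : Fin J × ℤˣ) (lam : Fin m → ℤˣ × Fin N) :
    MemLp (resBase A S χ r a m p lam) ∞ volume :=
  Ker.memLp_lmul (memLp_resProj r p) (Ker.memLp_rmul (fun _ => memLp_expProj A S r _ _)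
    (memLp_baseKer hχ hm hm1))

theorem prod_norm_expProj_le_one (ha : 0 ≤ a) (z : ZSpace d m) :
    ∏ j, ‖expProj A S r (-a) (lam j) (wv z j)‖ ≤ 1 :=
  Finset.prod_le_one (fun _ _ => norm_nonneg _)
    fun j _ => norm_expProj_le_one r (by linarith) (lam j) _

theorem norm_lmul_rmul_le {K : Ker d J m} {z : ZSpace d m} {C : ℝ} (hK : ‖K z‖ ≤ C)
    (r a : ℝ) (p : Fin J × ℤˣ) (lam : Fin m → ℤˣ × Fin N) :
    ‖((K.rmul fun j => expProj A S r (-a) (lam j)).lmul (resProj A S r p)) z‖ ≤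
      ‖resProj A S r p z.1‖ * (C * ∏ j, ‖expProj A S r (-a) (lam j) (wv z j)‖) := by
  refine (Ker.norm_lmul_le _ _ z).trans ?_
  gcongr
  refine (Ker.norm_rmul_le _ _ z).trans ?_
  gcongr

theorem norm_resKer_le (hχ : IsAdmissible A M Cχ χ) (hm : m ∈ M) (ha : 0 ≤ a) (r θ : ℝ)
    (p : Fin J × ℤˣ) (lam : Fin m → ℤˣ × Fin N) :
    ∀ᵐ z, ‖resKer A S χ r a θ m p lam z‖ ≤ (1 + 2 * N) * |Cχ| := by
  filter_upwards [norm_fieldKer_le hχ hm θ] with z hz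
  refine (norm_lmul_rmul_le hz r a p lam).trans ?_
  refine mul_le_mul (norm_resProj_le r p _) ?_ (by positivity) (by positivity)
  exact mul_le_of_le_one_right (abs_nonneg _) (prod_norm_expProj_le_one ha z)

theorem norm_resBase_le (hχ : IsAdmissible A M Cχ χ) (hm : m ∈ M) (ha : 0 ≤ a) (r : ℝ)
    (p : Fin J × ℤˣ) (lam : Fin m → ℤˣ × Fin N) :
    ∀ᵐ z, ‖resBase A S χ r a m p lam z‖ ≤ (1 + 2 * N) * |Cχ| := by
  filter_upwards [norm_baseKer_le hχ hm] with z hz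
  refine (norm_lmul_rmul_le hz r a p lam).trans ?_
  refine mul_le_mul (norm_resProj_le r p _) ?_ (by positivity) (by positivity)
  exact mul_le_of_le_one_right (abs_nonneg _) (prod_norm_expProj_le_one ha z)

/-- Within distance r of κ the output projection vanishes; beyond r the input weights give at most
e^{-ar}. -/
theorem norm_resKer_le_exp (hχ : IsAdmissible A M Cχ χ) (hm : m ∈ M) (hm1 : 1 ≤ m)
    (hS : Function.Injective S) (hr : Separated S r) (ha : 0 ≤ a) (θ : ℝ) {l : Fin N}
    (hl : S l = (p.1, sgn p.2 • kappa S lam)) :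
    ∀ᵐ z, ‖resKer A S χ r a θ m p lam z‖ ≤ (1 + 2 * N) * |Cχ| * Real.exp (-(a * r)) := by
  filter_upwards [norm_fieldKer_le hχ hm θ, ae_notMem_bc_ZSpace A m] with z hz hbc
  refine (norm_lmul_rmul_le hz r a p lam).trans ?_
  by_cases hκ : ‖z.1 - kappa S lam‖ ≤ r
  · rw [resProj_eq_zero hS hr hbc.1 hl hκ, norm_zero, zero_mul]
    positivity
  · rw [mul_assoc]
    refine mul_le_mul (norm_resProj_le r p _) ?_ (by positivity) (by positivity)
    refine mul_le_mul_of_nonneg_left ((prod_norm_expProj_le hm1 z lam r ha).trans ?_)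
      (abs_nonneg _)
    gcongr
    exact (not_le.1 hκ).le

theorem resBase_eq_zero {z : ZSpace d m} (h : ¬ ∀ j, ‖wv z j - center S (lam j)‖ ≤ r) :
    resBase A S χ r a m p lam z = 0 := by
  have h1 := norm_lmul_rmul_le (A := A) (S := S) (K := baseKer χ m) (z := z) le_rfl r a p lam
  rw [prod_norm_expProj_eq_zero h, mul_zero, mul_zero] at h1
  exact norm_le_zero_iff.1 h1

theorem kerOp_resKer_apply (hχ : IsAdmissible A M Cχ χ) (hm : m ∈ M) (hm1 : 1 ≤ m) (r a θ : ℝ)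
    (p : Fin J × ℤˣ) (lam : Fin m → ℤˣ × Fin N) (v : Fin m → L1 d J) :
    kerOp m (resKer A S χ r a θ m p lam) v = mulOp (resProj A S r p)
      (kerOp m (fieldKer A χ θ m) fun j => mulOp (expProj A S r (-a) (lam j)) (v j)) :=
  kerOp_lmul_rmul_apply hm1 (memLp_fieldKer hχ hm hm1 θ) (memLp_resProj r p)
    (fun _ => memLp_expProj A S r _ _) v

theorem continuous_kerOp_resKer (hχ : IsAdmissible A M Cχ χ) (hm : m ∈ M) (hm1 : 1 ≤ m)
    (ha : 0 ≤ a) (r ϱ : ℝ) (p : Fin J × ℤˣ) (lam : Fin m → ℤˣ × Fin N) {v : ℝ → Fin m → L1 d J}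
    (hv : Continuous v) :
    Continuous fun t => kerOp m (resKer A S χ r a (t / ϱ) m p lam) (v t) := by
  refine continuous_multilinear_apply (C := (1 + 2 * N) * |Cχ|) (fun x => ?_) (fun t => ?_) hv
  · simp only [kerOp_resKer_apply hχ hm hm1]
    exact (mulOp _).continuous.comp ((continuous_kerOp_fieldKer hχ hm hm1 _).comp
      (continuous_id.div_const ϱ))
  · exact norm_kerOp_le hm1 (memLp_resKer hχ hm hm1 _ _ _ _ _) (by positivity)
      (norm_resKer_le hχ hm ha r _ p lam)

end Kernels

theorem residual_eq (hχ : IsAdmissible A M Cχ χ) (hM : ∀ m ∈ M, 1 ≤ m) (r a θ : ℝ)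
    (v : ℤˣ × Fin N → L1 d J) :
    field A M χ θ (assemble A S r a v) -
        ∑ i, mulOp (expProj A S r 0 i) (field A M χ θ (assemble A S r a v)) =
      ∑ m ∈ M, ∑ lam : Fin m → ℤˣ × Fin N, ∑ p,
        kerOp m (resKer A S χ r a θ m p lam) fun j => v (lam j) := by
  rw [← mulOp_resid, field, map_sum]
  refine Finset.sum_congr rfl fun m hm => ?_
  rw [kerOp_fieldKer_assemble, map_sum]
  refine Finset.sum_congr rfl fun lam _ => ?_
  rw [mulOp_resid_eq_sum]
  refine Finset.sum_congr rfl fun p _ => ?_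
  rw [kerOp_resKer_apply hχ hm (hM m hm)]

/-! ### Nonresonant interactions -/

theorem kappa_notMem_bc (hns : NonSingular A M S) {m : ℕ} (hm : m ∈ M)
    (lam : Fin m → ℤˣ × Fin N) : kappa S lam ∉ A.bc := fun h =>
  (Set.eq_empty_iff_forall_notMem.1 hns.2 (kappa S lam)) ⟨⟨m, hm, lam, rfl⟩, h⟩

/-- By the symmetry of the dispersion relations, a vanishing phase at the centres is the resonance
equation, and invariance would put the output pair into the spectrum. -/
theorem phase_center_ne_zero (hns : NonSingular A M S) (hri : ResonanceInvariant A M S) {m : ℕ}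
    (hm : m ∈ M) {p : Fin J × ℤˣ} {lam : Fin m → ℤˣ × Fin N}
    (hnr : ¬ ∃ l, S l = (p.1, sgn p.2 • kappa S lam)) :
    A.ω p.1 p.2 (kappa S lam) - ∑ j, A.ω (S (lam j).2).1 (lam j).1 (center S (lam j)) ≠ 0 := by
  intro h
  apply hnr
  have hres : IsResonant A S p.2 p.1 lam := by
    rw [A.ω_eq_sgn_mul (kappa_notMem_bc hns hm lam)] at h
    have h2 : ∀ j, A.ω (S (lam j).2).1 (lam j).1 (center S (lam j)) =
        sgn (lam j).1 * A.ω (S (lam j).2).1 1 (S (lam j).2).2 := fun j =>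
      A.ω_sgn_smul (hns.1 _) _ _
    simp only [h2] at h
    rw [IsResonant]
    linarith
  -- Membership in the output spectrum requires ζκ itself to be an output wavevector: it is the one
  -- with all input signs multiplied by ζ.
  have hmem : ((p.1, sgn p.2 • kappa S lam) : Fin J × KSpace d) ∈ resSelect A M S :=
    Or.inr ⟨⟨m, hm, _, sgn_smul_kappa S lam p.2⟩, m, hm, p.2, lam, rfl, hres⟩
  rw [hri] at hmem
  exact hmem

/-- As a function of the m independent wavevectors the phase is continuous at the centres and
nonzero there. The bounds c and C' are fixed before the radius shrinks. -/
theorem eventually_phase_bounds (hns : NonSingular A M S) (hri : ResonanceInvariant A M S) {m : ℕ}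
    (hm : m ∈ M) (hm1 : 1 ≤ m) {p : Fin J × ℤˣ} {lam : Fin m → ℤˣ × Fin N}
    (hnr : ¬ ∃ l, S l = (p.1, sgn p.2 • kappa S lam)) :
    ∃ c C' : ℝ, 0 < c ∧ ∀ᶠ r in 𝓝[>] (0 : ℝ), ∀ z : ZSpace d m,
      (∀ j, ‖wv z j - center S (lam j)‖ ≤ r) →
        c ≤ |phase A S p lam z| ∧ |phase A S p lam z| ≤ C' := by
  set x₀ : Fin m → KSpace d := fun j => center S (lam j) with hx₀
  set Φ : (Fin m → KSpace d) → ℝ := fun x =>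
    A.ω p.1 p.2 (∑ j, x j) - ∑ j, A.ω (S (lam j).2).1 (lam j).1 (x j) with hΦ
  have hΦ0 : Φ x₀ ≠ 0 := phase_center_ne_zero hns hri hm hnr
  have hcont : ContinuousAt Φ x₀ := by
    refine ContinuousAt.sub ?_ (tendsto_finsetSum _ fun j _ => ?_)
    · refine ContinuousAt.comp (f := fun x : Fin m → KSpace d => ∑ j, x j) ?_ (by fun_prop)
      exact A.continuousAt_ω (kappa_notMem_bc hns hm lam) _ _
    · exact ContinuousAt.comp (f := fun x : Fin m → KSpace d => x j)
        (A.continuousAt_ω_sgn_smul (hns.1 _) _ _) (continuous_apply j).continuousAt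
  have hpos : 0 < |Φ x₀| := abs_pos.2 hΦ0
  have h1 : ∀ᶠ x in 𝓝 x₀, |Φ x₀| / 2 < |Φ x| :=
    (hcont.abs).eventually_const_lt (by linarith)
  have h2 : ∀ᶠ x in 𝓝 x₀, |Φ x| < 2 * |Φ x₀| :=
    (hcont.abs).eventually_lt_const (by linarith)
  obtain ⟨r₀, hr₀, hball⟩ := Metric.eventually_nhds_iff.1 (h1.and h2)
  refine ⟨|Φ x₀| / 2, 2 * |Φ x₀|, by positivity, ?_⟩
  filter_upwards [Ioo_mem_nhdsGT hr₀] with r hr z hz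
  have hd : dist (wv z) x₀ < r₀ := by
    refine lt_of_le_of_lt ((dist_pi_le_iff hr.1.le).2 fun j => ?_) hr.2
    rw [dist_eq_norm]
    exact hz j
  have e : phase A S p lam z = Φ (wv z) := by
    simp only [phase, hΦ]
    rw [sum_wavevectors hm1]
  rw [e]
  exact ⟨(hball hd).1.le, (hball hd).2.le⟩

/-- Dichotomy: an output pair in the spectrum gives the exponential factor by a direct bound on the
kernel, and any other is nonresonant and gains ϱ by integration by parts. The constant is chosen
before r, a, ϱ and the trajectory. -/
theorem exists_interaction_bound (hχ : IsAdmissible A M Cχ χ) (hS : Function.Injective S)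
    (hns : NonSingular A M S) (hri : ResonanceInvariant A M S) {m : ℕ} (hm : m ∈ M) (hm1 : 1 ≤ m)
    (p : Fin J × ℤˣ) (lam : Fin m → ℤˣ × Fin N) {B B' T : ℝ} (hB : 0 ≤ B) (hB' : 0 ≤ B')
    (hT : 0 ≤ T) :
    ∃ D : ℝ, 0 ≤ D ∧ ∀ᶠ r in 𝓝[>] (0 : ℝ), ∀ a ϱ : ℝ, 0 ≤ a → 0 < ϱ →
      ∀ v g : ℝ → ℤˣ × Fin N → L1 d J, Continuous g → (∀ t, HasDerivAt v (g t) t) →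
        (∀ t ∈ Icc 0 T, ‖v t‖ ≤ B) → (∀ t ∈ Icc 0 T, ‖g t‖ ≤ B') → ∀ τ ∈ Icc 0 T,
          ‖∫ t in (0 : ℝ)..τ, kerOp m (resKer A S χ r a (t / ϱ) m p lam) fun j => v t (lam j)‖ ≤
            D * (ϱ + Real.exp (-(a * r))) := by
  by_cases hnr : ∃ l, S l = (p.1, sgn p.2 • kappa S lam)
  · obtain ⟨l, hl⟩ := hnr
    refine ⟨(1 + 2 * N) * |Cχ| * B ^ m * T, by positivity, ?_⟩
    filter_upwards [eventually_separated S] with r hr a ϱ ha hϱ v g _ _ hv _ τ hτ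
    have h1 : ∀ t ∈ Set.uIoc (0 : ℝ) τ, ‖kerOp m (resKer A S χ r a (t / ϱ) m p lam) fun j =>
        v t (lam j)‖ ≤ (1 + 2 * N) * |Cχ| * Real.exp (-(a * r)) * B ^ m := by
      intro t ht
      rw [uIoc_of_le hτ.1] at ht
      exact ContinuousMultilinearMap.norm_apply_le_of_le _
        (norm_kerOp_le hm1 (memLp_resKer hχ hm hm1 _ _ _ _ _) (by positivity)
          (norm_resKer_le_exp hχ hm hm1 hS hr ha _ hl))
        fun j => (norm_le_pi_norm (v t) (lam j)).trans (hv t ⟨ht.1.le, ht.2.trans hτ.2⟩)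
    refine (intervalIntegral.norm_integral_le_of_norm_le_const h1).trans ?_
    rw [sub_zero, abs_of_nonneg hτ.1]
    calc (1 + 2 * N) * |Cχ| * Real.exp (-(a * r)) * B ^ m * τ
        ≤ (1 + 2 * N) * |Cχ| * Real.exp (-(a * r)) * B ^ m * T := by gcongr; exact hτ.2
      _ = (1 + 2 * N) * |Cχ| * B ^ m * T * Real.exp (-(a * r)) := by ring
      _ ≤ _ := by gcongr; linarith
  · obtain ⟨c, C', hc, hev⟩ := eventually_phase_bounds hns hri hm hm1 hnr
    set C : ℝ := (1 + 2 * N) * |Cχ| with hC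
    have hC0 : 0 ≤ C := by positivity
    refine ⟨C / c * (2 * B ^ m + T * (m * (B ^ (m - 1) * B'))), by positivity, ?_⟩
    filter_upwards [hev] with r hr a ϱ ha hϱ v g hg hvg hv hgB τ hτ
    set φ := phase A S p lam with hφ
    set K := resBase A S χ r a m p lam with hK
    have hφm : AEStronglyMeasurable φ volume := aestronglyMeasurable_phase p lam
    have hKm : MemLp K ∞ volume := memLp_resBase hχ hm hm1 r a p lam
    have hKC : ∀ᵐ z, ‖K z‖ ≤ C := norm_resBase_le hχ hm ha r p lam
    have hsupp : ∀ z, K z ≠ 0 → c ≤ |φ z| ∧ |φ z| ≤ C' := fun z hz => hr z (by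
      by_contra h
      exact hz (resBase_eq_zero h))
    have hφc : ∀ᵐ z, K z ≠ 0 → c ≤ |φ z| := Eventually.of_forall fun z hz => (hsupp z hz).1
    have hφC : ∀ᵐ z, K z ≠ 0 → |φ z| ≤ C' := Eventually.of_forall fun z hz => (hsupp z hz).2
    have hop : ∀ θ, kerOp m (resKer A S χ r a θ m p lam) = kerOp m (oscKer φ K θ) := fun θ =>
      kerOp_congr hm1 (memLp_resKer hχ hm hm1 _ _ _ _ _) (resKer_ae_eq r a θ p lam)
    have hvi : ∀ i t, HasDerivAt (fun t => v t i) (g t i) t := fun i t =>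
      hasDerivAt_pi.1 (hvg t) i
    have hvc : Continuous v := continuous_iff_continuousAt.2 fun t => (hvg t).continuousAt
    -- The kernel depends on t through t/ϱ, so its time antiderivative carries the factor ϱ, which
    -- is the whole gain.
    have hP : ∀ t, HasDerivAt (fun t => ϱ • kerOp m (oscPrim φ K (t / ϱ)))
        (kerOp m (resKer A S χ r a (t / ϱ) m p lam)) t := by
      intro t
      have h1 := hasDerivAt_kerOp_oscPrim hm1 hφm hKm hc hC0 hKC hφc hφC (t / ϱ)
      have h2 := (HasDerivAt.scomp t h1 ((hasDerivAt_id t).div_const ϱ)).const_smul ϱ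
      rw [hop]
      refine h2.congr_deriv ?_
      rw [smul_smul, mul_one_div_cancel hϱ.ne', one_smul]
    have hδ : ∀ t : ℝ, ‖ϱ • kerOp m (oscPrim φ K (t / ϱ))‖ ≤ ϱ * (C / c) := by
      intro t
      rw [norm_smul, Real.norm_of_nonneg hϱ.le]
      gcongr
      exact norm_kerOp_le hm1 (memLp_oscPrim hφm hKm hc hC0 hKC hφc _) (by positivity)
        (norm_oscPrim_le hc hC0 hKC hφc _)
    have hlamc : Continuous fun t => fun j => v t (lam j) :=
      continuous_pi fun j => (continuous_apply (lam j)).comp hvc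
    have := norm_integral_multilinear_le (v := fun j t => v t (lam j)) (B := B) (B' := B') (T := T)
      hP hδ (continuous_kerOp_resKer hχ hm hm1 ha r ϱ p lam hlamc)
      (fun j t => hvi (lam j) t) (fun j => (continuous_apply (lam j)).comp hg)
      (fun j t ht => (norm_le_pi_norm (v t) (lam j)).trans (hv t ht))
      (fun j t ht => (norm_le_pi_norm (g t) (lam j)).trans (hgB t ht)) hB hB' hτ
    refine this.trans ?_
    calc ϱ * (C / c) * (2 * B ^ m + T * (m * (B ^ (m - 1) * B')))
        = C / c * (2 * B ^ m + T * (m * (B ^ (m - 1) * B'))) * ϱ := by ring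
      _ ≤ _ := by
        gcongr
        linarith [Real.exp_pos (-(a * r))]

theorem exists_residual_bound (hχ : IsAdmissible A M Cχ χ) (hM : ∀ m ∈ M, 1 ≤ m)
    (hS : Function.Injective S) (hns : NonSingular A M S) (hri : ResonanceInvariant A M S)
    {B B' T : ℝ} (hB : 0 ≤ B) (hB' : 0 ≤ B') (hT : 0 ≤ T) :
    ∃ D : ℝ, 0 ≤ D ∧ ∀ᶠ r in 𝓝[>] (0 : ℝ), ∀ a ϱ : ℝ, 0 ≤ a → 0 < ϱ →
      ∀ v g : ℝ → ℤˣ × Fin N → L1 d J, Continuous g → (∀ t, HasDerivAt v (g t) t) →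
        (∀ t ∈ Icc 0 T, ‖v t‖ ≤ B) → (∀ t ∈ Icc 0 T, ‖g t‖ ≤ B') → ∀ τ ∈ Icc 0 T,
          ‖∫ t in (0 : ℝ)..τ, (field A M χ (t / ϱ) (assemble A S r a (v t)) -
            ∑ i, mulOp (expProj A S r 0 i) (field A M χ (t / ϱ) (assemble A S r a (v t))))‖ ≤
            D * (ϱ + Real.exp (-(a * r))) := by
  have h := fun (m : M) (lam : Fin m → ℤˣ × Fin N) (p : Fin J × ℤˣ) =>
    exists_interaction_bound hχ hS hns hri m.2 (hM m m.2) p lam hB hB' hT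
  choose D hD hev using h
  refine ⟨∑ m : M, ∑ lam : Fin m → ℤˣ × Fin N, ∑ p, D m lam p,
    Finset.sum_nonneg fun m _ => Finset.sum_nonneg fun lam _ => Finset.sum_nonneg fun p _ =>
      hD m lam p, ?_⟩
  have hall := eventually_all.2 fun m => eventually_all.2 fun lam => eventually_all.2 fun p =>
    hev m lam p
  filter_upwards [hall] with r hr a ϱ ha hϱ v g hg hvg hv hgB τ hτ
  have hvc : Continuous v := continuous_iff_continuousAt.2 fun t => (hvg t).continuousAt
  have hcont : ∀ (m : M) (lam : Fin m → ℤˣ × Fin N) (p : Fin J × ℤˣ), Continuous fun t =>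
      kerOp (m : ℕ) (resKer A S χ r a (t / ϱ) m p lam) fun j => v t (lam j) := fun m lam p =>
    continuous_kerOp_resKer hχ m.2 (hM m m.2) ha r ϱ p lam
      (continuous_pi fun j => (continuous_apply (lam j)).comp hvc)
  simp only [residual_eq hχ hM]
  have e : ∀ t, (∑ m ∈ M, ∑ lam : Fin m → ℤˣ × Fin N, ∑ p,
        kerOp m (resKer A S χ r a (t / ϱ) m p lam) fun j => v t (lam j)) =
      ∑ m : M, ∑ lam : Fin m → ℤˣ × Fin N, ∑ p,
        kerOp (m : ℕ) (resKer A S χ r a (t / ϱ) m p lam) fun j => v t (lam j) := fun t =>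
    (Finset.sum_coe_sort M fun m => ∑ lam : Fin m → ℤˣ × Fin N, ∑ p,
        kerOp m (resKer A S χ r a (t / ϱ) m p lam) fun j => v t (lam j)).symm
  simp only [e]
  rw [intervalIntegral.integral_finsetSum fun m _ => (continuous_finsetSum _ fun lam _ =>
    continuous_finsetSum _ fun p _ => hcont m lam p).intervalIntegrable _ _, Finset.sum_mul]
  refine norm_sum_le_of_le _ fun m _ => ?_
  rw [intervalIntegral.integral_finsetSum fun lam _ => (continuous_finsetSum _ fun p _ =>
    hcont m lam p).intervalIntegrable _ _, Finset.sum_mul]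
  refine norm_sum_le_of_le _ fun lam _ => ?_
  rw [intervalIntegral.integral_finsetSum fun p _ => (hcont m lam p).intervalIntegrable _ _,
    Finset.sum_mul]
  exact norm_sum_le_of_le _ fun p _ => hr m lam p a ϱ ha hϱ v g hg hvg hv hgB τ hτ

end

section

open scoped ENNReal NNReal
open Filter Topology Metric

variable {d J N : ℕ}

/-! ### Comparison of the exact and of the localized evolution -/

/-- The defect is small only after integration in time. Adding the integrated defect e to w turns it
into the pointwise defect F(w) - F(w + e), which is at most K·E; Gronwall then applies to w + e.
Since E ≤ 1, the ball of radius R + 1 contains w + e. -/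
theorem norm_sub_le_of_integral_defect {X : Type*} [NormedAddCommGroup X] [NormedSpace ℝ X]
    [CompleteSpace X] {F : ℝ → X → X} {K : ℝ≥0} {R E T : ℝ} (hT : 0 ≤ T)
    (hc : ∀ x, Continuous fun t => F t x)
    (hl : ∀ t, LipschitzOnWith K (F t) (closedBall 0 (R + 1)))
    {u g w w' : ℝ → X} (hu : ∀ t, HasDerivAt u (g t) t) (hug : ∀ t ∈ Icc 0 T, g t = F t (u t))
    (huR : ∀ t ∈ Icc 0 T, ‖u t‖ ≤ R) (hw : ∀ t, HasDerivAt w (w' t) t) (hw' : Continuous w')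
    (hwR : ∀ t ∈ Icc 0 T, ‖w t‖ ≤ R) (hE : E ≤ 1)
    (hdef : ∀ τ ∈ Icc 0 T, ‖∫ t in (0 : ℝ)..τ, (F t (w t) - w' t)‖ ≤ E) :
    ∀ τ ∈ Icc 0 T, ‖u τ - w τ‖ ≤ (‖u 0 - w 0‖ + 2 * E) * Real.exp ((K + 1) * T) := by
  have hE0 : 0 ≤ E := (norm_nonneg _).trans (hdef 0 (left_mem_Icc.2 hT))
  have hwc : Continuous w := continuous_iff_continuousAt.2 fun t => (hw t).continuousAt
  have huc : Continuous u := continuous_iff_continuousAt.2 fun t => (hu t).continuousAt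
  -- Freezing w outside [0, T] keeps it in the ball for all times, so that the integrated defect is
  -- differentiable everywhere.
  set ψ : ℝ → X := fun t => w (projIcc 0 T hT t) with hψ
  have hψc : Continuous ψ := hwc.comp (continuous_subtype_val.comp continuous_projIcc)
  have hψw : ∀ t ∈ Icc 0 T, ψ t = w t := fun t ht => by simp only [hψ, projIcc_of_mem hT ht]
  have hψm : ∀ t, ψ t ∈ closedBall (0 : X) (R + 1) := fun t => by
    rw [mem_closedBall_zero_iff]
    linarith [hwR _ (projIcc 0 T hT t).2]
  have hFc : Continuous fun t => F t (ψ t) :=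
    continuousOn_univ.1 (continuous_field_comp hc hl hψc.continuousOn fun t _ => hψm t)
  set e : ℝ → X := fun τ => ∫ t in (0 : ℝ)..τ, (F t (ψ t) - w' t) with he
  have hed : ∀ t, HasDerivAt e (F t (ψ t) - w' t) t := fun t =>
    ((hFc.sub hw').integral_hasStrictDerivAt 0 t).hasDerivAt
  have heE : ∀ τ ∈ Icc 0 T, ‖e τ‖ ≤ E := fun τ hτ => by
    have : e τ = ∫ t in (0 : ℝ)..τ, (F t (w t) - w' t) := by
      refine intervalIntegral.integral_congr fun t ht => ?_
      rw [uIcc_of_le hτ.1] at ht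
      simp only [hψw t ⟨ht.1, ht.2.trans hτ.2⟩]
    rw [this]
    exact hdef τ hτ
  have hzd : ∀ t, HasDerivAt (fun t => w t + e t) (F t (ψ t)) t := fun t => by
    simpa using (hw t).fun_add (hed t)
  have hzm : ∀ t ∈ Icc 0 T, w t + e t ∈ closedBall (0 : X) (R + 1) := fun t ht => by
    rw [mem_closedBall_zero_iff]
    linarith [norm_add_le (w t) (e t), hwR t ht, heE t ht]
  -- The constant is enlarged to be nonzero, which selects the exponential form of the Gronwall
  -- bound.
  have hl' : ∀ t, LipschitzOnWith (K + 1) (F t) (closedBall 0 (R + 1)) := fun t =>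
    (hl t).weaken (by simp)
  have h0 : e 0 = 0 := by simp [he]
  have key := dist_le_of_approx_trajectories_ODE_of_mem (v := F) (K := K + 1)
    (s := fun _ => closedBall 0 (R + 1)) (f := u) (g := fun t => w t + e t) (εf := 0)
    (εg := K * E) (δ := ‖u 0 - w 0‖) (a := 0) (b := T) (f' := g) (g' := fun t => F t (ψ t))
    (fun t _ => hl' t) huc.continuousOn (fun t _ => (hu t).hasDerivWithinAt)
    (fun t ht => by rw [hug t (Ico_subset_Icc_self ht), dist_self])
    (fun t ht => by
      rw [mem_closedBall_zero_iff]
      linarith [huR t (Ico_subset_Icc_self ht)])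
    (continuous_iff_continuousAt.2 fun t => (hzd t).continuousAt).continuousOn
    (fun t _ => (hzd t).hasDerivWithinAt)
    (fun t ht => by
      have ht' := Ico_subset_Icc_self ht
      refine ((hl t).dist_le_mul _ (hψm t) _ (hzm t ht')).trans ?_
      rw [hψw t ht', dist_eq_norm, sub_add_cancel_left, norm_neg]
      gcongr
      exact heE t ht')
    (fun t ht => hzm t (Ico_subset_Icc_self ht))
    (by simp [h0, dist_eq_norm])
  intro τ hτ
  have h1 := key τ hτ
  have hK : ((K + 1 : ℝ≥0) : ℝ) ≠ 0 := by positivity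
  rw [gronwallBound_of_K_ne_0 hK, dist_eq_norm, zero_add, sub_zero] at h1
  beta_reduce at h1
  have hK1 : ((K + 1 : ℝ≥0) : ℝ) = K + 1 := by push_cast; rfl
  rw [hK1] at h1
  have hexp : Real.exp ((K + 1) * τ) ≤ Real.exp ((K + 1) * T) := by
    gcongr
    exact hτ.2
  have hexp1 : 1 ≤ Real.exp ((K + 1) * τ) := Real.one_le_exp (by have := hτ.1; positivity)
  have h2 : K * E / (K + 1) ≤ E := by
    rw [div_le_iff₀ (by positivity)]
    nlinarith
  have h3 : ‖u τ - w τ‖ ≤ ‖u τ - (w τ + e τ)‖ + ‖e τ‖ := by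
    have : u τ - w τ = (u τ - (w τ + e τ)) + e τ := by abel
    rw [this]
    exact norm_add_le _ _
  calc ‖u τ - w τ‖ ≤ (‖u 0 - w 0‖ * Real.exp ((K + 1) * τ)
        + K * E / (K + 1) * (Real.exp ((K + 1) * τ) - 1)) + E := by linarith [heE τ hτ]
    _ ≤ (‖u 0 - w 0‖ * Real.exp ((K + 1) * τ) + E * (Real.exp ((K + 1) * τ) - 1))
        + E * Real.exp ((K + 1) * τ) := by
      refine add_le_add (add_le_add le_rfl (mul_le_mul_of_nonneg_right h2 ?_)) ?_
      · linarith
      · exact le_mul_of_one_le_right hE0 hexp1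
    _ ≤ (‖u 0 - w 0‖ + 2 * E) * Real.exp ((K + 1) * τ) := by linarith
    _ ≤ _ := by gcongr

variable {A : LinearPart d J} {S : Fin N → Fin J × KSpace d} {M : Finset ℕ} {Cχ : ℝ}
  {χ : Susceptibility d J}

variable (A S) in
theorem norm_mulOp_expProj_neg_le (r : ℝ) {a : ℝ} (ha : 0 ≤ a) (i : ℤˣ × Fin N) (f : L1 d J) :
    ‖mulOp (expProj A S r (-a) i) f‖ ≤ ‖f‖ := by
  simpa using norm_mulOp_apply_le (memLp_expProj A S r (-a) i) (C := 1)
    (Eventually.of_forall fun k => norm_expProj_le_one r (by linarith) i k) f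

theorem norm_assemble_le (r : ℝ) {a B : ℝ} (ha : 0 ≤ a) {v : ℤˣ × Fin N → L1 d J}
    (hv : ‖v‖ ≤ B) : ‖assemble A S r a v‖ ≤ 2 * N * B := by
  refine (norm_sum_le_of_le _ fun i _ => (norm_mulOp_expProj_neg_le A S r ha i (v i)).trans
    ((norm_le_pi_norm v i).trans hv)).trans ?_
  simp

/-- The exact solution stays close to a superposition of localized components. -/
theorem exists_localized_approximation (hχ : IsAdmissible A M Cχ χ) (hM : ∀ m ∈ M, 1 ≤ m)
    (hS : Function.Injective S) (hns : NonSingular A M S) (hri : ResonanceInvariant A M S)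
    {R T : ℝ} (hR : 0 ≤ R) (hT : 0 ≤ T)
    (hBT : (∑ m ∈ M, (2 * N : ℝ) ^ m * (|Cχ| * (2 * R) ^ m)) * T ≤ R) :
    ∃ D K : ℝ, 0 ≤ D ∧ 0 ≤ K ∧ ∀ᶠ r in 𝓝[>] (0 : ℝ), ∀ a ϱ : ℝ, 0 ≤ a → 0 < ϱ →
      D * (ϱ + Real.exp (-(a * r))) ≤ 1 →
      ∀ v₀ : ℤˣ × Fin N → L1 d J, ‖v₀‖ ≤ R →
      ∀ u g : ℝ → L1 d J, (∀ t, HasDerivAt u (g t) t) →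
        (∀ t ∈ Icc 0 T, g t = field A M χ (t / ϱ) (u t) ∧ ‖u t‖ ≤ 2 * R) →
        ∀ τ ∈ Icc 0 T, ∃ W : ℤˣ × Fin N → L1 d J,
          (∀ i, mulOp (expProj A S r 0 i) (W i) = W i) ∧ (∀ i, ‖W i‖ ≤ 2 * R) ∧
          ‖u τ - ∑ i, W i‖ ≤ K * (‖u 0 - assemble A S r a v₀‖ +
            2 * (D * (ϱ + Real.exp (-(a * r))))) := by
  have hB' : 0 ≤ ∑ m ∈ M, (2 * N : ℝ) ^ m * (|Cχ| * (2 * R) ^ m) :=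
    Finset.sum_nonneg fun _ _ => by positivity
  obtain ⟨D, hD, hev⟩ := exists_residual_bound (T := T) hχ hM hS hns hri
    (show 0 ≤ 2 * R by positivity) hB' hT
  -- One radius for both trajectories: 2R bounds the exact solution, and 2N components of size 2R
  -- bound the superposition.
  set R₂ : ℝ := 2 * R + 2 * N * (2 * R) with hR₂
  have hR₂0 : 0 ≤ R₂ + 1 := by positivity
  refine ⟨D, Real.exp (((fieldLip M Cχ (R₂ + 1)).toNNReal + 1) * T), hD, (Real.exp_pos _).le, ?_⟩
  filter_upwards [hev, eventually_outSeparated M S] with r hr hout a ϱ ha hϱ hE v₀ hv₀ u g hu hug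
    τ hτ
  obtain ⟨v, gv, hgv, hvd, hv0, hvg⟩ := exists_localized_solution (A := A) hχ hM hout ha ϱ v₀ hv₀
    hT hBT
  have hgB : ∀ t ∈ Icc 0 T, ‖gv t‖ ≤ ∑ m ∈ M, (2 * N : ℝ) ^ m * (|Cχ| * (2 * R) ^ m) :=
    fun t ht => by
      rw [(hvg t ht).1]
      exact norm_locField_le hχ hM hout ha _ (by positivity) (hvg t ht).2
  have hres := hr a ϱ ha hϱ v gv hgv hvd (fun t ht => (hvg t ht).2) hgB
  set w' : ℝ → L1 d J := fun t => ∑ i, mulOp (expProj A S r (-a) i) (gv t i) with hw'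
  have hw'c : Continuous w' := continuous_finsetSum _ fun i _ =>
    (mulOp (expProj A S r (-a) i)).continuous.comp ((continuous_apply i).comp hgv)
  have hwd : ∀ t, HasDerivAt (fun t => assemble A S r a (v t)) (w' t) t := fun t => by
    refine HasDerivAt.fun_sum fun i _ => ?_
    exact ((mulOp (expProj A S r (-a) i)).restrictScalars ℝ).hasFDerivAt.comp_hasDerivAt t
      (hasDerivAt_pi.1 (hvd t) i)
  have hw'eq : ∀ t ∈ Icc 0 T, w' t =
      ∑ i, mulOp (expProj A S r 0 i) (field A M χ (t / ϱ) (assemble A S r a (v t))) :=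
    fun t ht => Finset.sum_congr rfl fun i _ => by
      rw [(hvg t ht).1, mulOp_locField hχ hM]
  have hdef : ∀ τ ∈ Icc 0 T, ‖∫ t in (0 : ℝ)..τ,
      (field A M χ (t / ϱ) (assemble A S r a (v t)) - w' t)‖ ≤
        D * (ϱ + Real.exp (-(a * r))) := fun τ hτ => by
    refine le_of_eq_of_le (congrArg norm (intervalIntegral.integral_congr fun t ht => ?_))
      (hres τ hτ)
    rw [uIcc_of_le hτ.1] at ht
    simp only [hw'eq t ⟨ht.1, ht.2.trans hτ.2⟩]
  have key := norm_sub_le_of_integral_defect (F := fun t => field A M χ (t / ϱ)) (R := R₂) hT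
    (fun x => (continuous_field hχ hM x).comp (continuous_id.div_const ϱ))
    (fun t => lipschitzOnWith_field hχ hM _ hR₂0) hu (fun t ht => (hug t ht).1)
    (fun t ht => (hug t ht).2.trans (le_add_of_nonneg_right (by positivity)))
    hwd hw'c
    (fun t ht => (norm_assemble_le r ha (hvg t ht).2).trans (by rw [hR₂]; linarith)) hE hdef τ hτ
  refine ⟨fun i => mulOp (expProj A S r (-a) i) (v τ i), fun i => ?_, fun i => ?_, ?_⟩
  · rw [mulOp_expProj_mulOp, zero_add]
  · exact (norm_mulOp_expProj_neg_le A S r ha i _).trans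
      ((norm_le_pi_norm (v τ) i).trans (hvg τ hτ).2)
  · rw [hv0] at key
    exact key.trans_eq (mul_comm _ _)

end

/-! ### Small β: decomposition of wavepackets and choice of scales. -/

section

open scoped ENNReal NNReal
open Filter Topology Metric

variable {d J N : ℕ}

/-! ### Small parameters -/

theorem tendsto_rpow_nhdsGT_zero {p : ℝ} (hp : 0 < p) :
    Tendsto (fun β : ℝ => β ^ p) (𝓝[>] 0) (𝓝[>] 0) := by
  refine tendsto_nhdsWithin_iff.2 ⟨?_, ?_⟩
  · have := (Real.continuous_rpow_const hp.le).tendsto 0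
    rw [Real.zero_rpow hp.ne'] at this
    exact this.mono_left nhdsWithin_le_nhds
  · filter_upwards [self_mem_nhdsWithin] with β hβ using Real.rpow_pos_of_pos hβ p

theorem eventually_mul_rpow_le_one (C : ℝ) {s : ℝ} (hs : 0 < s) :
    ∀ᶠ β in 𝓝[>] (0 : ℝ), C * β ^ s ≤ 1 := by
  have h := ((tendsto_rpow_nhdsGT_zero hs).mono_right nhdsWithin_le_nhds).const_mul C
  rw [mul_zero] at h
  exact (h.eventually_lt_const one_pos).mono fun _ => le_of_lt

theorem eventually_exp_neg_rpow_le {δ : ℝ} (hδ : 0 < δ) (s : ℝ) :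
    ∀ᶠ β in 𝓝[>] (0 : ℝ), Real.exp (-β ^ (-δ)) ≤ β ^ s := by
  have h1 : ∀ᶠ y in atTop, Real.exp (-(1 : ℝ) * y) ≤ y ^ (-s / δ) := by
    filter_upwards [(isLittleO_exp_neg_mul_rpow_atTop one_pos (-s / δ)).bound one_pos,
      eventually_gt_atTop 0] with y hy hy0
    rwa [Real.norm_of_nonneg (Real.exp_pos _).le,
      Real.norm_of_nonneg (Real.rpow_pos_of_pos hy0 _).le, one_mul] at hy
  have h2 : Tendsto (fun β : ℝ => β ^ (-δ)) (𝓝[>] 0) atTop := by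
    refine (tendsto_inv_nhdsGT_zero.comp (tendsto_rpow_nhdsGT_zero hδ)).congr' ?_
    filter_upwards [self_mem_nhdsWithin] with β hβ
    rw [Real.rpow_neg (le_of_lt hβ)]
    rfl
  filter_upwards [h2.eventually h1, self_mem_nhdsWithin] with β hβ hβ0
  rw [← Real.rpow_mul (le_of_lt hβ0), neg_one_mul] at hβ
  rwa [show -δ * (-s / δ) = s by field_simp] at hβ

theorem exists_Ioo_of_eventually_nhdsGT {P : ℝ → Prop} (h : ∀ᶠ β in 𝓝[>] (0 : ℝ), P β) :
    ∃ β₀ : ℝ, 0 < β₀ ∧ ∀ β ∈ Ioo 0 β₀, P β := by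
  obtain ⟨β₀, hβ₀, hsub⟩ := (mem_nhdsGT_iff_exists_Ioo_subset).1 h
  exact ⟨β₀, hβ₀, fun β hβ => hsub hβ⟩

/-! ### Components of wavepackets -/

variable {A : LinearPart d J} {S : Fin N → Fin J × KSpace d}

theorem expProj_comp_of_le {r r' : ℝ} (h : r' ≤ r) (b b' : ℝ) (i : ℤˣ × Fin N) (k : KSpace d) :
    (expProj A S r b i k).comp (expProj A S r' b' i k) = expProj A S r' (b + b') i k := by
  by_cases hk : ‖k - center S i‖ ≤ r'
  · rw [← expProj_comp r' b b' i k, expProj_of_le (hk.trans h), expProj_of_le (b := b) hk]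
  · simp [expProj_of_not_le hk]

theorem mulOp_expProj_mulOp_of_le {r r' : ℝ} (h : r' ≤ r) (b b' : ℝ) (i : ℤˣ × Fin N)
    (f : L1 d J) : mulOp (expProj A S r b i) (mulOp (expProj A S r' b' i) f) =
      mulOp (expProj A S r' (b + b') i) f := by
  rw [mulOp_mulOp (memLp_expProj A S r b i) (memLp_expProj A S r' b' i)]
  congr 2
  funext k
  exact expProj_comp_of_le h b b' i k

theorem mulOp_expProj_zero_of_le {r r' : ℝ} (h : r' ≤ r) {i : ℤˣ × Fin N} {f : L1 d J}
    (hf : mulOp (expProj A S r' 0 i) f = f) : mulOp (expProj A S r 0 i) f = f := by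
  have := mulOp_expProj_mulOp_of_le (A := A) (S := S) h 0 0 i f
  rwa [zero_add, hf] at this

/-- All cross terms vanish by mutual annihilation. Components can thus be read off from their sum by
operators of norm at most 1, which gives both the bounds on the data and the uniqueness of
decompositions. -/
theorem mulOp_expProj_sum (hS : Function.Injective S) {r : ℝ} (hr : Separated S r) {κ : Type*}
    [Fintype κ] {e : κ → ℤˣ × Fin N} (he : Function.Injective e) {F : κ → L1 d J}
    (hF : ∀ b, mulOp (expProj A S r 0 (e b)) (F b) = F b) (b : κ) :
    mulOp (expProj A S r 0 (e b)) (∑ c, F c) = F b := by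
  rw [map_sum, Finset.sum_eq_single b (fun c _ hc => ?_) (by simp), hF b]
  rw [← hF c]
  exact mulOp_expProj_mulOp_of_ne A S hS hr (he.ne hc.symm) 0 0 _

theorem norm_le_norm_sum_of_expProj (hS : Function.Injective S) {r : ℝ} (hr : Separated S r)
    {κ : Type*} [Fintype κ] {e : κ → ℤˣ × Fin N} (he : Function.Injective e) {F : κ → L1 d J}
    (hF : ∀ b, mulOp (expProj A S r 0 (e b)) (F b) = F b) (b : κ) : ‖F b‖ ≤ ‖∑ c, F c‖ := by
  have h := norm_mulOp_expProj_neg_le A S r (a := 0) le_rfl (e b) (∑ c, F c)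
  rwa [neg_zero, mulOp_expProj_sum hS hr he hF b] at h

theorem cutoffAt_smul_proj {r : ℝ} (hr : 0 < r) (i : ℤˣ × Fin N) (k : KSpace d) (x : Amp J) :
    cutoffAt (center S i) r k • A.proj (S i.2).1 i.1 k x = expProj A S r 0 i k x := by
  have e : ‖r⁻¹ • (k - center S i)‖ ≤ 1 ↔ ‖k - center S i‖ ≤ r := by
    rw [norm_smul, norm_inv, Real.norm_of_nonneg hr.le, inv_mul_le_iff₀ hr, mul_one]
  by_cases h : ‖k - center S i‖ ≤ r
  · rw [expProj_zero_of_le h, cutoffAt, cutoff, if_pos (e.2 h), one_smul]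
  · rw [expProj_of_not_le h, cutoffAt, cutoff, if_neg (mt e.1 h), zero_smul]
    rfl

theorem mulOp_expProj_eq_self_iff {r : ℝ} (hr : 0 < r) (i : ℤˣ × Fin N) (f : L1 d J) :
    mulOp (expProj A S r 0 i) f = f ↔
      ∀ᵐ k, f k = cutoffAt (center S i) r k • A.proj (S i.2).1 i.1 k (f k) := by
  simp only [cutoffAt_smul_proj hr]
  have h := mulOp_coeFn (memLp_expProj A S r 0 i) f
  constructor
  · intro he
    rw [he] at h
    exact h
  · exact fun he => Lp.ext (h.trans (EventuallyEq.symm he))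

theorem sum_units_int {X : Type*} [AddCommMonoid X] (f : ℤˣ → X) : ∑ ζ, f ζ = f (-1) + f 1 := by
  rw [UnitsInt.univ, Finset.sum_pair (by decide), add_comm]

/-- A wavepacket in terms of localized projections. -/
theorem isWavepacket_iff {ε s : ℝ} {l : Fin N} {h : ℝ → L1 d J} :
    IsWavepacket A ε s (S l) h ↔ ∃ C C' : ℝ, ∀ᶠ β in 𝓝[>] (0 : ℝ), ‖h β‖ ≤ C ∧
      ∃ f : ℤˣ → L1 d J, (∀ ζ, mulOp (expProj A S (β ^ (1 - ε)) 0 (ζ, l)) (f ζ) = f ζ) ∧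
        ‖h β - ∑ ζ, f ζ‖ ≤ C' * β ^ s := by
  constructor
  · rintro ⟨β₀, hβ₀, ⟨C, hC⟩, f, D, hsum, hf, C', hD⟩
    refine ⟨C, C', ?_⟩
    filter_upwards [Ioo_mem_nhdsGT hβ₀] with β hβ
    refine ⟨hC β hβ, fun ζ => f ζ β, fun ζ => ?_, ?_⟩
    · exact (mulOp_expProj_eq_self_iff (Real.rpow_pos_of_pos hβ.1 _) (ζ, l) _).2 (hf ζ β hβ)
    · rw [sum_units_int, hsum β hβ, add_sub_cancel_left]
      exact hD β hβ
  · rintro ⟨C, C', hev⟩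
    -- No regularity in β is required, so the components are chosen separately for each β.
    obtain ⟨f, hf⟩ := (hev.mono fun β hβ => hβ.2).choice
    obtain ⟨β₀, hβ₀, hall⟩ := exists_Ioo_of_eventually_nhdsGT (hev.and hf)
    refine ⟨β₀, hβ₀, ⟨C, fun β hβ => (hall β hβ).1.1⟩, fun ζ β => f β ζ,
      fun β => h β - ∑ ζ, f β ζ, fun β _ => ?_, fun ζ β hβ => ?_, C', fun β hβ => (hall β hβ).2.2⟩
    · simp only [sum_units_int]
      abel
    · exact (mulOp_expProj_eq_self_iff (Real.rpow_pos_of_pos hβ.1 _) (ζ, l) _).1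
        ((hall β hβ).2.1 ζ)

/-- The whole remainder is put into the tail of a single wavepacket, which is why at least one pair
is needed. -/
theorem isMultiWavepacket_of_components {ε s C : ℝ} (hs : 0 < s) (hN : 0 < N) {U : ℝ → L1 d J}
    (h : ∀ᶠ β in 𝓝[>] (0 : ℝ), ∃ W : ℤˣ × Fin N → L1 d J,
      (∀ i, mulOp (expProj A S (β ^ (1 - ε)) 0 i) (W i) = W i) ∧ (∀ i, ‖W i‖ ≤ C) ∧
        ‖U β - ∑ i, W i‖ ≤ C * β ^ s) :
    IsMultiWavepacket A ε s S U := by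
  obtain ⟨W, hW⟩ := h.choice
  set l₀ : Fin N := ⟨0, hN⟩
  have hD : ∀ (l : Fin N) β, ‖(if l = l₀ then U β - ∑ i, W β i else 0)‖ ≤ ‖U β - ∑ i, W β i‖ := by
    intro l β
    split_ifs
    · exact le_rfl
    · simp
  refine ⟨fun l β => (∑ ζ, W β (ζ, l)) + if l = l₀ then U β - ∑ i, W β i else 0, fun l => ?_,
    1, one_pos, fun β _ => ?_⟩
  · refine isWavepacket_iff.2 ⟨2 * C + 1, C, ?_⟩
    filter_upwards [hW, eventually_mul_rpow_le_one C hs] with β hβ hβs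
    refine ⟨?_, fun ζ => W β (ζ, l), fun ζ => hβ.1 _, ?_⟩
    · refine (norm_add_le _ _).trans (add_le_add ?_ ((hD l β).trans (hβ.2.2.trans hβs)))
      refine (norm_sum_le_of_le _ fun ζ _ => hβ.2.1 (ζ, l)).trans ?_
      simp
    · rw [add_sub_cancel_left]
      exact (hD l β).trans hβ.2.2
  · rw [Finset.sum_add_distrib, Finset.sum_ite_eq' Finset.univ l₀, if_pos (Finset.mem_univ _),
      Fintype.sum_prod_type_right]
    abel

/-- The localized parts of the two decompositions differ, in total, by the tails alone, hence by
O(β^s). Projecting this total onto one component bounds the corresponding difference. -/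
theorem equivalent_of_isPresentation (hS : Function.Injective S) {ε s : ℝ} (hε : ε < 1)
    {U : ℝ → L1 d J} {w w' : Fin N → ℝ → L1 d J} (hw : IsPresentation A ε s S U w)
    (hw' : IsPresentation A ε s S U w') (l : Fin N) : Equivalent s (w l) (w' l) := by
  obtain ⟨hwp, β₀, hβ₀, hsum⟩ := hw
  obtain ⟨hwp', β₀', hβ₀', hsum'⟩ := hw'
  choose C₁ C hC using fun l => isWavepacket_iff.1 (hwp l)
  choose C₁' C' hC' using fun l => isWavepacket_iff.1 (hwp' l)
  have hsep := (tendsto_rpow_nhdsGT_zero (sub_pos.2 hε)).eventually (eventually_separated S)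
  have hev : ∀ᶠ β in 𝓝[>] (0 : ℝ), ‖w l β - w' l β‖ ≤
      (C l + C' l + 2 * ∑ l, (C l + C' l)) * β ^ s := by
    filter_upwards [eventually_all.2 hC, eventually_all.2 hC', hsep, Ioo_mem_nhdsGT hβ₀,
      Ioo_mem_nhdsGT hβ₀'] with β h h' hr hβ hβ'
    choose f hf hfD using fun l => (h l).2
    choose f' hf' hfD' using fun l => (h' l).2
    have hDD : ∀ l, ‖(w l β - ∑ ζ, f l ζ) - (w' l β - ∑ ζ, f' l ζ)‖ ≤ (C l + C' l) * β ^ s :=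
      fun l => (norm_sub_le _ _).trans (by linarith [hfD l, hfD' l])
    set F : ℤˣ × Fin N → L1 d J := fun i => f i.2 i.1 - f' i.2 i.1 with hF
    have hFs : ∀ i, mulOp (expProj A S (β ^ (1 - ε)) 0 i) (F i) = F i := fun i => by
      rw [hF, map_sub, hf, hf']
    have htot : ‖∑ i, F i‖ ≤ (∑ l, (C l + C' l)) * β ^ s := by
      have e : ∑ i, F i =
          -∑ l, ((w l β - ∑ ζ, f l ζ) - (w' l β - ∑ ζ, f' l ζ)) := by
        have e1 : ∑ l, w l β = ∑ l, w' l β := (hsum β hβ).symm.trans (hsum' β hβ')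
        rw [Fintype.sum_prod_type_right]
        simp only [hF, Finset.sum_sub_distrib, e1]
        abel
      rw [e, norm_neg, Finset.sum_mul]
      exact norm_sum_le_of_le _ fun l _ => hDD l
    have hFi : ∀ i, ‖F i‖ ≤ (∑ l, (C l + C' l)) * β ^ s := fun i =>
      (norm_le_norm_sum_of_expProj hS hr Function.injective_id hFs i).trans htot
    have e : w l β - w' l β =
        ((w l β - ∑ ζ, f l ζ) - (w' l β - ∑ ζ, f' l ζ)) + ∑ ζ, F (ζ, l) := by
      simp only [hF, Finset.sum_sub_distrib]
      abel
    rw [e]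
    refine (norm_add_le_of_le (hDD l) (norm_sum_le_of_le _ fun ζ _ => hFi (ζ, l))).trans
      (le_of_eq ?_)
    simp only [Finset.sum_const, Finset.card_univ, Fintype.card_units_int, nsmul_eq_mul]
    push_cast
    ring
  obtain ⟨β₂, hβ₂, hall⟩ := exists_Ioo_of_eventually_nhdsGT hev
  exact ⟨β₂, _, hβ₂, hall⟩

/-- The components of the initial data of a multi-wavepacket, in the weighted variables. -/
theorem exists_weighted_data (hS : Function.Injective S) {ε ε' s : ℝ} (hε : ε < 1) (hεε' : ε ≤ ε')
    (hs : 0 < s) {hl : Fin N → ℝ → L1 d J} (hhl : ∀ l, IsWavepacket A ε s (S l) (hl l))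
    {R : ℝ} (hR : 0 ≤ R) (hlR : ∀ᶠ β in 𝓝[>] (0 : ℝ), ∀ l, ‖hl l β‖ ≤ R) :
    ∃ C : ℝ, ∀ᶠ β in 𝓝[>] (0 : ℝ), ∃ v₀ : ℤˣ × Fin N → L1 d J, ‖v₀‖ ≤ 3 * (R + 1) ∧
      ‖∑ l, hl l β - assemble A S (β ^ (1 - ε')) (β ^ (-(1 - ε))) v₀‖ ≤ C * β ^ s := by
  choose C₁ C hC using fun l => isWavepacket_iff.1 (hhl l)
  have hsep := (tendsto_rpow_nhdsGT_zero (sub_pos.2 hε)).eventually (eventually_separated S)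
  refine ⟨∑ l, C l, ?_⟩
  filter_upwards [eventually_all.2 hC, hsep, hlR, Ioo_mem_nhdsGT one_pos,
    eventually_all.2 fun l => eventually_mul_rpow_le_one (C l) hs] with β h hr hβR hβ hβs
  choose f hf hfD using fun l => (h l).2
  set r₀ := β ^ (1 - ε) with hr₀
  set r := β ^ (1 - ε') with hr'
  set a := β ^ (-(1 - ε)) with ha
  have hle : r₀ ≤ r := Real.rpow_le_rpow_of_exponent_ge hβ.1 hβ.2.le (by linarith)
  have ha0 : 0 ≤ a := (Real.rpow_pos_of_pos hβ.1 _).le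
  -- The weight exponent is the inverse of the radius of the data, so on the support of the data the
  -- weight is at most e < 3.
  have har : a * r₀ = 1 := by
    rw [ha, hr₀, ← Real.rpow_add hβ.1, neg_add_cancel, Real.rpow_zero]
  set F : ℤˣ × Fin N → L1 d J := fun i => f i.2 i.1 with hF
  have hFs : ∀ i, mulOp (expProj A S r₀ 0 i) (F i) = F i := fun i => hf i.2 i.1
  -- Each sign component is a projection of the wavepacket minus its tail, and for small β the tail
  -- has norm at most 1.
  have hFR : ∀ i, ‖F i‖ ≤ R + 1 := fun i => by
    refine (norm_le_norm_sum_of_expProj hS hr (e := fun ζ => (ζ, i.2))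
      (fun ζ ζ' hζ => (Prod.ext_iff.1 hζ).1) (fun ζ => hf i.2 ζ) i.1).trans ?_
    have e : ∑ ζ, f i.2 ζ = hl i.2 β - (hl i.2 β - ∑ ζ, f i.2 ζ) := by abel
    rw [e]
    exact (norm_sub_le _ _).trans (add_le_add (hβR i.2) ((hfD i.2).trans (hβs i.2)))
  refine ⟨fun i => mulOp (expProj A S r a i) (F i), ?_, ?_⟩
  · refine (pi_norm_le_iff_of_nonneg (by positivity)).2 fun i => ?_
    -- The cutoff may be shrunk from `r` to the radius `r₀` of the data; the bound exp(a·r) would be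
    -- useless.
    have e : mulOp (expProj A S r a i) (F i) = mulOp (expProj A S r₀ a i) (F i) := by
      rw [← hFs i, mulOp_expProj_mulOp_of_le hle, hFs i, add_zero]
    rw [e]
    refine (norm_mulOp_apply_le (memLp_expProj A S r₀ a i)
      (Eventually.of_forall fun k => norm_expProj_le_exp r₀ a ha0 i k) (F i)).trans ?_
    rw [har]
    exact mul_le_mul (by linarith [Real.exp_one_lt_d9]) (hFR i) (norm_nonneg _) (by norm_num)
  · have e : assemble A S r a (fun i => mulOp (expProj A S r a i) (F i)) = ∑ l, ∑ ζ, f l ζ := by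
      rw [assemble, ← Fintype.sum_prod_type_right (f := F)]
      refine Finset.sum_congr rfl fun i _ => ?_
      rw [mulOp_expProj_mulOp, neg_add_cancel]
      exact mulOp_expProj_zero_of_le hle (hFs i)
    rw [e, ← Finset.sum_sub_distrib, Finset.sum_mul]
    exact norm_sum_le_of_le _ fun l _ => hfD l

/-! ### Preservation of multi-wavepackets -/

variable {M : Finset ℕ} {Cχ : ℝ} {χ : Susceptibility d J}

/-- The scales are a = β^(-(1-ε)), adapted to the data, and r = β^(1-ε'), the slightly larger output
radius. The gap ε' > ε makes a·r diverge, so e^{-ar} is below β^s. -/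
theorem exists_components (hχ : IsAdmissible A M Cχ χ) (hM : ∀ m ∈ M, 1 ≤ m)
    (hS : Function.Injective S) (hns : NonSingular A M S) (hri : ResonanceInvariant A M S)
    {ε ε' s : ℝ} (hε' : ε' ∈ Ioo ε 1) (hs : 0 < s) {hl : Fin N → ℝ → L1 d J}
    (hhl : ∀ l, IsWavepacket A ε s (S l) (hl l)) {R T : ℝ} (hR : 0 ≤ R) (hT : 0 ≤ T)
    (hBT : (∑ m ∈ M, (2 * N : ℝ) ^ m * (|Cχ| * (2 * (3 * (R + 1))) ^ m)) * T ≤ 3 * (R + 1))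
    {C : ℝ} {ρ : ℝ → ℝ} {u g : ℝ → ℝ → L1 d J}
    (hev : ∀ᶠ β in 𝓝[>] (0 : ℝ), (∀ l, ‖hl l β‖ ≤ R) ∧ (0 < ρ β ∧ ρ β ≤ C * β ^ s) ∧
      (∀ t, HasDerivAt (u β) (g β t) t) ∧ u β 0 = ∑ l, hl l β ∧
      ∀ t ∈ Icc 0 T, g β t = field A M χ (t / ρ β) (u β t) ∧ ‖u β t‖ ≤ 2 * (3 * (R + 1)))
    {τ : ℝ} (hτ : τ ∈ Icc 0 T) :
    ∃ C' : ℝ, ∀ᶠ β in 𝓝[>] (0 : ℝ), ∃ W : ℤˣ × Fin N → L1 d J,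
      (∀ i, mulOp (expProj A S (β ^ (1 - ε')) 0 i) (W i) = W i) ∧ (∀ i, ‖W i‖ ≤ C') ∧
        ‖u β τ - ∑ i, W i‖ ≤ C' * β ^ s := by
  obtain ⟨D, K, hD, hK, happ⟩ := exists_localized_approximation (A := A) (T := T) hχ hM hS hns hri
    (show 0 ≤ 3 * (R + 1) by positivity) hT hBT
  obtain ⟨C₀, hdata⟩ := exists_weighted_data hS (hε'.1.trans hε'.2) hε'.1.le hs hhl hR
    (hev.mono fun β h => h.1)
  refine ⟨max (2 * (3 * (R + 1))) (K * (C₀ + 2 * (D * (C + 1)))), ?_⟩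
  filter_upwards [(tendsto_rpow_nhdsGT_zero (sub_pos.2 hε'.2)).eventually happ, hdata, hev,
    eventually_exp_neg_rpow_le (sub_pos.2 hε'.1) s, eventually_mul_rpow_le_one (D * (C + 1)) hs,
    self_mem_nhdsWithin] with β h1 h2 h3 hexp hsmall hβ
  obtain ⟨v₀, hv₀, hv₀'⟩ := h2
  obtain ⟨-, hρ, hud, hu0, hu⟩ := h3
  have hβ0 : 0 < β := hβ
  have e : β ^ (-(1 - ε)) * β ^ (1 - ε') = β ^ (-(ε' - ε)) := by
    rw [← Real.rpow_add hβ0]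
    congr 1
    ring
  have hE : D * (ρ β + Real.exp (-(β ^ (-(1 - ε)) * β ^ (1 - ε')))) ≤ D * (C + 1) * β ^ s := by
    rw [e, mul_assoc]
    gcongr
    linarith [hρ.2]
  obtain ⟨W, hW, hWn, hWu⟩ := h1 _ _ (Real.rpow_pos_of_pos hβ0 (-(1 - ε))).le hρ.1
    (hE.trans hsmall) v₀ hv₀ (u β) (g β) hud hu τ hτ
  refine ⟨W, hW, fun i => (hWn i).trans (le_max_left _ _), hWu.trans ?_⟩
  rw [hu0]
  calc K * (‖∑ l, hl l β - assemble A S (β ^ (1 - ε')) (β ^ (-(1 - ε))) v₀‖ +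
        2 * (D * (ρ β + Real.exp (-(β ^ (-(1 - ε)) * β ^ (1 - ε'))))))
      ≤ K * (C₀ * β ^ s + 2 * (D * (C + 1) * β ^ s)) := by gcongr
    _ = K * (C₀ + 2 * (D * (C + 1))) * β ^ s := by ring
    _ ≤ _ := by
      gcongr
      exact le_max_right _ _

/-- The radius of the balls on which the evolution is controlled. -/
def dataRadius {N : ℕ} (R : Fin N → ℝ) : ℝ := 3 * ((∑ l, |R l|) + 1)

/-- The bound of the vector fields on these balls. -/
def speedBound (M : Finset ℕ) (Cχ : ℝ) {N : ℕ} (R : Fin N → ℝ) : ℝ :=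
  ∑ m ∈ M, (2 * N + 1 : ℝ) ^ m * (|Cχ| * (2 * dataRadius R) ^ m)

/-- The length of the time interval. -/
def lifespan (M : Finset ℕ) (Cχ : ℝ) (N : ℕ) (R : Fin N → ℝ) : ℝ :=
  dataRadius R / (speedBound M Cχ R + 1)

theorem dataRadius_pos (R : Fin N → ℝ) : 0 < dataRadius R := by
  have : 0 ≤ ∑ l, |R l| := Finset.sum_nonneg fun _ _ => abs_nonneg _
  rw [dataRadius]
  positivity

theorem speedBound_nonneg (M : Finset ℕ) (Cχ : ℝ) (R : Fin N → ℝ) : 0 ≤ speedBound M Cχ R :=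
  Finset.sum_nonneg fun _ _ => by
    have := dataRadius_pos R
    positivity

theorem lifespan_pos (M : Finset ℕ) (Cχ : ℝ) (N : ℕ) (R : Fin N → ℝ) : 0 < lifespan M Cχ N R :=
  div_pos (dataRadius_pos R) (by linarith [speedBound_nonneg M Cχ R])

theorem mul_lifespan_le {R : Fin N → ℝ} {B : ℝ} (hB : B ≤ speedBound M Cχ R) :
    B * lifespan M Cχ N R ≤ dataRadius R := by
  have h := speedBound_nonneg M Cχ R
  rw [lifespan, ← mul_div_assoc, div_le_iff₀ (by linarith), mul_comm]
  exact mul_le_mul_of_nonneg_left (by linarith) (dataRadius_pos R).le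

/-- The base 2N + 1 in `speedBound` dominates both 1, for the exact field, and 2N, for the localized
system, so a common lifespan serves both, including N = 0. -/
theorem sum_exact_le_speedBound (R : Fin N → ℝ) :
    ∑ m ∈ M, |Cχ| * (2 * dataRadius R) ^ m ≤ speedBound M Cχ R := by
  have := dataRadius_pos R
  refine Finset.sum_le_sum fun m _ => le_mul_of_one_le_left (by positivity) (one_le_pow₀ ?_)
  linarith [Nat.cast_nonneg (α := ℝ) N]

theorem sum_localized_le_speedBound (R : Fin N → ℝ) :
    ∑ m ∈ M, (2 * N : ℝ) ^ m * (|Cχ| * (2 * dataRadius R) ^ m) ≤ speedBound M Cχ R := by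
  have := dataRadius_pos R
  refine Finset.sum_le_sum fun m _ => ?_
  gcongr
  linarith

end

end Wavepacket

end

/-! ### Preservation of multi-wavepackets. -/

theorem theorem1 (d J : ℕ) (M : Finset ℕ) (hM : ∀ m ∈ M, 2 ≤ m) (Cχ : ℝ) :
    ∃ τs : (N : ℕ) → (Fin N → ℝ) → ℝ, (∀ N R, 0 < τs N R) ∧
      ∀ (A : Wavepacket.LinearPart d J) (χ : Wavepacket.Susceptibility d J),
        Wavepacket.IsAdmissible A M Cχ χ →
      ∀ (N : ℕ) (S : Fin N → Fin J × Wavepacket.KSpace d), Function.Injective S →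
        Wavepacket.NonSingular A M S → Wavepacket.ResonanceInvariant A M S →
      ∀ ε s : ℝ, 0 < ε → ε < 1 → 0 < s →
      ∀ (β₁ : ℝ), 0 < β₁ →
      ∀ (h : ℝ → Wavepacket.L1 d J) (hl : Fin N → ℝ → Wavepacket.L1 d J),
        (∀ l, Wavepacket.IsWavepacket A ε s (S l) (hl l)) →
        (∀ β ∈ Set.Ioo 0 β₁, h β = ∑ l, hl l β) →
      ∀ R : Fin N → ℝ, (∀ l, ∀ β ∈ Set.Ioo 0 β₁, ‖hl l β‖ ≤ R l) →
      ∀ (C : ℝ) (ρ : ℝ → ℝ), (∀ β ∈ Set.Ioo 0 β₁, 0 < ρ β ∧ ρ β ≤ C * β ^ s) →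
      ∃ u : ℝ → ℝ → Wavepacket.L1 d J,
        (∀ β ∈ Set.Ioo 0 β₁,
          Wavepacket.IsSolution A M χ (ρ β) (h β) (τs N R) (u β) ∧
          ∀ v : ℝ → Wavepacket.L1 d J,
            Wavepacket.IsSolution A M χ (ρ β) (h β) (τs N R) v →
            Set.EqOn v (u β) (Set.Icc 0 (τs N R))) ∧
        ∀ τ ∈ Set.Icc 0 (τs N R), ∀ ε' ∈ Set.Ioo ε 1,
          Wavepacket.IsMultiWavepacket A ε' s S (fun β => u β τ) ∧
          ∀ w w' : Fin N → ℝ → Wavepacket.L1 d J,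
            Wavepacket.IsPresentation A ε' s S (fun β => u β τ) w →
            Wavepacket.IsPresentation A ε' s S (fun β => u β τ) w' →
            ∀ l, Wavepacket.Equivalent s (w l) (w' l) := by
  open Wavepacket in
  refine ⟨lifespan M Cχ, lifespan_pos M Cχ, ?_⟩
  intro A χ hχ N S hS hns hri ε s hε hε1 hs β₁ hβ₁ h hl hhl hsum R hR C ρ hρ
  have hM1 : ∀ m ∈ M, 1 ≤ m := fun m hm => one_le_two.trans (hM m hm)
  have hT := (lifespan_pos M Cχ N R).le
  have hRs : ∀ l, R l ≤ ∑ l, |R l| := fun l => (le_abs_self _).trans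
    (Finset.single_le_sum (f := fun l => |R l|) (fun _ _ => abs_nonneg _) (Finset.mem_univ l))
  have hR0 : 0 ≤ ∑ l, |R l| := Finset.sum_nonneg fun _ _ => abs_nonneg _
  -- The family u is fixed here, before τ and ε'. Only the localized comparison depends on them.
  have hex : ∀ β, ∃ u g : ℝ → L1 d J, β ∈ Ioo 0 β₁ → Continuous g ∧
      (∀ t, HasDerivAt u (g t) t) ∧ u 0 = h β ∧ ∀ t ∈ Icc 0 (lifespan M Cχ N R),
        g t = field A M χ (t / ρ β) (u t) ∧ ‖u t‖ ≤ 2 * dataRadius R := by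
    intro β
    by_cases hβ : β ∈ Ioo 0 β₁
    · have hh : ‖h β‖ ≤ dataRadius R := by
        rw [hsum β hβ, dataRadius]
        have := norm_sum_le_of_le Finset.univ fun l _ => (hR l β hβ).trans (le_abs_self _)
        linarith
      obtain ⟨u, g, hug⟩ := exists_exact_solution hχ hM1 (ρ β) (h β) hh hT
        (mul_lifespan_le (sum_exact_le_speedBound R))
      exact ⟨u, g, fun _ => hug⟩
    · exact ⟨0, 0, fun hβ' => absurd hβ' hβ⟩
  choose u g hug using hex
  have hsol : ∀ β ∈ Ioo 0 β₁, IsSolution A M χ (ρ β) (h β) (lifespan M Cχ N R) (u β) :=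
    fun β hβ => isSolution_of_hasDerivAt hχ hM1 (hug β hβ).1 (hug β hβ).2.1 (hug β hβ).2.2.1
      fun t ht => ((hug β hβ).2.2.2 t ht).1
  refine ⟨u, fun β hβ => ⟨hsol β hβ, fun v hv => eqOn_of_isSolution hχ hM1 (hsol β hβ) hv⟩,
    fun τ hτ ε' hε' => ⟨?_, fun w w' hw hw' => equivalent_of_isPresentation hS hε'.2 hw hw'⟩⟩
  -- With an empty spectrum there is no wavepacket to absorb a remainder. The data then vanish, and
  -- by uniqueness so does the solution, as every nonlinear term has positive degree.
  rcases Nat.eq_zero_or_pos N with rfl | hN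
  · refine ⟨fun _ _ => 0, fun l => l.elim0, β₁, hβ₁, fun β hβ => ?_⟩
    have h0 : h β = 0 := by
      rw [hsum β hβ]
      rfl
    have hz : IsSolution A M χ (ρ β) (h β) (lifespan M Cχ 0 R) fun _ => 0 := by
      rw [h0]
      exact isSolution_of_hasDerivAt hχ hM1 continuous_const (fun t => hasDerivAt_const t _) rfl
        fun t _ => (field_zero hM1 _).symm
    exact (eqOn_of_isSolution hχ hM1 (hsol β hβ) hz hτ).symm
  · obtain ⟨C', hC'⟩ := exists_components hχ hM1 hS hns hri hε' hs hhl hR0 hT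
      (mul_lifespan_le (sum_localized_le_speedBound R)) (C := C) (ρ := ρ) (u := u) (g := g) (by
        filter_upwards [Ioo_mem_nhdsGT hβ₁] with β hβ
        exact ⟨fun l => (hR l β hβ).trans (hRs l), hρ β hβ, (hug β hβ).2.1,
          (hug β hβ).2.2.1.trans (hsum β hβ), (hug β hβ).2.2.2⟩) hτ
    exact isMultiWavepacket_of_components hs hN hC'
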